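/- Let $(X_t,\sigma_t)_{t\in\mathbb Z}$ be a stochastic volatility model with Gamma-type log-volatility, that is, $X_t=\sigma_t\epsilon_t$ and $\log\sigma_t=\sum_{i=0}^\infty\alpha_i\eta_{t-i}$ (an almost surely convergent series), where the $\epsilon_t$, $t\in\mathbb Z$, are i.i.d. with $P(\epsilon_0>0)>0$ and $E|\epsilon_0|^{1+\delta}<\infty$ for some $\delta>0$; $\alpha_i\in[0,1]$, $\max_i\alpha_i=1$ and $\alpha_i=O(i^{-\theta})$ for some $\theta>1$; and the $\eta_t$, $t\in\mathbb Z$, are i.i.d., independent of $(\epsilon_t)_{t\in\mathbb Z}$, with $E\eta_0^2<\infty$ and $P(\eta_0>z)\sim Kz^\beta e^{-z}$ as $z\to\infty$ for some $K>0$ and some real $\beta\ne-1$. Put $\alpha_k:=0$ for $k<0$ and $y^+:=\max\{y,0\}$. Let $h\ge1$ be an integer such that the linear program $$\text{minimize }\sum_{i=0}^\infty\kappa_i\quad\text{subject to}\quad \sum_{i=0}^\infty\alpha_{i-h}\kappa_i\ge1,\quad\sum_{i=0}^\infty\alpha_i\kappa_i\ge1,\quad \kappa_i\ge0\ \ (i\in\mathbb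 N_0)$$ has a unique solution $(\kappa_i)_{i\in\mathbb N_0}$, and suppose that $E\big((\epsilon_0^+)^{\sum_i\kappa_i+\delta}\big)<\infty$ for some $\delta>0$. (i) If $\kappa_i,\kappa_j>0$ for some $i\ne j$, then for all $s_0,s_h>0$ $$\lim_{x\to\infty}\frac{P(\sigma_0>s_0x,\sigma_h>s_hx)}{P(\min\{\sigma_0,\sigma_h\}>x)}=\lim_{x\to\infty}\frac{P(X_0>s_0x,X_h>s_hx)}{P(\min\{X_0,X_h\}>x)}=s_0^{(\alpha_i-\alpha_j)/D}\,s_h^{(\alpha_{j-h}-\alpha_{i-h})/D},$$ where $D=\alpha_j\alpha_{i-h}-\alpha_i\alpha_{j-h}$. (ii) If $\kappa_i>0$ for exactly one $i$, then $i\ge h$, $\alpha_i=\alpha_{i-h}$, and, with $A=\prod_{j\ge h,\,j\ne i}e^{\eta_{h-j}\alpha_{j-h}}$ and $B=\prod_{j\ge0,\,j\ne i}e^{\eta_{h-j}\alpha_j}$, for all $s_0,s_h>0$ $$\lim_{x\to\infty}\frac{P(\sigma_0>s_0x,\sigma_h>s_hx)}{P(\min\{\sigma_0,\sigma_h\}>x)}=\frac{E\big(\min(s_0^{-1}A,\,s_h^{-1}B)^{1/\alpha_i}\big)}{E\big(\min(A,B)^{1/\alpha_i}\big)},$$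 $$\lim_{x\to\infty}\frac{P(X_0>s_0x,X_h>s_hx)}{P(\min\{X_0,X_h\}>x)}=\frac{E\big(\min(s_0^{-1}\epsilon_0^+A,\,s_h^{-1}\epsilon_h^+B)^{1/\alpha_i}\big)}{E\big(\min(\epsilon_0^+A,\,\epsilon_h^+B)^{1/\alpha_i}\big)},$$ where all these expectations are finite and positive. In both cases $(\sigma_0,\sigma_h)$ and $(X_0,X_h)$ are regularly varying on the cone $(0,\infty)^2$ with index $-\sum_i\kappa_i$, and the value of the respective limit measure at $(s_0,\infty)\times(s_h,\infty)$ is the respective limit above. Here a random vector $Z$ is called regularly varying on $(0,\infty)^2$ with index $\rho<0$ and limit measure $\nu$ if $\nu\ne0$ is a Borel measure on $(0,\infty)^2$ which is finite on $(x,\infty)^2$ for all $x>0$ and homogeneous of order $\rho$, i.e. $\nu(tB)=t^{\rho}\nu(B)$ for all $t>0$ and all Borel sets $B$, and if $P(Z\in xB)/P(\min(Z)>x)\to\nu(B)$ as $x\to\infty$ for all Borel sets $B\subset(0,\infty)^2$ that are bounded away from the boundary of $(0,\infty)^2$ and satisfy $\nu(\partial B)=0$. -/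

import Mathlib

open MeasureTheory ProbabilityTheory Filter Topology
open scoped Pointwise

namespace GammaSV

/-- The open cone `(0,∞)²`. -/
def cone : Set (ℝ × ℝ) := Set.Ioi 0 ×ˢ Set.Ioi 0

/-- The set `B` has positive distance from the topological boundary of the cone `(0,∞)²`. -/
def BoundedAway (B : Set (ℝ × ℝ)) : Prop :=
  ∃ δ : ℝ, 0 < δ ∧ ∀ z ∈ B, ∀ w ∈ frontier cone, δ ≤ dist z w

/-- The random vector `Z` is regularly varying on the cone `(0,∞)²` with index `ρ < 0` and limit
measure `ν`: the measure `ν` lives on the cone, is nonzero, is finite on `(x,∞)²` for all `x > 0`,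
`P(Z ∈ xB) / P(min Z > x) → ν(B)` as `x → ∞` for all Borel subsets `B` of the cone that are bounded
away from the boundary of the cone and have a `ν`-null boundary, and `ν` is homogeneous of
order `ρ`. -/
structure IsRegVarOnCone {Ω : Type*} [MeasurableSpace Ω] (P : Measure Ω) (Z : Ω → ℝ × ℝ)
    (ρ : ℝ) (ν : Measure (ℝ × ℝ)) : Prop where
  index_neg : ρ < 0
  ne_zero : ν ≠ 0
  concentrated : ν coneᶜ = 0
  finite : ∀ x : ℝ, 0 < x → ν (Set.Ioi x ×ˢ Set.Ioi x) < ⊤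
  tendsto : ∀ B : Set (ℝ × ℝ), MeasurableSet B → B ⊆ cone → BoundedAway B →
    ν (frontier B) = 0 →
    Tendsto (fun x : ℝ => P.real {ω | Z ω ∈ x • B} / P.real {ω | x < min (Z ω).1 (Z ω).2})
      atTop (𝓝 (ν.real B))
  homogeneous : ∀ t : ℝ, 0 < t → ∀ B : Set (ℝ × ℝ), MeasurableSet B → B ⊆ cone →
    ν (t • B) = ENNReal.ofReal (t ^ ρ) * ν B

/-- `(X_t, σ_t)`, `t ∈ ℤ`, is a stochastic volatility model with Gamma-type log-volatility, with
coefficients `α`, innovations `ε` and log-volatility innovations `η`. -/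
structure IsGammaSVModel {Ω : Type*} [MeasurableSpace Ω] (P : Measure Ω)
    (α : ℕ → ℝ) (ε η σ X : ℤ → Ω → ℝ) : Prop where
  measurable_ε : ∀ t, Measurable (ε t)
  measurable_η : ∀ t, Measurable (η t)
  measurable_σ : ∀ t, Measurable (σ t)
  measurable_X : ∀ t, Measurable (X t)
  /- the returns -/
  X_eq : ∀ t, ∀ᵐ ω ∂P, X t ω = σ t ω * ε t ω
  /- the innovations -/
  indep_ε : iIndepFun ε P
  ident_ε : ∀ t, IdentDistrib (ε t) (ε 0) P P
  pos_ε : 0 < P {ω | 0 < ε 0 ω}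
  moment_ε : ∃ δ : ℝ, 0 < δ ∧ Integrable (fun ω => |ε 0 ω| ^ (1 + δ)) P
  /- the log-volatilities, as almost surely convergent series -/
  pos_σ : ∀ t, ∀ᵐ ω ∂P, 0 < σ t ω
  log_σ : ∀ t, ∀ᵐ ω ∂P,
    Tendsto (fun n : ℕ => ∑ i ∈ Finset.range n, α i * η (t - i) ω) atTop
      (𝓝 (Real.log (σ t ω)))
  /- the coefficients -/
  α_nonneg : ∀ i, 0 ≤ α i
  α_max : IsGreatest (Set.range α) 1
  α_decay : ∃ θ : ℝ, 1 < θ ∧ α =O[atTop] (fun i : ℕ => (i : ℝ) ^ (-θ))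
  /- the innovations of the log-volatilities -/
  indep_η : iIndepFun η P
  ident_η : ∀ t, IdentDistrib (η t) (η 0) P P
  indep_η_ε : IndepFun (fun ω t => η t ω) (fun ω t => ε t ω) P
  moment_η : Integrable (fun ω => (η 0 ω) ^ 2) P
  tail_η : ∃ K β : ℝ, 0 < K ∧ β ≠ -1 ∧
    Asymptotics.IsEquivalent atTop (fun z : ℝ => P.real {ω | z < η 0 ω})
      (fun z : ℝ => K * z ^ β * Real.exp (-z))

/-- The shifted coefficients `i ↦ α_{i-h}`, where `α_k := 0` for `k < 0`. -/
def lag (α : ℕ → ℝ) (h i : ℕ) : ℝ := if h ≤ i then α (i - h) else 0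

/-- The constraints `∑ α_{i-h} κ_i ≥ 1`, `∑ α_i κ_i ≥ 1`, `κ_i ≥ 0` of the linear program. The sums
have nonnegative terms and take values in `[0,∞]`. -/
def IsFeasible (α : ℕ → ℝ) (h : ℕ) (κ : ℕ → ℝ) : Prop :=
  (∀ i, 0 ≤ κ i) ∧ 1 ≤ ∑' i, ENNReal.ofReal (lag α h i * κ i) ∧
    1 ≤ ∑' i, ENNReal.ofReal (α i * κ i)

/-- `κ` is feasible and minimizes `∑ κ_i ∈ [0,∞]` among all feasible sequences. -/
def IsOptimal (α : ℕ → ℝ) (h : ℕ) (κ : ℕ → ℝ) : Prop :=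
  IsFeasible α h κ ∧ ∀ κ' : ℕ → ℝ, IsFeasible α h κ' →
    ∑' i, ENNReal.ofReal (κ i) ≤ ∑' i, ENNReal.ofReal (κ' i)

section

variable {Ω : Type*} [MeasurableSpace Ω]

/-- `P(Y > s₀ x, Y' > s₁ x) / P(min{Y, Y'} > x)`. -/
noncomputable def tailRatio (P : Measure Ω) (Y Y' : Ω → ℝ) (s₀ s₁ x : ℝ) : ℝ :=
  P.real {ω | s₀ * x < Y ω ∧ s₁ * x < Y' ω} / P.real {ω | x < min (Y ω) (Y' ω)}

/-- The infinite product `∏_{j ≠ i} exp(η_{h-j} c_j)`. -/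
noncomputable def restProd (η : ℤ → Ω → ℝ) (c : ℕ → ℝ) (h i : ℕ) (ω : Ω) : ℝ :=
  ∏' j : {j : ℕ // j ≠ i}, Real.exp (η ((h : ℤ) - (j : ℕ)) ω * c j)

/-- `min(s₀⁻¹ A, s₁⁻¹ B)^p`. -/
noncomputable def minPow (A B : Ω → ℝ) (p s₀ s₁ : ℝ) (ω : Ω) : ℝ :=
  (min (s₀⁻¹ * A ω) (s₁⁻¹ * B ω)) ^ p

end

end GammaSV

namespace GammaSV

/-! Put ξ_k = η_{h-k}. Then log σ_0 = ∑ a_k ξ_k and log σ_h = ∑ b_k ξ_k with a_k = α_{k-h} and b_k =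
α_k. Innovations ξ_k of size κ_k log x have a probability of order x^(-∑ κ_k), up to logarithmic
factors. The linear program therefore asks for the cheapest way to push both sums beyond log x, and
the support of its solution names the innovations that dominate.

Uniqueness of the solution makes duality strict. A finite perturbation of κ that stays feasible
without raising the objective must vanish (`IsOptimal.isRigid`). Testing this with two or three
coordinates shows that the support has at most two elements and yields p, q > 0 with p + q = ∑ κ_k
and p a_k + q b_k < 1 for every k off the support (`IsRigid.dual_two`, `IsRigid.dual_one`). All
factors other than the dominating innovations form an independent pair W. Strictness gives E W₁^p'
W₂^q' < ∞ for (p', q') near (p, q) (`IsLinearModel.integrable_restPair`), so one can condition on W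
and pass to the limit by dominated convergence (`tendsto_real_div_of_indepFun`).

If i alone dominates, then a_i = b_i = 1/κ_i, and the event says that ξ_i exceeds κ_i log x - κ_i
log min(W₁/s, W₂/t). Relative to P(ξ_i > κ_i log x) this has limit min(W₁/s, W₂/t)^κ_i. If i and j
dominate, the law of (ξ_i - κ_i log x, ξ_j - κ_j log x), divided by the product of the two tails,
approaches e^(-u-v) du dv. The event becomes a wedge in the (u,v)-plane, whose limit mass is, by
translation, a constant times (W₁/s)^p (W₂/t)^q. Hence the limit is proportional to s^(-p) t^(-q).
The domination comes from Potter bounds with an error e^(δ|u|), which perturb the exponents slightly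
and are absorbed by the margin in the dual constraints.

Finally, limits on upper quadrants suffice for regular variation on the cone
(`isRegVarOnCone_of_tendsto`). The volatilities and the returns are treated at once, through a
factor V that is (1, 1) or (ε_0⁺, ε_h⁺). -/

/-! ### From upper quadrants to regular variation on the cone -/

/-- The half-open boxes form a π-system. -/
lemma isPiSystem_box : IsPiSystem
    {s : Set (ℝ × ℝ) | ∃ a b c d : ℝ, s = Set.Ioc a b ×ˢ Set.Ioc c d} := by
  rintro _ ⟨a, b, c, d, rfl⟩ _ ⟨a', b', c', d', rfl⟩ -
  exact ⟨a ⊔ a', b ⊓ b', c ⊔ c', d ⊓ d', by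
    rw [Set.prod_inter_prod, Set.Ioc_inter_Ioc, Set.Ioc_inter_Ioc]⟩

/-- The inclusion-exclusion formula for a half-open box in a quadrant. -/
lemma real_quadrant_inter_box (μ : Measure (ℝ × ℝ)) (k : ℝ)
    (hμ : μ (Set.Ioi k ×ˢ Set.Ioi k) ≠ ⊤) {a b c d : ℝ} (hab : a ≤ b) (hcd : c ≤ d) :
    μ.real ((Set.Ioi k ×ˢ Set.Ioi k) ∩ (Set.Ioc a b ×ˢ Set.Ioc c d)) =
      μ.real (Set.Ioi (max k a) ×ˢ Set.Ioi (max k c))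
        - μ.real (Set.Ioi (max k b) ×ˢ Set.Ioi (max k c))
        - (μ.real (Set.Ioi (max k a) ×ˢ Set.Ioi (max k d))
        - μ.real (Set.Ioi (max k b) ×ˢ Set.Ioi (max k d))) := by
  have hfin : ∀ s t : ℝ, k ≤ s → k ≤ t → μ (Set.Ioi s ×ˢ Set.Ioi t) ≠ ⊤ := fun s t hs ht =>
    ne_top_of_le_ne_top hμ (measure_mono (Set.prod_mono (Set.Ioi_subset_Ioi hs)
      (Set.Ioi_subset_Ioi ht)))
  have hm : ∀ s t : ℝ, MeasurableSet (Set.Ioi s ×ˢ Set.Ioi t) := fun s t =>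
    measurableSet_Ioi.prod measurableSet_Ioi
  have strip : ∀ t : ℝ, k ≤ t → μ.real (Set.Ioc (max k a) (max k b) ×ˢ Set.Ioi t) =
      μ.real (Set.Ioi (max k a) ×ˢ Set.Ioi t) - μ.real (Set.Ioi (max k b) ×ˢ Set.Ioi t) := by
    intro t ht
    rw [← measureReal_sdiff (Set.prod_mono (Set.Ioi_subset_Ioi (max_le_max le_rfl hab)) le_rfl)
      (hm _ _) (hfin _ _ (le_max_left _ _) ht)]
    congr 1
    ext z
    simp only [Set.mem_prod, Set.mem_Ioc, Set.mem_Ioi, Set.mem_sdiff]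
    constructor
    · rintro ⟨⟨h1, h2⟩, h3⟩
      exact ⟨⟨h1, h3⟩, fun h => absurd h.1 (not_lt.2 h2)⟩
    · rintro ⟨⟨h1, h3⟩, h⟩
      exact ⟨⟨h1, not_lt.1 fun h' => h ⟨h', h3⟩⟩, h3⟩
  rw [← strip _ (le_max_left _ _), ← strip _ (le_max_left _ _), ← measureReal_sdiff
    (Set.prod_mono le_rfl (Set.Ioi_subset_Ioi (max_le_max le_rfl hcd)))
    (measurableSet_Ioc.prod measurableSet_Ioi)
    (ne_top_of_le_ne_top (hfin _ _ (le_max_left k a) (le_max_left k c)) (measure_mono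
      (Set.prod_mono Set.Ioc_subset_Ioi_self le_rfl)))]
  · congr 1
    ext z
    simp only [Set.mem_prod, Set.mem_Ioc, Set.mem_Ioi, Set.mem_sdiff, Set.mem_inter_iff, sup_lt_iff,
      le_sup_iff]
    constructor
    · rintro ⟨⟨h1, h2⟩, ⟨h3, h4⟩, h5, h6⟩
      exact ⟨⟨⟨⟨h1, h3⟩, Or.inr h4⟩, h2, h5⟩, fun h => absurd h.2.2 (not_lt.2 h6)⟩
    · rintro ⟨⟨⟨⟨h1, h3⟩, h4⟩, h2, h5⟩, h⟩
      have h4' : z.1 ≤ b := h4.resolve_left (not_le.2 h1)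
      exact ⟨⟨h1, h2⟩, ⟨h3, h4'⟩, h5, not_lt.1 fun h6 => h ⟨⟨⟨h1, h3⟩, Or.inr h4'⟩, h2, h6⟩⟩

/-- Convergence of (rescaled) finite measures on upper quadrants implies convergence on all
subsets of a fixed quadrant whose boundary is a null set. -/
theorem tendsto_real_of_tendsto_quadrant {ι : Type*} {l : Filter ι} [l.IsCountablyGenerated]
    (Q : ι → Measure (ℝ × ℝ)) [∀ x, IsFiniteMeasure (Q x)] (N : ι → ℝ) (m : Measure (ℝ × ℝ))
    (k : ℝ) (hfin : m (Set.Ioi k ×ˢ Set.Ioi k) ≠ ⊤)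
    (hconv : ∀ s t : ℝ, k ≤ s → k ≤ t →
      Tendsto (fun x => (Q x).real (Set.Ioi s ×ˢ Set.Ioi t) / N x) l
        (𝓝 (m.real (Set.Ioi s ×ˢ Set.Ioi t))))
    {B : Set (ℝ × ℝ)} (hB : B ⊆ Set.Ioi k ×ˢ Set.Ioi k) (hfr : m (frontier B) = 0) :
    Tendsto (fun x => (Q x).real B / N x) l (𝓝 (m.real B)) := by
  set R : Set (ℝ × ℝ) := Set.Ioi k ×ˢ Set.Ioi k with hR
  have hRm : MeasurableSet R := measurableSet_Ioi.prod measurableSet_Ioi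
  have hR0 := hconv k k le_rfl le_rfl
  rw [← hR] at hR0
  -- A limit without mass on `R` cannot be conditioned; in that case everything inside `R` is
  -- squeezed to zero.
  by_cases hm0 : m.real R = 0
  · have hmB : m.real B = 0 := le_antisymm (hm0 ▸ measureReal_mono hB hfin) measureReal_nonneg
    rw [hm0] at hR0
    rw [hmB]
    refine squeeze_zero_norm (fun x => ?_) (tendsto_norm_zero.comp hR0)
    simp only [Function.comp, norm_div]
    gcongr
    rw [Real.norm_of_nonneg measureReal_nonneg, Real.norm_of_nonneg measureReal_nonneg]
    exact measureReal_mono hB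
  have hmR : m R ≠ 0 := fun h => hm0 (by simp [Measure.real, h])
  have hmcond : IsProbabilityMeasure (m[|R]) := cond_isProbabilityMeasure_of_finite hmR hfin
  have hev : ∀ᶠ x in l, (Q x) R ≠ 0 := by
    filter_upwards [hR0.eventually_ne hm0] with x hx h
    exact hx (by simp [Measure.real, h])
  classical
  -- Conditioning on `R` reduces the claim to weak convergence of probability measures, checked on
  -- boxes by inclusion-exclusion; the normalisation `N` cancels. The value chosen where `Q x R = 0`
  -- is irrelevant by `hev`.
  let μ : ι → ProbabilityMeasure (ℝ × ℝ) := fun x => if h : (Q x) R ≠ 0 then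
    ⟨(Q x)[|R], cond_isProbabilityMeasure h⟩ else ⟨m[|R], hmcond⟩
  let ν : ProbabilityMeasure (ℝ × ℝ) := ⟨m[|R], hmcond⟩
  have hμ : ∀ᶠ x in l, ∀ s, (μ x : Measure (ℝ × ℝ)).real s
      = ((Q x).real R / N x)⁻¹ * ((Q x).real (R ∩ s) / N x) := by
    filter_upwards [hev, hR0.eventually_ne hm0] with x hx hx' s
    have hN : N x ≠ 0 := fun h => hx' (by simp [h])
    have h' : μ x = ⟨(Q x)[|R], cond_isProbabilityMeasure hx⟩ := dif_pos hx
    have : (μ x : Measure (ℝ × ℝ)) = (Q x)[|R] := by rw [h']; rfl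
    rw [this, Measure.real, cond_apply hRm, ENNReal.toReal_mul, ENNReal.toReal_inv, ← Measure.real,
      ← Measure.real]
    field_simp
  have hν : ∀ s, (ν : Measure (ℝ × ℝ)).real s = (m.real R)⁻¹ * m.real (R ∩ s) := fun s => by
    have : (ν : Measure (ℝ × ℝ)) = m[|R] := rfl
    rw [this, Measure.real, cond_apply hRm, ENNReal.toReal_mul, ENNReal.toReal_inv, ← Measure.real,
      ← Measure.real]
  have hkey : Tendsto μ l (𝓝 ν) := by
    refine isPiSystem_box.tendsto_probabilityMeasure_of_tendsto_of_mem ?_ ?_ ?_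
    · rintro _ ⟨a, b, c, d, rfl⟩
      exact measurableSet_Ioc.prod measurableSet_Ioc
    · intro u hu z hz
      obtain ⟨r, hr, hru⟩ := Metric.isOpen_iff.1 hu z hz
      refine ⟨Set.Ioc (z.1 - r / 2) (z.1 + r / 2) ×ˢ Set.Ioc (z.2 - r / 2) (z.2 + r / 2),
        ⟨_, _, _, _, rfl⟩, ?_, ?_⟩
      · rw [← Prod.mk.eta (p := z)]
        exact prod_mem_nhds (Ioc_mem_nhds (by linarith) (by linarith))
          (Ioc_mem_nhds (by linarith) (by linarith))
      · rintro w ⟨⟨h1, h2⟩, h3, h4⟩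
        apply hru
        rw [Metric.mem_ball, Prod.dist_eq, max_lt_iff, Real.dist_eq, Real.dist_eq, abs_lt, abs_lt]
        refine ⟨⟨?_, ?_⟩, ?_, ?_⟩ <;> linarith
    · rintro _ ⟨a, b, c, d, rfl⟩
      have : Tendsto (fun x => (μ x : Measure (ℝ × ℝ)).real (Set.Ioc a b ×ˢ Set.Ioc c d)) l
          (𝓝 ((ν : Measure (ℝ × ℝ)).real (Set.Ioc a b ×ˢ Set.Ioc c d))) := by
        rcases lt_or_ge b a with hab | hab
        · simpa [Set.Ioc_eq_empty_of_le hab.le] using tendsto_const_nhds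
        rcases lt_or_ge d c with hcd | hcd
        · simpa [Set.Ioc_eq_empty_of_le hcd.le] using tendsto_const_nhds
        rw [hν]
        refine Tendsto.congr' (EventuallyEq.symm (hμ.mono fun x hx => hx _)) ?_
        refine (hR0.inv₀ hm0).mul ?_
        rw [hR, real_quadrant_inter_box m k hfin hab hcd]
        simp_rw [fun x => real_quadrant_inter_box (Q x) k (measure_ne_top _ _) hab hcd, sub_div]
        exact ((hconv _ _ (le_max_left _ _) (le_max_left _ _)).sub
          (hconv _ _ (le_max_left _ _) (le_max_left _ _))).sub
          ((hconv _ _ (le_max_left _ _) (le_max_left _ _)).sub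
          (hconv _ _ (le_max_left _ _) (le_max_left _ _)))
      rw [← NNReal.tendsto_coe]
      exact this
  have hBlim : Tendsto (fun x => (μ x : Measure (ℝ × ℝ)).real B) l
      (𝓝 ((ν : Measure (ℝ × ℝ)).real B)) := by
    have h0 : (ν : Measure (ℝ × ℝ)) (frontier B) = 0 := by
      simp only [ν, ProbabilityMeasure.coe_mk]
      exact cond_absolutelyContinuous hfr
    exact (ENNReal.tendsto_toReal (measure_ne_top _ _)).comp
      (ProbabilityMeasure.tendsto_measure_of_null_frontier_of_tendsto' hkey h0)
  rw [hν, Set.inter_eq_self_of_subset_right hB] at hBlim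
  have hfinal := hR0.mul hBlim
  rw [mul_inv_cancel_left₀ hm0] at hfinal
  refine hfinal.congr' ?_
  filter_upwards [hμ, hR0.eventually_ne hm0] with x hx hx'
  rw [hx, Set.inter_eq_self_of_subset_right hB, mul_inv_cancel_left₀ hx']

lemma generateFrom_quadrant : (inferInstance : MeasurableSpace (ℝ × ℝ)) =
    MeasurableSpace.generateFrom
      (Set.image2 (· ×ˢ ·) (Set.range (Set.Ioi : ℝ → Set ℝ)) (Set.range Set.Ioi)) := by
  have hspan : IsCountablySpanning (Set.range (Set.Ioi : ℝ → Set ℝ)) := by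
    refine ⟨fun n : ℕ => Set.Ioi (-(n : ℝ)), fun n => ⟨_, rfl⟩, ?_⟩
    refine Set.eq_univ_of_forall fun x => ?_
    obtain ⟨n, hn⟩ := exists_nat_gt (-x)
    exact Set.mem_iUnion.2 ⟨n, by simp only [Set.mem_Ioi]; linarith⟩
  rw [← generateFrom_prod_eq hspan hspan]
  have : (inferInstance : MeasurableSpace ℝ) =
      MeasurableSpace.generateFrom (Set.range (Set.Ioi : ℝ → Set ℝ)) := by
    rw [← borel_eq_generateFrom_Ioi]
    exact BorelSpace.measurable_eq
  rw [← this]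

/-- A measure on the cone is determined by its values on upper quadrants. -/
theorem measure_eq_of_quadrant {μ ν : Measure (ℝ × ℝ)}
    (h : ∀ s t : ℝ, 0 < s → 0 < t → μ (Set.Ioi s ×ˢ Set.Ioi t) = ν (Set.Ioi s ×ˢ Set.Ioi t))
    (hfin : ∀ s : ℝ, 0 < s → μ (Set.Ioi s ×ˢ Set.Ioi s) ≠ ⊤)
    {B : Set (ℝ × ℝ)} (hB : MeasurableSet B) (hBc : B ⊆ cone) : μ B = ν B := by
  -- The mass may be infinite near the axes, so uniqueness is proved on quadrants of finite mass,
  -- which exhaust the cone.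
  let R : ℕ → Set (ℝ × ℝ) := fun n => Set.Ioi (1 / ((n : ℝ) + 1)) ×ˢ Set.Ioi (1 / ((n : ℝ) + 1))
  have hpos : ∀ n : ℕ, (0 : ℝ) < 1 / ((n : ℝ) + 1) := fun n => by positivity
  have hRm : ∀ n, MeasurableSet (R n) := fun n => measurableSet_Ioi.prod measurableSet_Ioi
  have hmono : Monotone R := fun n m hnm => by
    have : 1 / ((m : ℝ) + 1) ≤ 1 / ((n : ℝ) + 1) := by gcongr
    exact Set.prod_mono (Set.Ioi_subset_Ioi this) (Set.Ioi_subset_Ioi this)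
  have hres : ∀ n, μ.restrict (R n) = ν.restrict (R n) := by
    intro n
    have : IsFiniteMeasure (μ.restrict (R n)) :=
      ⟨by rw [Measure.restrict_apply_univ]; exact (hfin _ (hpos n)).lt_top⟩
    refine ext_of_generate_finite _ generateFrom_quadrant (isPiSystem_Ioi.prod isPiSystem_Ioi)
      ?_ ?_
    · rintro _ ⟨_, ⟨s, rfl⟩, _, ⟨t, rfl⟩, rfl⟩
      rw [Measure.restrict_apply' (hRm n), Measure.restrict_apply' (hRm n), Set.prod_inter_prod,
        Set.Ioi_inter_Ioi, Set.Ioi_inter_Ioi]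
      exact h _ _ (lt_of_lt_of_le (hpos n) (le_max_right _ _))
        (lt_of_lt_of_le (hpos n) (le_max_right _ _))
    · rw [Measure.restrict_apply_univ, Measure.restrict_apply_univ]
      exact h _ _ (hpos n) (hpos n)
  have hU : B = ⋃ n, B ∩ R n := by
    rw [← Set.inter_iUnion, eq_comm, Set.inter_eq_left]
    intro z hz
    obtain ⟨h1, h2⟩ := hBc hz
    obtain ⟨n, hn⟩ := exists_nat_one_div_lt (lt_min (show 0 < z.1 from h1) (show 0 < z.2 from h2))
    exact Set.mem_iUnion.2 ⟨n, hn.trans_le (min_le_left _ _), hn.trans_le (min_le_right _ _)⟩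
  have hmono' : Monotone fun n => B ∩ R n := fun n m hnm => Set.inter_subset_inter_right _ (hmono hnm)
  rw [hU, hmono'.measure_iUnion, hmono'.measure_iUnion]
  congr 1
  ext n
  rw [← Measure.restrict_apply hB, hres, Measure.restrict_apply hB]

/-- In the sup metric the boundary points `(0, z.2)` and `(z.1, 0)` lie at distance `z.1` and `z.2`
from `z`, so both coordinates are at least `δ`; halving `δ` makes the inequality strict. -/
lemma subset_quadrant_of_boundedAway {B : Set (ℝ × ℝ)} (hB : B ⊆ cone) (h : BoundedAway B) :
    ∃ k : ℝ, 0 < k ∧ B ⊆ Set.Ioi k ×ˢ Set.Ioi k := by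
  obtain ⟨δ, hδ, h⟩ := h
  have hfr : frontier cone = (Set.Ici 0 ×ˢ {0}) ∪ ({0} ×ˢ Set.Ici (0 : ℝ)) := by
    rw [cone, frontier_prod_eq, closure_Ioi, frontier_Ioi]
  refine ⟨δ / 2, by linarith, fun z hz => ?_⟩
  obtain ⟨h1, h2⟩ := hB hz
  simp only [Set.mem_Ioi] at h1 h2
  have e1 := h z hz (0, z.2) (by rw [hfr]; right; exact ⟨rfl, h2.le⟩)
  have e2 := h z hz (z.1, 0) (by rw [hfr]; left; exact ⟨h1.le, rfl⟩)
  rw [Prod.dist_eq] at e1 e2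
  simp only [dist_self, Real.dist_eq, sub_zero, abs_of_pos h1, abs_of_pos h2] at e1 e2
  rw [max_eq_left h1.le] at e1
  rw [max_eq_right h2.le] at e2
  exact ⟨show δ / 2 < z.1 by linarith, show δ / 2 < z.2 by linarith⟩

/-- A random vector is regularly varying on the cone as soon as the rescaled probabilities of upper
quadrants converge to a homogeneous limit that is given by a measure. -/
theorem isRegVarOnCone_of_tendsto {Ω : Type*} [MeasurableSpace Ω] (P : Measure Ω)
    [IsProbabilityMeasure P] {Y Y' : Ω → ℝ} (hY : Measurable Y) (hY' : Measurable Y') (N : ℝ → ℝ)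
    (G : ℝ → ℝ → ℝ) (m : Measure (ℝ × ℝ)) {ρ : ℝ} (hρ : ρ < 0) (hm0 : m coneᶜ = 0)
    (hmG : ∀ s t : ℝ, 0 < s → 0 < t → m (Set.Ioi s ×ˢ Set.Ioi t) = ENNReal.ofReal (G s t))
    (hG : ∀ s t : ℝ, 0 < s → 0 < t → 0 ≤ G s t) (hG1 : 0 < G 1 1)
    (hhom : ∀ r s t : ℝ, 0 < r → 0 < s → 0 < t → G (r * s) (r * t) = r ^ ρ * G s t)
    (hlim : ∀ s t : ℝ, 0 < s → 0 < t →
      Tendsto (fun x : ℝ => P.real {ω | s * x < Y ω ∧ t * x < Y' ω} / N x) atTop (𝓝 (G s t))) :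
    (∀ s t : ℝ, 0 < s → 0 < t → Tendsto (tailRatio P Y Y' s t) atTop (𝓝 (G s t / G 1 1))) ∧
    ∃ ν : Measure (ℝ × ℝ), IsRegVarOnCone P (fun ω => (Y ω, Y' ω)) ρ ν ∧
      ∀ s t : ℝ, 0 < s → 0 < t →
        Tendsto (tailRatio P Y Y' s t) atTop (𝓝 (ν.real (Set.Ioi s ×ˢ Set.Ioi t))) := by
  have hmin : ∀ x : ℝ, {ω | x < min (Y ω) (Y' ω)} = {ω | 1 * x < Y ω ∧ 1 * x < Y' ω} := fun x => by
    ext ω; simp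
  have hratio : ∀ s t : ℝ, 0 < s → 0 < t →
      Tendsto (tailRatio P Y Y' s t) atTop (𝓝 (G s t / G 1 1)) := by
    intro s t hs ht
    have h11 := hlim 1 1 one_pos one_pos
    refine ((hlim s t hs ht).div h11 hG1.ne').congr' ?_
    filter_upwards [h11.eventually_ne hG1.ne'] with x hx
    have hN : N x ≠ 0 := fun h => hx (by simp [h])
    simp only [Pi.div_apply]
    rw [div_div_div_cancel_right₀ hN, tailRatio, hmin]
  -- The normalisation by P(min > x) corresponds to dividing `m` by `G 1 1`; the auxiliary `N` has
  -- dropped out.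
  refine ⟨hratio, ENNReal.ofReal (G 1 1)⁻¹ • m, ?_, ?_⟩
  swap
  · intro s t hs ht
    have : (ENNReal.ofReal (G 1 1)⁻¹ • m).real (Set.Ioi s ×ˢ Set.Ioi t) = G s t / G 1 1 := by
      rw [measureReal_ennreal_smul_apply, Measure.real, hmG s t hs ht,
        ENNReal.toReal_ofReal (hG s t hs ht), ENNReal.toReal_ofReal (inv_nonneg.2 hG1.le)]
      ring
    rw [this]
    exact hratio s t hs ht
  set ν := ENNReal.ofReal (G 1 1)⁻¹ • m with hν
  have hνG : ∀ s t : ℝ, 0 < s → 0 < t →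
      ν (Set.Ioi s ×ˢ Set.Ioi t) = ENNReal.ofReal ((G 1 1)⁻¹ * G s t) := by
    intro s t hs ht
    rw [hν, Measure.smul_apply, smul_eq_mul, hmG s t hs ht,
      ENNReal.ofReal_mul (inv_nonneg.2 hG1.le)]
  have hνfin : ∀ s t : ℝ, 0 < s → 0 < t → ν (Set.Ioi s ×ˢ Set.Ioi t) ≠ ⊤ := fun s t hs ht => by
    rw [hνG s t hs ht]; exact ENNReal.ofReal_ne_top
  refine ⟨hρ, ?_, ?_, fun x hx => (hνfin x x hx hx).lt_top, ?_, ?_⟩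
  · intro h0
    have := hνG 1 1 one_pos one_pos
    rw [h0, inv_mul_cancel₀ hG1.ne'] at this
    simp at this
  · rw [hν, Measure.smul_apply, hm0, smul_zero]
  · intro B hBm hBc hBa hBfr
    obtain ⟨k, hk, hBk⟩ := subset_quadrant_of_boundedAway hBc hBa
    have hmeas : ∀ x : ℝ, Measurable fun ω => (x⁻¹ * Y ω, x⁻¹ * Y' ω) := fun x =>
      (hY.const_mul _).prodMk (hY'.const_mul _)
    have key : ∀ x : ℝ, 0 < x → ∀ C : Set (ℝ × ℝ), MeasurableSet C →
        (P.map fun ω => (x⁻¹ * Y ω, x⁻¹ * Y' ω)).real C = P.real {ω | (Y ω, Y' ω) ∈ x • C} := by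
      intro x hx C hC
      rw [map_measureReal_apply (hmeas x) hC]
      congr 1
      ext ω
      simp [Set.mem_smul_set_iff_inv_smul_mem₀ hx.ne']
    have hmain := tendsto_real_of_tendsto_quadrant (l := atTop)
      (fun x : ℝ => P.map fun ω => (x⁻¹ * Y ω, x⁻¹ * Y' ω))
      (fun x => P.real {ω | x < min (Y ω) (Y' ω)}) ν k (hνfin k k hk hk) ?_ hBk hBfr
    · refine hmain.congr' ?_
      filter_upwards [eventually_gt_atTop 0] with x hx
      rw [key x hx B hBm]
    · intro s t hs ht
      have hs0 := hk.trans_le hs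
      have ht0 := hk.trans_le ht
      have : ν.real (Set.Ioi s ×ˢ Set.Ioi t) = G s t / G 1 1 := by
        rw [Measure.real, hνG s t hs0 ht0, ENNReal.toReal_ofReal
          (mul_nonneg (inv_nonneg.2 hG1.le) (hG s t hs0 ht0))]
        ring
      rw [this]
      refine (hratio s t hs0 ht0).congr' ?_
      filter_upwards [eventually_gt_atTop 0] with x hx
      rw [tailRatio, key x hx _ (measurableSet_Ioi.prod measurableSet_Ioi)]
      congr 3
      ext ω
      simp only [Set.mem_smul_set_iff_inv_smul_mem₀ hx.ne', Set.mem_prod, Set.mem_Ioi,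
        Prod.smul_mk, smul_eq_mul, inv_mul_eq_div, lt_div_iff₀ hx]
  · intro t ht B hB hBc
    have hmt : Measurable fun z : ℝ × ℝ => t⁻¹ • z := measurable_const_smul _
    have hpre : ∀ C : Set (ℝ × ℝ), (fun z : ℝ × ℝ => t⁻¹ • z) ⁻¹' C = t • C := fun C =>
      Set.preimage_smul_inv₀ ht.ne' C
    have hq : ∀ s s' : ℝ, t • (Set.Ioi s ×ˢ Set.Ioi s') = Set.Ioi (t * s) ×ˢ Set.Ioi (t * s') := by
      intro s s'
      ext z
      simp only [Set.mem_smul_set_iff_inv_smul_mem₀ ht.ne', Set.mem_prod, Set.mem_Ioi,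
        Prod.smul_fst, Prod.smul_snd, smul_eq_mul, inv_mul_eq_div, lt_div_iff₀ ht, mul_comm t]
    -- Homogeneity is an identity between the image of `ν` under division by `t` and a multiple of
    -- `ν`; on quadrants it is `hhom`.
    have := measure_eq_of_quadrant (μ := ν.map fun z => t⁻¹ • z) (ν := ENNReal.ofReal (t ^ ρ) • ν)
      ?_ ?_ hB hBc
    · rw [Measure.map_apply hmt hB, hpre] at this
      rw [this, Measure.smul_apply, smul_eq_mul]
    · intro s s' hs hs'
      rw [Measure.map_apply hmt (measurableSet_Ioi.prod measurableSet_Ioi), hpre, hq,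
        Measure.smul_apply _ ν, smul_eq_mul, hνG _ _ (mul_pos ht hs) (mul_pos ht hs'), hνG _ _ hs hs',
        hhom t s s' ht hs hs', ← ENNReal.ofReal_mul (by positivity)]
      congr 1
      ring
    · intro s hs
      rw [Measure.map_apply hmt (measurableSet_Ioi.prod measurableSet_Ioi), hpre, hq]
      exact hνfin _ _ (mul_pos ht hs) (mul_pos ht hs)

/-! ### Tails and exponential moments of Gamma-type innovations -/

/-- The survival function of `τ` is asymptotically equivalent to `K z^β exp(-z)`. -/
def HasGammaTail (τ : Measure ℝ) (K β : ℝ) : Prop :=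
  Asymptotics.IsEquivalent atTop (fun z : ℝ => τ.real (Set.Ioi z))
      (fun z : ℝ => K * z ^ β * Real.exp (-z))

section

variable {τ : Measure ℝ} {K β : ℝ}

lemma HasGammaTail.eventually_bounds (hτ : HasGammaTail τ K β) (hK : 0 < K) :
    ∃ y₀ : ℝ, 1 ≤ y₀ ∧ ∀ y, y₀ ≤ y →
      K / 2 * y ^ β * Real.exp (-y) ≤ τ.real (Set.Ioi y) ∧
      τ.real (Set.Ioi y) ≤ 2 * K * y ^ β * Real.exp (-y) := by
  have h := (Asymptotics.IsEquivalent.isLittleO hτ).def (c := 1 / 2) (by norm_num)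
  obtain ⟨y₀, hy₀⟩ := eventually_atTop.1 (h.and (eventually_ge_atTop 1))
  refine ⟨max y₀ 1, le_max_right _ _, fun y hy => ?_⟩
  obtain ⟨h1, h2⟩ := hy₀ y ((le_max_left _ _).trans hy)
  have hpos : 0 < K * y ^ β * Real.exp (-y) := by positivity
  simp only [Pi.sub_apply, Real.norm_eq_abs] at h1
  rw [abs_of_pos hpos, abs_le] at h1
  constructor <;> nlinarith [h1.1, h1.2]

/-- A fixed shift changes the polynomial factor only by `((z + u) / z) ^ β → 1`, so the exponential
factor alone survives. -/
lemma HasGammaTail.tendsto_ratio (hτ : HasGammaTail τ K β) (hK : 0 < K) (u : ℝ) :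
    Tendsto (fun z => τ.real (Set.Ioi (z + u)) / τ.real (Set.Ioi z)) atTop
      (𝓝 (Real.exp (-u))) := by
  have hshift : Tendsto (fun z : ℝ => z + u) atTop atTop := tendsto_atTop_add_const_right _ _ tendsto_id
  have h1 := (Asymptotics.IsEquivalent.comp_tendsto hτ hshift).div hτ
  refine h1.symm.tendsto_nhds ?_
  have h2 : Tendsto (fun z : ℝ => ((z + u) / z) ^ β) atTop (𝓝 1) := by
    have h3 : Tendsto (fun z : ℝ => (z + u) / z) atTop (𝓝 1) := by
      have : Tendsto (fun z : ℝ => 1 + u / z) atTop (𝓝 (1 + 0)) :=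
        tendsto_const_nhds.add (tendsto_const_nhds.div_atTop tendsto_id)
      rw [add_zero] at this
      refine this.congr' ?_
      filter_upwards [eventually_gt_atTop 0] with z hz
      field_simp
    have := (Real.continuousAt_rpow_const 1 β (Or.inl one_ne_zero)).tendsto.comp h3
    rwa [Real.one_rpow] at this
  have h4 := h2.mul_const (Real.exp (-u))
  rw [one_mul] at h4
  refine h4.congr' ?_
  filter_upwards [eventually_gt_atTop 0, eventually_gt_atTop (-u)] with z hz hzu
  have hzu' : 0 < z + u := by linarith
  simp only [Pi.div_apply, Function.comp]
  rw [Real.div_rpow hzu'.le hz.le, show -(z + u) = -u + -z by ring, Real.exp_add]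
  have := Real.rpow_pos_of_pos hz β
  field_simp

/-- Absorbs polynomial factors in an arbitrarily small exponential rate: for `d ≤ 1` one has `1 + t
≤ d⁻¹ exp(d t)`, and the power `b` turns the rate into `d b ≤ δ`. -/
lemma one_add_rpow_le_exp (b : ℝ) (hb : 0 ≤ b) {δ : ℝ} (hδ : 0 < δ) :
    ∃ C : ℝ, 0 < C ∧ ∀ t : ℝ, 0 ≤ t → (1 + t) ^ b ≤ C * Real.exp (δ * t) := by
  set d := min 1 (δ / (b + 1)) with hd
  have hd0 : 0 < d := lt_min one_pos (by positivity)
  refine ⟨d⁻¹ ^ b, by positivity, fun t ht => ?_⟩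
  have h1 : 1 + t ≤ d⁻¹ * Real.exp (d * t) := by
    rw [inv_mul_eq_div, le_div_iff₀ hd0]
    have := Real.add_one_le_exp (d * t)
    have : d ≤ 1 := min_le_left _ _
    nlinarith
  calc (1 + t) ^ b ≤ (d⁻¹ * Real.exp (d * t)) ^ b := Real.rpow_le_rpow (by linarith) h1 hb
    _ = d⁻¹ ^ b * Real.exp (d * t * b) := by
        rw [Real.mul_rpow (by positivity) (by positivity), ← Real.exp_mul]
    _ ≤ d⁻¹ ^ b * Real.exp (δ * t) := by
        refine mul_le_mul_of_nonneg_left (Real.exp_le_exp.2 ?_) (by positivity)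
        have h2 : d ≤ δ / (b + 1) := min_le_right _ _
        rw [le_div_iff₀ (by linarith)] at h2
        nlinarith [mul_le_mul_of_nonneg_right h2 ht]

lemma rpow_le_one_add_abs_rpow {x t β : ℝ} (hx : 0 < x) (h1 : x ≤ 1 + t) (h2 : x⁻¹ ≤ 1 + t) : x ^ β ≤ (1 + t) ^ |β| := by
  rcases le_total 0 β with hβ | hβ
  · rw [abs_of_nonneg hβ]
    exact Real.rpow_le_rpow hx.le h1 hβ
  · rw [abs_of_nonpos hβ, ← neg_neg β, Real.rpow_neg hx.le, ← Real.inv_rpow hx.le, neg_neg]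
    exact Real.rpow_le_rpow (by positivity) h2 (by linarith)

/-- Potter bounds for Gamma-type tails, uniform over all shifts. -/
theorem HasGammaTail.potter [IsProbabilityMeasure τ] (hτ : HasGammaTail τ K β) (hK : 0 < K)
    {δ : ℝ} (hδ : 0 < δ) :
    ∃ C z₀ : ℝ, 0 < C ∧ ∀ z, z₀ ≤ z → 0 < τ.real (Set.Ioi z) ∧ ∀ u : ℝ,
      τ.real (Set.Ioi (z + u)) ≤ C * τ.real (Set.Ioi z) * Real.exp (-u + δ * |u|) := by
  obtain ⟨y₀, hy₀, hb⟩ := hτ.eventually_bounds hK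
  obtain ⟨C₁, hC₁, hC⟩ := one_add_rpow_le_exp |β| (abs_nonneg β) hδ
  have hF : ∀ z, y₀ ≤ z → 0 < τ.real (Set.Ioi z) := fun z hz => by
    have hz0 : 0 < z := by linarith
    exact lt_of_lt_of_le (by positivity) (hb z hz).1
  set C₂ : ℝ := 2 / K * C₁ * Real.exp ((1 + δ) * y₀) with hC₂
  have hC₂0 : 0 < C₂ := by positivity
  refine ⟨4 * C₁ + C₂, y₀, by positivity, fun z hz => ⟨hF z hz, fun u => ?_⟩⟩
  have hz0 : 0 < z := by linarith
  have hFz := hF z hz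
  have hzβ := Real.rpow_pos_of_pos hz0 β
  -- As long as `z + u ≥ y₀ ≥ 1`, both tails have the Gamma form and the ratio of their polynomial
  -- factors is at most `(1 + |u|) ^ |β|`. Otherwise the tail is bounded by 1, and `|u| > z - y₀`
  -- makes `exp(-u + δ|u|)` larger than a constant times the reciprocal of the tail at `z`.
  rcases le_or_gt y₀ (z + u) with h | h
  · have hzu0 : 0 < z + u := by linarith
    have hle := neg_abs_le u
    have hle' := le_abs_self u
    have habs := abs_nonneg u
    have hr : ((z + u) / z) ^ β ≤ C₁ * Real.exp (δ * |u|) := by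
      refine (rpow_le_one_add_abs_rpow (t := |u|) (by positivity) ?_ ?_).trans
        (hC _ habs)
      · rw [div_le_iff₀ hz0]; nlinarith
      · rw [inv_div, div_le_iff₀ hzu0]; nlinarith
    calc τ.real (Set.Ioi (z + u)) ≤ 2 * K * (z + u) ^ β * Real.exp (-(z + u)) := (hb _ h).2
      _ = 4 * ((z + u) / z) ^ β * (K / 2 * z ^ β * Real.exp (-z)) * Real.exp (-u) := by
          rw [Real.div_rpow hzu0.le hz0.le, show -(z + u) = -z + -u by ring, Real.exp_add]
          field_simp
          ring
      _ ≤ 4 * (C₁ * Real.exp (δ * |u|)) * τ.real (Set.Ioi z) * Real.exp (-u) := by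
          gcongr
          exact (hb z hz).1
      _ = 4 * C₁ * τ.real (Set.Ioi z) * Real.exp (-u + δ * |u|) := by
          rw [Real.exp_add]; ring
      _ ≤ (4 * C₁ + C₂) * τ.real (Set.Ioi z) * Real.exp (-u + δ * |u|) := by
          gcongr; linarith
  · have hu : u < 0 := by linarith
    have h1 : z ^ (-β) ≤ C₁ * Real.exp (δ * z) := by
      have := rpow_le_one_add_abs_rpow (x := z) (t := z) (β := -β) hz0 (by linarith)
        ((inv_le_one_of_one_le₀ (by linarith)).trans (by linarith))
      rw [abs_neg] at this
      exact this.trans (hC z hz0.le)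
    have h2 : Real.exp (-z) / C₁ ≤ z ^ β * Real.exp ((δ) * z) * Real.exp (-z) := by
      rw [div_le_iff₀ hC₁]
      rw [Real.rpow_neg hz0.le, inv_le_iff_one_le_mul₀ hzβ] at h1
      nlinarith [Real.exp_pos (-z)]
    calc τ.real (Set.Ioi (z + u)) ≤ 1 := measureReal_le_one
      _ = 2 / K * C₁ * Real.exp ((1 + δ) * y₀) * (K / 2 * (Real.exp (-z) / C₁)) *
          Real.exp (z - δ * z) * Real.exp (-(1 + δ) * y₀ + δ * z) := by
          have e1 : Real.exp ((1 + δ) * y₀) * Real.exp (-z) * Real.exp (z - δ * z) *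
              Real.exp (-(1 + δ) * y₀ + δ * z) = 1 := by
            rw [← Real.exp_add, ← Real.exp_add, ← Real.exp_add, ← Real.exp_zero]
            congr 1; ring
          have hK' := hK.ne'
          have hC₁' := hC₁.ne'
          calc (1 : ℝ) = 2 / K * C₁ * (K / 2 / C₁) * (Real.exp ((1 + δ) * y₀) * Real.exp (-z) *
                Real.exp (z - δ * z) * Real.exp (-(1 + δ) * y₀ + δ * z)) := by
                rw [e1]; field_simp
            _ = _ := by ring
      _ ≤ 2 / K * C₁ * Real.exp ((1 + δ) * y₀) *
          (K / 2 * (z ^ β * Real.exp ((δ) * z) * Real.exp (-z))) *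
          Real.exp (z - δ * z) * Real.exp (-(1 + δ) * y₀ + δ * z) := by
          gcongr
      _ = C₂ * (K / 2 * z ^ β * Real.exp (-z)) * Real.exp ((1 + δ) * (z - y₀)) := by
          have e1 : Real.exp (δ * z) * Real.exp (z - δ * z) * Real.exp (-(1 + δ) * y₀ + δ * z)
              = Real.exp ((1 + δ) * (z - y₀)) := by
            rw [← Real.exp_add, ← Real.exp_add]; congr 1; ring
          rw [← e1, hC₂]; ring
      _ ≤ (4 * C₁ + C₂) * τ.real (Set.Ioi z) * Real.exp (-u + δ * |u|) := by
          gcongr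
          · linarith
          · exact (hb z hz).1
          · rw [abs_of_neg hu]; nlinarith

lemma integrable_exp_neg_mul_abs {c : ℝ} (hc : 0 < c) :
    Integrable fun u : ℝ => Real.exp (-(c * |u|)) := by
  have h1 : IntegrableOn (fun u : ℝ => Real.exp (-(c * |u|))) (Set.Ioi 0) := by
    refine (integrableOn_exp_mul_Ioi (a := -c) (by linarith) 0).congr_fun (fun u hu => ?_)
      measurableSet_Ioi
    simp only [Set.mem_Ioi] at hu
    simp [abs_of_pos hu]
  have h2 : IntegrableOn (fun u : ℝ => Real.exp (-(c * |u|))) (Set.Iic 0) := by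
    refine (integrableOn_exp_mul_Iic (a := c) hc 0).congr_fun (fun u hu => ?_) measurableSet_Iic
    simp only [Set.mem_Iic] at hu
    simp [abs_of_nonpos hu]
  rw [← integrableOn_univ, ← Set.Iic_union_Ioi (a := (0 : ℝ))]
  exact h2.union h1

/-- The exponential moment `exp(Y - δ|Y|)`, `Y = η - z`, is of the order of the tail at `z`. -/
theorem HasGammaTail.lintegral_exp_le [IsProbabilityMeasure τ] (hτ : HasGammaTail τ K β)
    (hK : 0 < K) {δ : ℝ} (hδ : 0 < δ) (hδ1 : δ ≤ 1) :
    ∃ C z₀ : ℝ, 0 < C ∧ ∀ z, z₀ ≤ z →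
      ∫⁻ y, ENNReal.ofReal (Real.exp (y - z - δ * |y - z|)) ∂τ ≤
        ENNReal.ofReal (C * τ.real (Set.Ioi z)) := by
  obtain ⟨C₁, z₀, hC₁, hpot⟩ := hτ.potter hK (half_pos hδ)
  set I : ℝ := ∫ u : ℝ, Real.exp (-(δ / 2 * |u|)) with hI
  have hIint := integrable_exp_neg_mul_abs (half_pos hδ)
  have hI0 : 0 ≤ I := integral_nonneg fun u => (Real.exp_pos _).le
  refine ⟨Real.exp 2 * C₁ * (I + 1), z₀, by positivity, fun z hz => ?_⟩
  obtain ⟨hF, hpotz⟩ := hpot z hz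
  -- The weight at `y - z` is compared with its values on the unit interval to the left, where `u`
  -- differs from `y - z` by at most one; with `δ ≤ 1` this costs `exp 2`. Integrating over `y` then
  -- produces the tails at `z + u`, and the Potter bound with `δ / 2` leaves the integrable function
  -- `exp(-δ|u|/2)`.
  have hstep : ∀ y : ℝ, ENNReal.ofReal (Real.exp (y - z - δ * |y - z|)) ≤
      ∫⁻ u : ℝ, ENNReal.ofReal (Real.exp 2 * Real.exp (u - δ * |u|)) *
        (Set.Ioi (z + u)).indicator 1 y := by
    intro y
    calc ENNReal.ofReal (Real.exp (y - z - δ * |y - z|))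
        = ∫⁻ u in Set.Ioo (y - z - 1) (y - z), ENNReal.ofReal (Real.exp (y - z - δ * |y - z|)) := by
          rw [setLIntegral_const, Real.volume_Ioo]; simp
      _ ≤ ∫⁻ u in Set.Ioo (y - z - 1) (y - z),
          ENNReal.ofReal (Real.exp 2 * Real.exp (u - δ * |u|)) *
            (Set.Ioi (z + u)).indicator 1 y := by
          refine setLIntegral_mono' measurableSet_Ioo fun u hu => ?_
          have hmem : y ∈ Set.Ioi (z + u) := by
            have := hu.2; simp only [Set.mem_Ioi]; linarith
          rw [Set.indicator_of_mem hmem, Pi.one_apply, mul_one, ← Real.exp_add]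
          refine ENNReal.ofReal_le_ofReal (Real.exp_le_exp.2 ?_)
          have h1 : |u| - |y - z| ≤ 1 := by
            refine (abs_sub_abs_le_abs_sub u (y - z)).trans (abs_le.2 ⟨?_, ?_⟩) <;>
              linarith [hu.1, hu.2]
          have h2 : δ * (|u| - |y - z|) ≤ 1 := by
            rcases le_total 0 (|u| - |y - z|) with h | h <;> nlinarith
          linarith [hu.1]
      _ ≤ _ := setLIntegral_le_lintegral _ _
  calc ∫⁻ y, ENNReal.ofReal (Real.exp (y - z - δ * |y - z|)) ∂τ
      ≤ ∫⁻ y, (∫⁻ u : ℝ, ENNReal.ofReal (Real.exp 2 * Real.exp (u - δ * |u|)) *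
        (Set.Ioi (z + u)).indicator 1 y) ∂τ := lintegral_mono hstep
    _ = ∫⁻ u : ℝ, ∫⁻ y, ENNReal.ofReal (Real.exp 2 * Real.exp (u - δ * |u|)) *
        (Set.Ioi (z + u)).indicator 1 y ∂τ := by
        refine lintegral_lintegral_swap (Measurable.aemeasurable ?_)
        have hset : MeasurableSet {p : ℝ × ℝ | z + p.2 < p.1} :=
          measurableSet_lt (by fun_prop) (by fun_prop)
        have heq : (Function.uncurry fun y u : ℝ =>
            ENNReal.ofReal (Real.exp 2 * Real.exp (u - δ * |u|)) *
              (Set.Ioi (z + u)).indicator (1 : ℝ → ENNReal) y) = fun p : ℝ × ℝ =>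
            ENNReal.ofReal (Real.exp 2 * Real.exp (p.2 - δ * |p.2|)) *
              {p : ℝ × ℝ | z + p.2 < p.1}.indicator 1 p := by
          ext p; simp [Function.uncurry, Set.indicator]
        rw [heq]
        exact Measurable.mul (by fun_prop) (measurable_one.indicator hset)
    _ = ∫⁻ u : ℝ, ENNReal.ofReal (Real.exp 2 * Real.exp (u - δ * |u|)) *
        τ (Set.Ioi (z + u)) := by
        refine lintegral_congr fun u => ?_
        rw [lintegral_const_mul _ (measurable_one.indicator measurableSet_Ioi),
          lintegral_indicator_one measurableSet_Ioi]
    _ ≤ ∫⁻ u : ℝ, ENNReal.ofReal (Real.exp 2 * C₁ * τ.real (Set.Ioi z)) *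
          ENNReal.ofReal (Real.exp (-(δ / 2 * |u|))) := by
        refine lintegral_mono fun u => ?_
        rw [← ENNReal.ofReal_mul (by positivity), ← ofReal_measureReal (measure_ne_top _ _),
          ← ENNReal.ofReal_mul (by positivity)]
        refine ENNReal.ofReal_le_ofReal ?_
        calc Real.exp 2 * Real.exp (u - δ * |u|) * τ.real (Set.Ioi (z + u))
            ≤ Real.exp 2 * Real.exp (u - δ * |u|) *
              (C₁ * τ.real (Set.Ioi z) * Real.exp (-u + δ / 2 * |u|)) := by
              gcongr; exact hpotz u
          _ = Real.exp 2 * C₁ * τ.real (Set.Ioi z) *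
              (Real.exp (u - δ * |u|) * Real.exp (-u + δ / 2 * |u|)) := by ring
          _ = _ := by rw [← Real.exp_add]; congr 2; ring
    _ = ENNReal.ofReal (Real.exp 2 * C₁ * τ.real (Set.Ioi z) * I) := by
        rw [lintegral_const_mul _ (by fun_prop), ← ofReal_integral_eq_lintegral_ofReal hIint
          (ae_of_all _ fun u => (Real.exp_pos _).le), ← ENNReal.ofReal_mul (by positivity)]
    _ ≤ _ := by
        refine ENNReal.ofReal_le_ofReal ?_
        have : 0 ≤ Real.exp 2 * C₁ * τ.real (Set.Ioi z) := by positivity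
        nlinarith

/-- All exponential moments of order less than one exist. -/
theorem HasGammaTail.integrable_exp [IsProbabilityMeasure τ] (hτ : HasGammaTail τ K β)
    (hK : 0 < K) {θ : ℝ} (hθ : θ < 1) (hθ0 : 0 ≤ θ) :
    Integrable (fun y => Real.exp (θ * y)) τ := by
  -- For `δ = 1 - θ` the weight is exactly `exp(θ (y - z₀))` when `y ≥ z₀`; for smaller `y` this
  -- exponential is at most 1.
  obtain ⟨C, z₀, -, h⟩ := hτ.lintegral_exp_le hK (δ := 1 - θ) (by linarith) (by linarith)
  have h1 : Integrable (fun y => Real.exp (y - z₀ - (1 - θ) * |y - z₀|)) τ := by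
    refine ⟨Measurable.aestronglyMeasurable (by fun_prop), ?_⟩
    rw [hasFiniteIntegral_iff_ofReal (ae_of_all _ fun u => (Real.exp_pos _).le)]
    exact (h z₀ le_rfl).trans_lt ENNReal.ofReal_lt_top
  refine ((h1.add (integrable_const 1)).const_mul (Real.exp (θ * z₀))).mono'
    (Measurable.aestronglyMeasurable (by fun_prop)) (ae_of_all _ fun y => ?_)
  rw [Real.norm_of_nonneg (Real.exp_pos _).le]
  have h2 : Real.exp (θ * y) = Real.exp (θ * z₀) * Real.exp (θ * (y - z₀)) := by
    rw [← Real.exp_add]; congr 1; ring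
  rw [h2]
  simp only [Pi.add_apply]
  gcongr
  rcases le_total 0 (y - z₀) with h3 | h3
  · rw [abs_of_nonneg h3, show y - z₀ - (1 - θ) * (y - z₀) = θ * (y - z₀) by ring]
    linarith
  · have : Real.exp (θ * (y - z₀)) ≤ 1 := Real.exp_le_one_iff.2 (by nlinarith)
    linarith [Real.exp_pos (y - z₀ - (1 - θ) * |y - z₀|)]

end

/-! ### Duality for the linear program -/

/-- A solution `κ` of the linear program with coefficients `a`, `b` that admits no finite
perturbation which keeps it feasible without increasing the objective. -/
structure IsRigid (a b κ : ℕ → ℝ) : Prop where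
  nonneg : ∀ n, 0 ≤ κ n
  summable : Summable κ
  le_a : 1 ≤ ∑' n, a n * κ n
  le_b : 1 ≤ ∑' n, b n * κ n
  rigid : ∀ (F : Finset ℕ) (d : ℕ → ℝ),
    (0 ≤ ∑ n ∈ F, a n * d n ∨ 1 < ∑' n, a n * κ n) →
    (0 ≤ ∑ n ∈ F, b n * d n ∨ 1 < ∑' n, b n * κ n) →
    ∑ n ∈ F, d n ≤ 0 → (∀ n ∈ F, d n < 0 → 0 < κ n) → ∀ n ∈ F, d n = 0

lemma summable_mul_of_le_one {a κ : ℕ → ℝ} (ha0 : ∀ n, 0 ≤ a n) (ha1 : ∀ n, a n ≤ 1)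
    (hκ0 : ∀ n, 0 ≤ κ n) (hκ : Summable κ) : Summable fun n => a n * κ n :=
  hκ.of_nonneg_of_le (fun n => mul_nonneg (ha0 n) (hκ0 n)) fun n => by
    nlinarith [mul_nonneg (sub_nonneg.2 (ha1 n)) (hκ0 n)]

lemma lag_nonneg {α : ℕ → ℝ} (hα : ∀ i, 0 ≤ α i) (h i : ℕ) : 0 ≤ lag α h i := by
  unfold lag; split_ifs <;> simp [hα]

lemma lag_le_one {α : ℕ → ℝ} (hα : ∀ i, α i ≤ 1) (h i : ℕ) : lag α h i ≤ 1 := by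
  unfold lag; split_ifs <;> simp [hα]

lemma one_le_tsum_ofReal_iff {f : ℕ → ℝ} (hf : ∀ n, 0 ≤ f n) (hs : Summable f) :
    1 ≤ ∑' n, ENNReal.ofReal (f n) ↔ 1 ≤ ∑' n, f n := by
  rw [← ENNReal.ofReal_tsum_of_nonneg hf hs, ← ENNReal.ofReal_one,
    ENNReal.ofReal_le_ofReal_iff (tsum_nonneg hf)]

/-- Unit masses at `m` and `m + h`, where `α m = 1`, are feasible at finite cost. Hence the optimum
is finite, and the program can be rewritten with real sums. -/
lemma IsOptimal.summable {α κ : ℕ → ℝ} (hα1 : IsGreatest (Set.range α) 1) {h : ℕ}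
    (hopt : IsOptimal α h κ) : Summable κ := by
  obtain ⟨m, hm⟩ := hα1.1
  have hfeas : IsFeasible α h fun n => (if n = m then 1 else 0) + if n = m + h then 1 else 0 := by
    refine ⟨fun n => by positivity, ?_, ?_⟩
    · refine le_trans ?_ (ENNReal.le_tsum (m + h))
      rw [← ENNReal.ofReal_one]
      refine ENNReal.ofReal_le_ofReal ?_
      simp only [lag, le_add_iff_nonneg_left, zero_le, if_true, add_tsub_cancel_right, hm]
      split_ifs <;> norm_num
    · refine le_trans ?_ (ENNReal.le_tsum m)
      rw [← ENNReal.ofReal_one]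
      refine ENNReal.ofReal_le_ofReal ?_
      simp only [hm, if_true]
      split_ifs <;> norm_num
  have hle := hopt.2 _ hfeas
  have hfin : ∑' i, ENNReal.ofReal (κ i) ≠ ⊤ := by
    refine ne_top_of_le_ne_top ?_ hle
    rw [← ENNReal.ofReal_tsum_of_nonneg (fun n => by positivity)]
    · exact ENNReal.ofReal_ne_top
    · exact (summable_of_ne_finset_zero (s := {m}) (by simp)).add
        (summable_of_ne_finset_zero (s := {m + h}) (by simp))
  have := ENNReal.summable_toReal hfin
  exact this.congr fun n => (ENNReal.toReal_ofReal (hopt.1.1 n))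

/-- For small `t > 0` the point `κ + t d` is feasible: a slack constraint survives every small move,
a tight one needs the right sign of its change. It costs no more than `κ`, hence is optimal, and
uniqueness gives `d = 0`. This is the only use of uniqueness. -/
lemma IsOptimal.isRigid {α κ : ℕ → ℝ} (hα0 : ∀ i, 0 ≤ α i)
    (hα1 : IsGreatest (Set.range α) 1) {h : ℕ} (hopt : IsOptimal α h κ)
    (hunique : ∀ κ' : ℕ → ℝ, IsOptimal α h κ' → κ' = κ) : IsRigid (lag α h) α κ := by
  have hκs := hopt.summable hα1
  have hle1 : ∀ i, α i ≤ 1 := fun i => hα1.2 ⟨i, rfl⟩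
  have ha0 := lag_nonneg hα0 h
  have ha1 := lag_le_one hle1 h
  have hκ0 := hopt.1.1
  have hsa := summable_mul_of_le_one ha0 ha1 hκ0 hκs
  have hsb := summable_mul_of_le_one hα0 hle1 hκ0 hκs
  have hA : 1 ≤ ∑' n, lag α h n * κ n :=
    (one_le_tsum_ofReal_iff (fun n => mul_nonneg (ha0 n) (hκ0 n)) hsa).1 hopt.1.2.1
  have hB : 1 ≤ ∑' n, α n * κ n :=
    (one_le_tsum_ofReal_iff (fun n => mul_nonneg (hα0 n) (hκ0 n)) hsb).1 hopt.1.2.2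
  refine ⟨hκ0, hκs, hA, hB, fun F d hda hdb hds hneg => ?_⟩
  have small : ∀ {x y : ℝ}, (0 ≤ y ∨ 0 < x) → 0 ≤ x → ∀ᶠ t in 𝓝[>] (0 : ℝ), 0 ≤ x + t * y := by
    rintro x y (hy | hx) hx0
    · filter_upwards [self_mem_nhdsWithin] with t ht
      have : (0 : ℝ) < t := ht
      positivity
    · have : Tendsto (fun t : ℝ => x + t * y) (𝓝[>] 0) (𝓝 (x + 0 * y)) :=
        ((continuous_const.add (continuous_id.mul continuous_const)).tendsto _).mono_left
          nhdsWithin_le_nhds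
      rw [zero_mul, add_zero] at this
      filter_upwards [this.eventually (lt_mem_nhds hx)] with t ht using ht.le
  have e1 : ∀ᶠ t in 𝓝[>] (0 : ℝ), ∀ n ∈ F, 0 ≤ κ n + t * d n := by
    rw [Filter.eventually_all_finset]
    intro n hn
    refine small ?_ (hκ0 n)
    rcases le_or_gt 0 (d n) with h' | h'
    · exact Or.inl h'
    · exact Or.inr (hneg n hn h')
  have e2 : ∀ᶠ t in 𝓝[>] (0 : ℝ),
      0 ≤ (∑' n, lag α h n * κ n - 1) + t * ∑ n ∈ F, lag α h n * d n :=
    small (hda.imp id sub_pos.2) (sub_nonneg.2 hA)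
  have e3 : ∀ᶠ t in 𝓝[>] (0 : ℝ), 0 ≤ (∑' n, α n * κ n - 1) + t * ∑ n ∈ F, α n * d n :=
    small (hdb.imp id sub_pos.2) (sub_nonneg.2 hB)
  obtain ⟨t, ⟨⟨ht1, ht2⟩, ht3⟩, ht0⟩ :=
    (((e1.and e2).and e3).and self_mem_nhdsWithin).exists
  have ht0 : 0 < t := ht0
  set κ' : ℕ → ℝ := fun n => κ n + if n ∈ F then t * d n else 0 with hκ'
  have hfs : ∀ c : ℕ → ℝ, HasSum (fun n => if n ∈ F then c n else 0) (∑ n ∈ F, c n) := by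
    intro c
    have h1 : HasSum (fun n => if n ∈ F then c n else 0) (∑ n ∈ F, if n ∈ F then c n else 0) :=
      hasSum_sum_of_ne_finset_zero fun n hn => by simp [hn]
    rwa [Finset.sum_congr rfl fun n hn => if_pos hn] at h1
  have hκ'0 : ∀ n, 0 ≤ κ' n := by
    intro n
    by_cases hn : n ∈ F
    · simp only [hκ', hn, if_true]; exact ht1 n hn
    · simp only [hκ', hn, if_false, add_zero]; exact hκ0 n
  have hsum : ∀ c : ℕ → ℝ, Summable (fun n => c n * κ n) →
      HasSum (fun n => c n * κ' n) (∑' n, c n * κ n + t * ∑ n ∈ F, c n * d n) := by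
    intro c hc
    have h2 := hc.hasSum.add ((hfs fun n => c n * d n).mul_left t)
    refine h2.congr_fun fun n => ?_
    simp only [hκ']
    split_ifs <;> ring
  have hfeas : IsFeasible α h κ' := by
    refine ⟨hκ'0, ?_, ?_⟩
    · rw [one_le_tsum_ofReal_iff (fun n => mul_nonneg (ha0 n) (hκ'0 n)) (hsum _ hsa).summable,
        (hsum _ hsa).tsum_eq]
      linarith
    · rw [one_le_tsum_ofReal_iff (fun n => mul_nonneg (hα0 n) (hκ'0 n)) (hsum _ hsb).summable,
        (hsum _ hsb).tsum_eq]
      linarith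
  have hs1 := hsum (fun _ => 1) (by simpa using hκs)
  simp only [one_mul] at hs1
  have hobj : ∑' n, ENNReal.ofReal (κ' n) ≤ ∑' n, ENNReal.ofReal (κ n) := by
    rw [← ENNReal.ofReal_tsum_of_nonneg hκ'0 hs1.summable,
      ← ENNReal.ofReal_tsum_of_nonneg hκ0 hκs, hs1.tsum_eq]
    refine ENNReal.ofReal_le_ofReal ?_
    nlinarith
  have heq := hunique κ' ⟨hfeas, fun κ'' h'' => hobj.trans (hopt.2 κ'' h'')⟩
  intro n hn
  have h1 := congrFun heq n
  simp only [hκ', hn, if_true, add_eq_left, mul_eq_zero] at h1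
  exact h1.resolve_left ht0.ne'

section

variable {a b κ : ℕ → ℝ}

lemma IsRigid.two (hr : IsRigid a b κ) {i j : ℕ} (hij : i ≠ j) (hi : 0 < κ i) (hj : 0 < κ j)
    {u v : ℝ} (ha : 0 ≤ a i * u + a j * v ∨ 1 < ∑' n, a n * κ n)
    (hb : 0 ≤ b i * u + b j * v ∨ 1 < ∑' n, b n * κ n) (hs : u + v ≤ 0) : u = 0 ∧ v = 0 := by
  have h := hr.rigid {i, j} (fun n => if n = i then u else v)
    (by rw [Finset.sum_pair hij]; simpa [hij.symm] using ha)
    (by rw [Finset.sum_pair hij]; simpa [hij.symm] using hb)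
    (by rw [Finset.sum_pair hij]; simpa [hij.symm] using hs)
    (by simp [hij.symm, hi, hj])
  exact ⟨by simpa using h i (by simp), by simpa [hij.symm] using h j (by simp)⟩

lemma IsRigid.three (hr : IsRigid a b κ) {i j k : ℕ} (hij : i ≠ j) (hki : k ≠ i) (hkj : k ≠ j)
    (hi : 0 < κ i) {u v w : ℝ} (hv : v < 0 → 0 < κ j) (hw : w < 0 → 0 < κ k)
    (ha : 0 ≤ a i * u + a j * v + a k * w)
    (hb : 0 ≤ b i * u + b j * v + b k * w) (hs : u + v + w ≤ 0) : u = 0 ∧ v = 0 ∧ w = 0 := by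
  have hsum : ∀ f : ℕ → ℝ, ∑ n ∈ ({i, j, k} : Finset ℕ), f n = f i + f j + f k := by
    intro f
    rw [Finset.sum_insert (by simp [hij, hki.symm]), Finset.sum_pair hkj.symm, add_assoc]
  have h := hr.rigid {i, j, k} (fun n => if n = i then u else if n = j then v else w)
    (by rw [hsum]; simpa [hij.symm, hki, hkj] using Or.inl ha)
    (by rw [hsum]; simpa [hij.symm, hki, hkj] using Or.inl hb)
    (by rw [hsum]; simpa [hij.symm, hki, hkj] using hs)
    (by simp [hij.symm, hki, hkj, hi]; exact ⟨hv, hw⟩)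
  exact ⟨by simpa using h i (by simp), by simpa [hij.symm] using h j (by simp),
    by simpa [hki, hkj] using h k (by simp)⟩

/-- The dual solution when the solution has two positive components. -/
theorem IsRigid.dual_two (hr : IsRigid a b κ) {i j : ℕ} (hij : i ≠ j) (hi : 0 < κ i)
    (hj : 0 < κ j) (D : ℝ) (hD : D = b j * a i - b i * a j) :
    D ≠ 0 ∧ 0 < (b j - b i) / D ∧ 0 < (a i - a j) / D ∧
      (∀ k, k ≠ i → k ≠ j → (b j - b i) / D * a k + (a i - a j) / D * b k < 1) ∧
      (∀ k, k ≠ i → k ≠ j → κ k = 0) ∧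
      a i * κ i + a j * κ j = 1 ∧ b i * κ i + b j * κ j = 1 ∧
      ∑' n, κ n = (b j - b i) / D + (a i - a j) / D := by
  -- A kernel vector changes neither constraint, and either it or its negative does not raise the
  -- cost.
  have hker : ∀ u v : ℝ, a i * u + a j * v = 0 → b i * u + b j * v = 0 → u = 0 ∧ v = 0 := by
    intro u v h1 h2
    rcases le_total (u + v) 0 with h | h
    · exact hr.two hij hi hj (Or.inl h1.ge) (Or.inl h2.ge) h
    · have := hr.two hij hi hj (u := -u) (v := -v) (Or.inl (by linarith)) (Or.inl (by linarith))
        (by linarith)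
      exact ⟨by linarith [this.1], by linarith [this.2]⟩
  have hD0 : D ≠ 0 := by
    intro h0
    rw [hD] at h0
    obtain ⟨h1, h2⟩ := hker (a j) (-a i) (by ring) (by linarith)
    obtain ⟨h3, h4⟩ := hker (b j) (-b i) (by linarith) (by ring)
    have := hker 1 0 (by linarith) (by linarith)
    exact one_ne_zero this.1
  set p := (b j - b i) / D with hp
  set q := (a i - a j) / D with hq
  have hpi : p * a i + q * b i = 1 := by rw [hp, hq]; field_simp; rw [hD]; ring
  have hpj : p * a j + q * b j = 1 := by rw [hp, hq]; field_simp; rw [hD]; ring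
  have hp1a : a i * (b j / D) + a j * (-b i / D) = 1 := by field_simp; rw [hD]; ring
  have hp1b : b i * (b j / D) + b j * (-b i / D) = 0 := by field_simp; ring
  have hq1a : a i * (-a j / D) + a j * (a i / D) = 0 := by field_simp; ring
  have hq1b : b i * (-a j / D) + b j * (a i / D) = 1 := by field_simp; rw [hD]; ring
  have hps : b j / D + -b i / D = p := by rw [hp]; ring
  have hqs : -a j / D + a i / D = q := by rw [hq]; ring
  -- The move `(b j / D, -b i / D)` raises the first constraint by one, keeps the second and costs
  -- `p`; so `p` is a shadow price, positive by rigidity. The same argument with the constraints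
  -- exchanged gives `q`.
  have hp0 : 0 < p := by
    by_contra! h
    obtain ⟨h1, h2⟩ := hr.two hij hi hj (u := b j / D) (v := -b i / D)
      (Or.inl (by rw [hp1a]; exact zero_le_one)) (Or.inl hp1b.ge) (by rw [hps]; exact h)
    rw [h1, h2] at hp1a; norm_num at hp1a
  have hq0 : 0 < q := by
    by_contra! h
    obtain ⟨h1, h2⟩ := hr.two hij hi hj (u := -a j / D) (v := a i / D)
      (Or.inl hq1a.ge) (Or.inl (by rw [hq1b]; exact zero_le_one)) (by rw [hqs]; exact h)
    rw [h1, h2] at hq1b; norm_num at hq1b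
  -- One unit at `k` is offset in both constraints by masses `u` at `i` and `v` at `j`, at net cost
  -- `1 - (p a_k + q b_k)`. Carried out forwards, this exchange gives the strict inequality `hlt`;
  -- backwards it gives `κ k = 0`.
  have hk : ∀ k, ∃ u v : ℝ, a i * u + a j * v + a k = 0 ∧ b i * u + b j * v + b k = 0 ∧
      u + v = -(p * a k + q * b k) := by
    intro k
    refine ⟨-(a k * (b j / D) + b k * (-a j / D)), -(a k * (-b i / D) + b k * (a i / D)),
      ?_, ?_, ?_⟩
    · linear_combination -a k * hp1a - b k * hq1a
    · linear_combination -a k * hp1b - b k * hq1b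
    · linear_combination -a k * hps - b k * hqs
  have hlt : ∀ k, k ≠ i → k ≠ j → p * a k + q * b k < 1 := by
    intro k hki hkj
    by_contra! h
    obtain ⟨u, v, h1, h2, h3⟩ := hk k
    have := hr.three hij hki hkj hi (u := u) (v := v) (w := 1) (fun _ => hj) (by norm_num)
      (by linarith) (by linarith) (by linarith)
    exact one_ne_zero this.2.2
  have hz : ∀ k, k ≠ i → k ≠ j → κ k = 0 := by
    intro k hki hkj
    by_contra hne
    have hpos : 0 < κ k := lt_of_le_of_ne (hr.nonneg k) (Ne.symm hne)
    obtain ⟨u, v, h1, h2, h3⟩ := hk k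
    have := hr.three hij hki hkj hi (u := -u) (v := -v) (w := -1) (fun _ => hj) (fun _ => hpos)
      (by linarith) (by linarith) (by linarith [hlt k hki hkj])
    linarith [this.2.2]
  have htsum : ∀ c : ℕ → ℝ, ∑' n, c n * κ n = c i * κ i + c j * κ j := by
    intro c
    rw [tsum_eq_sum (s := {i, j}), Finset.sum_pair hij]
    intro n hn
    simp only [Finset.mem_insert, Finset.mem_singleton, not_or] at hn
    rw [hz n hn.1 hn.2, mul_zero]
  -- A slack first constraint could be lowered by the reversed move, at cost `-p < 0`.
  have hA : a i * κ i + a j * κ j = 1 := by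
    rw [← htsum]
    refine le_antisymm ?_ hr.le_a
    by_contra! h
    obtain ⟨h1, h2⟩ := hr.two hij hi hj (u := -(b j / D)) (v := -(-b i / D))
      (Or.inr h) (Or.inl (by linarith)) (by linarith)
    rw [neg_eq_zero] at h1 h2
    rw [h1, h2] at hp1a; norm_num at hp1a
  have hB : b i * κ i + b j * κ j = 1 := by
    rw [← htsum]
    refine le_antisymm ?_ hr.le_b
    by_contra! h
    obtain ⟨h1, h2⟩ := hr.two hij hi hj (u := -(-a j / D)) (v := -(a i / D))
      (Or.inl (by linarith)) (Or.inr h) (by linarith)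
    rw [neg_eq_zero] at h1 h2
    rw [h1, h2] at hq1b; norm_num at hq1b
  refine ⟨hD0, hp0, hq0, hlt, hz, hA, hB, ?_⟩
  have := htsum fun _ => 1
  simp only [one_mul] at this
  rw [this]
  linear_combination p * hA + q * hB - κ i * hpi - κ j * hpj

/-- The dual solution when the solution has exactly one positive component. -/
theorem IsRigid.dual_one (hr : IsRigid a b κ) (ha0 : ∀ n, 0 ≤ a n) (hb0 : ∀ n, 0 ≤ b n)
    (ha1 : ∀ n, a n ≤ 1) (hb1 : ∀ n, b n ≤ 1)
    (hma : ∃ m, a m = 1) (hmb : ∃ m, b m = 1) (hal : Tendsto a atTop (𝓝 0))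
    (hbl : Tendsto b atTop (𝓝 0)) {i : ℕ} (hi : 0 < κ i) (hz : ∀ j, j ≠ i → κ j = 0) :
    a i = b i ∧ 0 < b i ∧ b i * κ i = 1 ∧ ∑' n, κ n = κ i ∧
      ∃ p q : ℝ, 0 < p ∧ 0 < q ∧ p + q = κ i ∧ ∀ k, k ≠ i → p * a k + q * b k < 1 := by
  have htsum : ∀ c : ℕ → ℝ, ∑' n, c n * κ n = c i * κ i := fun c =>
    tsum_eq_single i fun n hn => by rw [hz n hn, mul_zero]
  have hA := hr.le_a
  have hB := hr.le_b
  rw [htsum] at hA hB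
  have hpair : ∀ m, m ≠ i → ∀ u v : ℝ, (0 ≤ a i * u + a m * v ∨ 1 < a i * κ i) →
      (0 ≤ b i * u + b m * v ∨ 1 < b i * κ i) → u + v ≤ 0 → 0 ≤ v → u = 0 ∧ v = 0 := by
    intro m hm u v h1 h2 h3 h4
    have h := hr.rigid {i, m} (fun n => if n = i then u else v)
      (by rw [Finset.sum_pair hm.symm, htsum]; simpa [hm] using h1)
      (by rw [Finset.sum_pair hm.symm, htsum]; simpa [hm] using h2)
      (by rw [Finset.sum_pair hm.symm]; simpa [hm] using h3)
      (by simp [hm, hi]; intro h; linarith)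
    exact ⟨by simpa using h i (by simp), by simpa [hm] using h m (by simp)⟩
  -- If `a i < b i`, the second constraint is slack. Replacing one unit at `i` by `a i` units at an
  -- index with `a m = 1` keeps the first constraint and costs `a i - 1 ≤ 0`.
  have hab : a i = b i := by
    rcases lt_trichotomy (a i) (b i) with h | h | h
    · exfalso
      obtain ⟨m, hm⟩ := hma
      have hmi : m ≠ i := fun h' => by rw [h'] at hm; linarith [hb1 i]
      have := hpair m hmi (-1) (a i) (Or.inl (by rw [hm]; linarith))
        (Or.inr (lt_of_le_of_lt hA (by gcongr))) (by linarith [ha1 i]) (ha0 i)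
      linarith [this.1]
    · exact h
    · exfalso
      obtain ⟨m, hm⟩ := hmb
      have hmi : m ≠ i := fun h' => by rw [h'] at hm; linarith [ha1 i]
      have := hpair m hmi (-1) (b i) (Or.inr (lt_of_le_of_lt hB (by gcongr)))
        (Or.inl (by rw [hm]; linarith)) (by linarith [hb1 i]) (hb0 i)
      linarith [this.1]
  have hc0 : 0 < b i := by
    by_contra! h
    nlinarith
  have hone : b i * κ i = 1 := by
    refine le_antisymm ?_ hB
    by_contra! h
    have := hpair (i + 1) (by omega) (-1) 0 (Or.inr (by rwa [hab])) (Or.inr h) (by norm_num) le_rfl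
    linarith [this.1]
  have hκs : ∑' n, κ n = κ i := by
    have := htsum fun _ => 1
    simpa using this
  refine ⟨hab, hc0, hone, hκs, ?_⟩
  set c := b i with hc
  -- The dual solution is sought as `(t κ_i, (1 - t) κ_i)`, which requires `t a_k + (1 - t) b_k < c`
  -- for all `k ≠ i`. By `hsing` each such constraint is a one-sided bound on `t` or no restriction
  -- on (0,1); by `hcross` lower bounds lie below upper bounds.
  have hsing : ∀ k, k ≠ i → a k < c ∨ b k < c := by
    intro k hk
    by_contra! h
    have := hpair k hk (-1) 1 (Or.inl (by linarith [h.1])) (Or.inl (by linarith [h.2]))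
      (by norm_num) zero_le_one
    linarith [this.1]
  have hcross : ∀ k l, k ≠ i → l ≠ i → c ≤ b k → c ≤ a l →
      (b k - c) * (a l - c) < (c - b l) * (c - a k) := by
    intro k l hk hl hbk hal'
    have hak : a k < c := (hsing k hk).resolve_right (not_lt.2 hbk)
    have hbl' : b l < c := (hsing l hl).resolve_left (not_lt.2 hal')
    have hkl : k ≠ l := fun h => by rw [h] at hak; linarith
    by_contra! h
    -- The weights leave the first constraint unchanged at zero net cost; if the claimed inequality
    -- failed, the second constraint would not decrease either.
    have := hr.three (i := i) (j := k) (k := l) hk.symm hl hkl.symm hi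
      (u := -((a l - c) + (c - a k))) (v := a l - c) (w := c - a k)
      (fun h => by linarith) (fun h => by linarith)
      (by rw [hab]; nlinarith) (by nlinarith) (by linarith)
    linarith [this.2.2]
  have hfinset : ∀ f : ℕ → ℝ, Tendsto f atTop (𝓝 0) → {k | c ≤ f k}.Finite := by
    intro f hf
    have := hf.eventually_lt_const hc0
    rw [← Nat.cofinite_eq_atTop, Filter.eventually_cofinite] at this
    simpa using this
  classical
  -- Since `a` and `b` tend to zero, only finitely many `k` restrict `t`: those in `K` from below,
  -- those in `L` from above.
  let K := (hfinset b hbl).toFinset.erase i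
  let L := (hfinset a hal).toFinset.erase i
  have hK : ∀ k ∈ K, k ≠ i ∧ c ≤ b k := by simp [K]
  have hL : ∀ k ∈ L, k ≠ i ∧ c ≤ a k := by simp [L]
  obtain ⟨t, ht1, ht2⟩ := Order.exists_between_finsets
    (insert 0 (K.image fun k => (b k - c) / (b k - a k)))
    (insert 1 (L.image fun l => (c - b l) / (a l - b l))) (by
      intro x hx y hy
      rw [Finset.mem_insert, Finset.mem_image] at hx hy
      rcases hx with rfl | ⟨k, hk, rfl⟩ <;> rcases hy with rfl | ⟨l, hl, rfl⟩
      · exact one_pos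
      · obtain ⟨h1, h2⟩ := hL l hl
        have := (hsing l h1).resolve_left (not_lt.2 h2)
        exact div_pos (by linarith) (by linarith)
      · obtain ⟨h1, h2⟩ := hK k hk
        have := (hsing k h1).resolve_right (not_lt.2 h2)
        rw [div_lt_one (by linarith)]
        linarith
      · obtain ⟨h1, h2⟩ := hK k hk
        obtain ⟨h3, h4⟩ := hL l hl
        have h5 := (hsing k h1).resolve_right (not_lt.2 h2)
        have h6 := (hsing l h3).resolve_left (not_lt.2 h4)
        rw [div_lt_div_iff₀ (by linarith) (by linarith)]
        nlinarith [hcross k l h1 h3 h2 h4])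
  have ht0 : 0 < t := ht1 0 (by simp)
  have ht11 : t < 1 := ht2 1 (by simp)
  refine ⟨t * κ i, (1 - t) * κ i, by positivity, mul_pos (by linarith) hi, by ring, ?_⟩
  intro k hk
  have hkey : t * a k + (1 - t) * b k < c := by
    rcases le_or_gt c (b k) with h | h
    · have hak := (hsing k hk).resolve_right (not_lt.2 h)
      have := ht1 ((b k - c) / (b k - a k)) (Finset.mem_insert_of_mem
        (Finset.mem_image_of_mem _ (by simp [K, hk, h])))
      rw [div_lt_iff₀ (by linarith)] at this
      linarith
    · rcases le_or_gt c (a k) with h' | h'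
      · have := ht2 ((c - b k) / (a k - b k)) (Finset.mem_insert_of_mem
          (Finset.mem_image_of_mem _ (by simp [L, hk, h'])))
        rw [lt_div_iff₀ (by linarith)] at this
        linarith
      · nlinarith
  calc t * κ i * a k + (1 - t) * κ i * b k = (t * a k + (1 - t) * b k) * κ i := by ring
    _ < c * κ i := by gcongr
    _ = 1 := hone

end

/-! ### Exponential moments of linear processes and conditioning on independent blocks -/

/-- The sum of the series `∑ c_k x_k`. -/
noncomputable def ser (c x : ℕ → ℝ) : ℝ := ∑' k, c k * x k

lemma measurable_ser (c : ℕ → ℝ) : Measurable (ser c) :=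
  Measurable.tsum fun k => by fun_prop

variable {Ω : Type*} [MeasurableSpace Ω] {P : Measure Ω}

/-- The expectation of `∑ c_k |ξ_k|` is `(∑ c_k) E|ξ_0|`, which is finite. -/
lemma ae_summable_mul {c : ℕ → ℝ} (hc : Summable c) (hc0 : ∀ k, 0 ≤ c k) {ξ : ℕ → Ω → ℝ}
    {τ : Measure ℝ} (hξ : ∀ k, Measurable (ξ k)) (hlaw : ∀ k, P.map (ξ k) = τ)
    (hint : Integrable id τ) : ∀ᵐ ω ∂P, Summable fun k => c k * ξ k ω := by
  have hmeas : ∀ k, Measurable fun ω => ‖c k * ξ k ω‖ₑ := fun k =>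
    ((hξ k).const_mul _).enorm
  have hfin : ∫⁻ ω, ∑' k, ‖c k * ξ k ω‖ₑ ∂P ≠ ⊤ := by
    rw [lintegral_tsum fun k => (hmeas k).aemeasurable]
    have : ∀ k, ∫⁻ ω, ‖c k * ξ k ω‖ₑ ∂P = ENNReal.ofReal (c k) * ∫⁻ y, ‖y‖ₑ ∂τ := by
      intro k
      rw [← hlaw k, lintegral_map measurable_enorm (hξ k), ← lintegral_const_mul _ (hξ k).enorm]
      refine lintegral_congr fun ω => ?_
      rw [enorm_mul, Real.enorm_of_nonneg (hc0 k)]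
    simp_rw [this]
    rw [ENNReal.tsum_mul_right, ← ENNReal.ofReal_tsum_of_nonneg hc0 hc]
    exact ENNReal.mul_ne_top ENNReal.ofReal_ne_top hint.hasFiniteIntegral.ne
  filter_upwards [ae_lt_top (Measurable.tsum hmeas) hfin] with ω hω
  refine Summable.of_norm ?_
  have := ENNReal.summable_toReal hω.ne
  simpa using this

/-- Convexity gives `exp(c y) ≤ 1 + (c / θ) exp(θ y)`, and `1 + x ≤ exp x` after integration. The
bound is exponential and linear in `c` in the exponent, so that products over many coefficients only
see their sum. -/
lemma lintegral_exp_mul_le [IsProbabilityMeasure P] {X : Ω → ℝ} {θ c : ℝ} (hθ : 0 < θ)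
    (hint : Integrable (fun ω => Real.exp (θ * X ω)) P) (hc0 : 0 ≤ c) (hcθ : c ≤ θ) :
    ∫⁻ ω, ENNReal.ofReal (Real.exp (c * X ω)) ∂P ≤
      ENNReal.ofReal (Real.exp (c * ((∫ ω, Real.exp (θ * X ω) ∂P) / θ))) := by
  have hpt : ∀ y : ℝ, Real.exp (c * y) ≤ 1 + c / θ * Real.exp (θ * y) := by
    intro y
    have h : Real.exp ((1 - c / θ) • (0 : ℝ) + (c / θ) • (θ * y)) ≤
        (1 - c / θ) • Real.exp 0 + (c / θ) • Real.exp (θ * y) :=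
      convexOn_exp.2 (Set.mem_univ 0) (Set.mem_univ (θ * y))
        (by rw [sub_nonneg, div_le_one hθ]; exact hcθ) (div_nonneg hc0 hθ.le) (by ring)
    simp only [smul_eq_mul, mul_zero, zero_add, Real.exp_zero, mul_one] at h
    rw [show c / θ * (θ * y) = c * y by field_simp] at h
    have : 0 ≤ c / θ := by positivity
    linarith
  have hint' : Integrable (fun ω => 1 + c / θ * Real.exp (θ * X ω)) P :=
    (integrable_const _).add (hint.const_mul _)
  calc ∫⁻ ω, ENNReal.ofReal (Real.exp (c * X ω)) ∂P
      ≤ ∫⁻ ω, ENNReal.ofReal (1 + c / θ * Real.exp (θ * X ω)) ∂P :=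
        lintegral_mono fun ω => ENNReal.ofReal_le_ofReal (hpt _)
    _ = ENNReal.ofReal (∫ ω, 1 + c / θ * Real.exp (θ * X ω) ∂P) :=
        (ofReal_integral_eq_lintegral_ofReal hint' (ae_of_all _ fun ω => by positivity)).symm
    _ ≤ _ := by
        refine ENNReal.ofReal_le_ofReal ?_
        rw [integral_add (integrable_const _) (hint.const_mul _), integral_const_mul]
        simp only [integral_const, probReal_univ, smul_eq_mul, mul_one]
        have := Real.add_one_le_exp (c * ((∫ ω, Real.exp (θ * X ω) ∂P) / θ))
        calc _ = c * ((∫ ω, Real.exp (θ * X ω) ∂P) / θ) + 1 := by ring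
          _ ≤ _ := this

/-- Exponential moments of a linear process whose coefficients are bounded away from one. -/
theorem integrable_exp_ser [IsProbabilityMeasure P] {c : ℕ → ℝ} (hc : Summable c)
    (hc0 : ∀ k, 0 ≤ c k) {θ : ℝ} (hθ : 0 < θ) (hcθ : ∀ k, c k ≤ θ) {ξ : ℕ → Ω → ℝ}
    {τ : Measure ℝ} (hξ : ∀ k, Measurable (ξ k)) (hlaw : ∀ k, P.map (ξ k) = τ)
    (hind : iIndepFun ξ P) (hint : Integrable id τ)
    (hexp : Integrable (fun y => Real.exp (θ * y)) τ) :
    Integrable (fun ω => Real.exp (ser c fun k => ξ k ω)) P := by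
  have hmeas : Measurable fun ω => Real.exp (ser c fun k => ξ k ω) :=
    Real.measurable_exp.comp ((measurable_ser c).comp (measurable_pi_lambda _ hξ))
  refine ⟨hmeas.aestronglyMeasurable, ?_⟩
  rw [hasFiniteIntegral_iff_ofReal (ae_of_all _ fun ω => (Real.exp_pos _).le)]
  set M := (∫ y, Real.exp (θ * y) ∂τ) / θ with hM
  have hM0 : 0 ≤ M := div_nonneg (integral_nonneg fun y => (Real.exp_pos _).le) hθ.le
  have hlaw_int : ∀ k, ∫⁻ ω, ENNReal.ofReal (Real.exp (c k * ξ k ω)) ∂P ≤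
      ENNReal.ofReal (Real.exp (c k * M)) := by
    intro k
    have he : Integrable (fun ω => Real.exp (θ * ξ k ω)) P := by
      rw [← hlaw k] at hexp
      exact hexp.comp_measurable (hξ k)
    have := lintegral_exp_mul_le hθ he (hc0 k) (hcθ k)
    rwa [← integral_map (f := fun y => Real.exp (θ * y)) (hξ k).aemeasurable
      (Measurable.aestronglyMeasurable (by fun_prop)), hlaw k] at this
  have hfin : ∀ n : ℕ, ∫⁻ ω, ENNReal.ofReal (Real.exp (∑ k ∈ Finset.range n, c k * ξ k ω)) ∂P ≤
      ENNReal.ofReal (Real.exp (M * ∑' k, c k)) := by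
    intro n
    calc ∫⁻ ω, ENNReal.ofReal (Real.exp (∑ k ∈ Finset.range n, c k * ξ k ω)) ∂P
        = ∫⁻ ω, ∏ k ∈ Finset.range n, ENNReal.ofReal (Real.exp (c k * ξ k ω)) ∂P := by
          refine lintegral_congr fun ω => ?_
          rw [Real.exp_sum, ENNReal.ofReal_prod_of_nonneg fun k _ => (Real.exp_pos _).le]
      _ = ∏ k ∈ Finset.range n, ∫⁻ ω, ENNReal.ofReal (Real.exp (c k * ξ k ω)) ∂P :=
          lintegral_prod_eq_prod_lintegral_of_indepFun (Finset.range n)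
            (fun k ω => ENNReal.ofReal (Real.exp (c k * ξ k ω)))
            (hind.comp (fun k y => ENNReal.ofReal (Real.exp (c k * y))) fun k => by fun_prop)
            fun k => by have := hξ k; fun_prop
      _ ≤ ∏ k ∈ Finset.range n, ENNReal.ofReal (Real.exp (c k * M)) :=
          Finset.prod_le_prod' fun k _ => hlaw_int k
      _ = ENNReal.ofReal (Real.exp (∑ k ∈ Finset.range n, c k * M)) := by
          rw [Real.exp_sum, ENNReal.ofReal_prod_of_nonneg fun k _ => (Real.exp_pos _).le]
      _ ≤ _ := by
          refine ENNReal.ofReal_le_ofReal (Real.exp_le_exp.2 ?_)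
          rw [← Finset.sum_mul, mul_comm]
          exact mul_le_mul_of_nonneg_left (hc.sum_le_tsum _ fun k _ => hc0 k) hM0
  -- Fatou's lemma carries the uniform bound on the partial sums over to the series.
  have hlim : ∀ᵐ ω ∂P, ENNReal.ofReal (Real.exp (ser c fun k => ξ k ω)) = atTop.liminf
      fun n : ℕ => ENNReal.ofReal (Real.exp (∑ k ∈ Finset.range n, c k * ξ k ω)) := by
    filter_upwards [ae_summable_mul hc hc0 hξ hlaw hint] with ω hω
    exact ((ENNReal.continuous_ofReal.comp Real.continuous_exp).tendsto _ |>.comp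
      hω.hasSum.tendsto_sum_nat).liminf_eq.symm
  rw [lintegral_congr_ae hlim]
  refine lt_of_le_of_lt (lintegral_liminf_le fun n => ?_) ?_
  · have : Measurable fun ω => ∑ k ∈ Finset.range n, c k * ξ k ω :=
      Finset.measurable_sum _ fun k _ => (hξ k).const_mul _
    fun_prop
  · refine lt_of_le_of_lt ?_ (ENNReal.ofReal_lt_top (r := Real.exp (M * ∑' k, c k)))
    exact liminf_le_of_frequently_le' (Frequently.of_forall hfin)

lemma comap_process_le {Ω' : Type*} {m : MeasurableSpace Ω'} {f : Ω' → ℕ → ℝ}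
    (hf : ∀ k, Measurable[m] fun ω => f ω k) : MeasurableSpace.comap f inferInstance ≤ m :=
  measurable_iff_comap_le.1 (measurable_pi_lambda f hf)

/-- Disjoint blocks of an independent sequence are independent. -/
lemma indepFun_mask {ξ : ℕ → Ω → ℝ} (hξ : ∀ k, Measurable (ξ k)) (hind : iIndepFun ξ P)
    (S : Finset ℕ) :
    IndepFun (fun ω k => if k ∈ S then ξ k ω else 0) (fun ω k => if k ∈ S then 0 else ξ k ω) P := by
  have h := indep_iSup_of_disjoint (fun k => (hξ k).comap_le) hind
    (disjoint_compl_right (a := (S : Set ℕ)))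
  rw [IndepFun_iff_Indep]
  refine indep_of_indep_of_le h ?_ ?_
  · refine comap_process_le fun k => ?_
    by_cases hk : k ∈ S
    · simp only [hk, if_true]
      exact Measurable.mono (comap_measurable (ξ k))
        (le_iSup₂_of_le k (by simpa using hk) le_rfl) le_rfl
    · simp only [hk, if_false]
      exact measurable_const
  · refine comap_process_le fun k => ?_
    by_cases hk : k ∈ S
    · simp only [hk, if_true]
      exact measurable_const
    · simp only [hk, if_false]
      exact Measurable.mono (comap_measurable (ξ k))
        (le_iSup₂_of_le k (by simpa using hk) le_rfl) le_rfl

/-- Both hypotheses factorise the joint law into a triple product, which may be regrouped. This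
joins `V` to the remaining innovations. -/
lemma indepFun_prodMk_right [IsProbabilityMeasure P] {S T R : Type*} [MeasurableSpace S]
    [MeasurableSpace T] [MeasurableSpace R] {X : Ω → S} {Y : Ω → T} {V : Ω → R}
    (hX : Measurable X) (hY : Measurable Y) (hV : Measurable V) (hXY : IndepFun X Y P)
    (hXYV : IndepFun (fun ω => (X ω, Y ω)) V P) : IndepFun X (fun ω => (Y ω, V ω)) P := by
  have hYV : IndepFun Y V P := hXYV.comp measurable_snd measurable_id
  have := Measure.isProbabilityMeasure_map (μ := P) hX.aemeasurable
  have := Measure.isProbabilityMeasure_map (μ := P) hY.aemeasurable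
  have := Measure.isProbabilityMeasure_map (μ := P) hV.aemeasurable
  rw [indepFun_iff_map_prod_eq_prod_map_map hX.aemeasurable (hY.prodMk hV).aemeasurable,
    (indepFun_iff_map_prod_eq_prod_map_map hY.aemeasurable hV.aemeasurable).1 hYV,
    ← Measure.prodAssoc_prod,
    ← (indepFun_iff_map_prod_eq_prod_map_map hX.aemeasurable hY.aemeasurable).1 hXY,
    ← (indepFun_iff_map_prod_eq_prod_map_map (hX.prodMk hY).aemeasurable hV.aemeasurable).1 hXYV,
    Measure.map_map (by fun_prop) ((hX.prodMk hY).prodMk hV)]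
  rfl

/-- Conditioning on an independent factor, combined with dominated convergence. -/
theorem tendsto_real_div_of_indepFun [IsProbabilityMeasure P] {S R : Type*} [MeasurableSpace S]
    [MeasurableSpace R] {U : Ω → S} {W : Ω → R} (hU : Measurable U) (hW : Measurable W)
    (hUW : IndepFun U W P) (E : ℝ → Set (S × R)) (hE : ∀ x, MeasurableSet (E x)) (N : ℝ → ℝ)
    (bound L : R → ℝ) (hbound : Integrable (fun ω => bound (W ω)) P)
    (hle : ∀ᶠ x in atTop, ∀ ω, |(P.map U).real {u | (u, W ω) ∈ E x} / N x| ≤ bound (W ω))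
    (hlim : ∀ ω, Tendsto (fun x => (P.map U).real {u | (u, W ω) ∈ E x} / N x) atTop
      (𝓝 (L (W ω)))) :
    Tendsto (fun x => P.real {ω | (U ω, W ω) ∈ E x} / N x) atTop (𝓝 (∫ ω, L (W ω) ∂P)) := by
  have := Measure.isProbabilityMeasure_map (μ := P) hU.aemeasurable
  have := Measure.isProbabilityMeasure_map (μ := P) hW.aemeasurable
  have hmeas : ∀ x, Measurable fun w => (P.map U) {u | (u, w) ∈ E x} := fun x =>
    measurable_measure_prodMk_right (hE x)
  have hEq : ∀ x, P.real {ω | (U ω, W ω) ∈ E x} =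
      ∫ ω, (P.map U).real {u | (u, W ω) ∈ E x} ∂P := by
    intro x
    have h1 : P {ω | (U ω, W ω) ∈ E x} = ∫⁻ ω, (P.map U) {u | (u, W ω) ∈ E x} ∂P := by
      have : P {ω | (U ω, W ω) ∈ E x} = P.map (fun ω => (U ω, W ω)) (E x) :=
        (Measure.map_apply (hU.prodMk hW) (hE x)).symm
      rw [this, (indepFun_iff_map_prod_eq_prod_map_map hU.aemeasurable hW.aemeasurable).1 hUW,
        Measure.prod_apply_symm (hE x)]
      exact lintegral_map (hmeas x) hW
    rw [Measure.real, h1]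
    exact (integral_toReal ((hmeas x).comp hW).aemeasurable
      (ae_of_all _ fun ω => measure_lt_top _ _)).symm
  simp_rw [hEq, ← integral_div]
  refine tendsto_integral_filter_of_dominated_convergence (fun ω => bound (W ω)) ?_ ?_ hbound
    (ae_of_all _ hlim)
  · exact Eventually.of_forall fun x =>
      ((((hmeas x).ennreal_toReal).comp hW).div_const _).aestronglyMeasurable
  · filter_upwards [hle] with x hx using ae_of_all _ hx

/-- A strict dual constraint remains strict, uniformly, under small changes of the dual solution. -/
lemma exists_uniform_margin {a b : ℕ → ℝ} (ha0 : ∀ n, 0 ≤ a n) (hb0 : ∀ n, 0 ≤ b n)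
    (ha1 : ∀ n, a n ≤ 1) (hb1 : ∀ n, b n ≤ 1)
    (hal : Tendsto a atTop (𝓝 0)) (hbl : Tendsto b atTop (𝓝 0)) (S : Finset ℕ) {p₀ q₀ : ℝ}
    (hp : 0 < p₀) (hq : 0 < q₀) (h : ∀ k, k ∉ S → p₀ * a k + q₀ * b k < 1) :
    ∃ δ θ : ℝ, 0 < δ ∧ 0 < θ ∧ θ < 1 ∧ ∀ p q : ℝ, |p - p₀| ≤ δ → |q - q₀| ≤ δ →
      0 < p ∧ 0 < q ∧ ∀ k, k ∉ S → p * a k + q * b k ≤ θ := by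
  have hlim : Tendsto (fun k => p₀ * a k + q₀ * b k) atTop (𝓝 0) := by
    simpa using (hal.const_mul p₀).add (hbl.const_mul q₀)
  have hfin : {k | 1 / 2 ≤ p₀ * a k + q₀ * b k}.Finite := by
    have := hlim.eventually_lt_const (show (0 : ℝ) < 1 / 2 by norm_num)
    rw [← Nat.cofinite_eq_atTop, Filter.eventually_cofinite] at this
    simpa using this
  classical
  -- Only finitely many constraints reach 1/2, so all constraints off `S` have a common bound `r <
  -- 1`.
  obtain ⟨r, hr1, hr2⟩ := Order.exists_between_finsets
    (insert (1 / 2) ((hfin.toFinset \ S).image fun k => p₀ * a k + q₀ * b k)) {(1 : ℝ)} (by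
      intro x hx y hy
      rw [Finset.mem_singleton] at hy
      rw [Finset.mem_insert, Finset.mem_image] at hx
      rcases hx with rfl | ⟨k, hk, rfl⟩
      · rw [hy]; norm_num
      · rw [hy]; exact h k (Finset.mem_sdiff.1 hk).2)
  have hr0 : 1 / 2 < r := hr1 _ (by simp)
  have hr3 : r < 1 := hr2 1 (by simp)
  have hrk : ∀ k, k ∉ S → p₀ * a k + q₀ * b k ≤ r := by
    intro k hk
    rcases lt_or_ge (p₀ * a k + q₀ * b k) (1 / 2) with h' | h'
    · linarith
    · exact (hr1 _ (Finset.mem_insert_of_mem (Finset.mem_image_of_mem _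
        (by simp [hk]; linarith)))).le
  -- Each of the two perturbations uses at most a quarter of the gap `1 - r`, which leaves `θ = (1 +
  -- r) / 2`; the halves of `p₀` and `q₀` keep the exponents positive.
  refine ⟨min (min (p₀ / 2) (q₀ / 2)) ((1 - r) / 4), (1 + r) / 2, ?_, by linarith, by linarith, ?_⟩
  · refine lt_min (lt_min ?_ ?_) ?_ <;> linarith
  intro p q hpd hqd
  have h1 := min_le_left (min (p₀ / 2) (q₀ / 2)) ((1 - r) / 4)
  have h2 := min_le_right (min (p₀ / 2) (q₀ / 2)) ((1 - r) / 4)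
  have h3 := min_le_left (p₀ / 2) (q₀ / 2)
  have h4 := min_le_right (p₀ / 2) (q₀ / 2)
  rw [abs_le] at hpd hqd
  refine ⟨by linarith [hpd.1], by linarith [hqd.1], fun k hk => ?_⟩
  have := hrk k hk
  have e1 : (p - p₀) * a k ≤ (1 - r) / 4 := by nlinarith [ha0 k, ha1 k, hpd.2]
  have e2 : (q - q₀) * b k ≤ (1 - r) / 4 := by nlinarith [hb0 k, hb1 k, hqd.2]
  linarith

/-! ### The linear model and the factors besides the dominating innovations -/

/-- The ingredients of a pair `(V₁ exp(∑ a_k ξ_k), V₂ exp(∑ b_k ξ_k))` with i.i.d. `ξ_k`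
independent of `V ≥ 0`. -/
structure IsLinearModel {Ω : Type*} [MeasurableSpace Ω] (P : Measure Ω) (τ : Measure ℝ)
    (a b : ℕ → ℝ) (ξ : ℕ → Ω → ℝ) (V : Ω → ℝ × ℝ) : Prop where
  measurable_ξ : ∀ k, Measurable (ξ k)
  measurable_V : Measurable V
  indep_ξ : iIndepFun ξ P
  indep : IndepFun (fun ω k => ξ k ω) V P
  law : ∀ k, P.map (ξ k) = τ
  integrable_id : Integrable id τ
  a_nonneg : ∀ k, 0 ≤ a k
  b_nonneg : ∀ k, 0 ≤ b k
  a_le_one : ∀ k, a k ≤ 1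
  b_le_one : ∀ k, b k ≤ 1
  a_summable : Summable a
  b_summable : Summable b
  V_nonneg : ∀ ω, 0 ≤ (V ω).1 ∧ 0 ≤ (V ω).2
  V_pos : P {ω | 0 < (V ω).1 ∧ 0 < (V ω).2} ≠ 0
  tail : ∃ K β : ℝ, 0 < K ∧ HasGammaTail τ K β

/-- The factors that remain when the innovations with index in `S` are removed. -/
noncomputable def restPair {Ω : Type*} (a b : ℕ → ℝ) (ξ : ℕ → Ω → ℝ) (V : Ω → ℝ × ℝ)
    (S : Finset ℕ) (ω : Ω) : ℝ × ℝ :=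
  ((V ω).1 * Real.exp (ser a fun k => if k ∈ S then 0 else ξ k ω),
    (V ω).2 * Real.exp (ser b fun k => if k ∈ S then 0 else ξ k ω))

namespace IsLinearModel

variable {Ω : Type*} [MeasurableSpace Ω] {P : Measure Ω}
  {τ : Measure ℝ} {a b : ℕ → ℝ} {ξ : ℕ → Ω → ℝ} {V : Ω → ℝ × ℝ}

lemma isProbabilityMeasure [IsProbabilityMeasure P] (hM : IsLinearModel P τ a b ξ V) : IsProbabilityMeasure τ := by
  rw [← hM.law 0]
  exact Measure.isProbabilityMeasure_map (hM.measurable_ξ 0).aemeasurable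

lemma measurable_restPair (hM : IsLinearModel P τ a b ξ V) (S : Finset ℕ) :
    Measurable (restPair a b ξ V S) := by
  have h : Measurable fun ω k => if k ∈ S then 0 else ξ k ω :=
    measurable_pi_lambda _ fun k => by
      by_cases hk : k ∈ S
      · simp [hk]
      · simpa [hk] using hM.measurable_ξ k
  have hV := hM.measurable_V
  have ha := (measurable_ser a).comp h
  have hb := (measurable_ser b).comp h
  unfold restPair
  exact (hV.fst.mul (Real.measurable_exp.comp ha)).prodMk
    (hV.snd.mul (Real.measurable_exp.comp hb))

lemma restPair_nonneg (hM : IsLinearModel P τ a b ξ V) (S : Finset ℕ) (ω : Ω) :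
    0 ≤ (restPair a b ξ V S ω).1 ∧ 0 ≤ (restPair a b ξ V S ω).2 :=
  ⟨mul_nonneg (hM.V_nonneg ω).1 (Real.exp_pos _).le,
    mul_nonneg (hM.V_nonneg ω).2 (Real.exp_pos _).le⟩

lemma indepFun_restPair [IsProbabilityMeasure P] (hM : IsLinearModel P τ a b ξ V) (S : Finset ℕ) :
    IndepFun (fun ω k => if k ∈ S then ξ k ω else 0) (restPair a b ξ V S) P := by
  have h1 : Measurable fun x : ℕ → ℝ => fun k => if k ∈ S then x k else 0 :=
    measurable_pi_lambda _ fun k => by by_cases hk : k ∈ S <;> simp [hk]; fun_prop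
  have h2 : Measurable fun x : ℕ → ℝ => fun k => if k ∈ S then 0 else x k :=
    measurable_pi_lambda _ fun k => by by_cases hk : k ∈ S <;> simp [hk]; fun_prop
  have hξ : Measurable fun ω k => ξ k ω := measurable_pi_lambda _ hM.measurable_ξ
  have hind := indepFun_prodMk_right (h1.comp hξ) (h2.comp hξ) hM.measurable_V
    (indepFun_mask hM.measurable_ξ hM.indep_ξ S)
    (hM.indep.comp (φ := fun x : ℕ → ℝ => ((fun k => if k ∈ S then x k else 0 : ℕ → ℝ),
      (fun k => if k ∈ S then 0 else x k : ℕ → ℝ))) (h1.prodMk h2) measurable_id)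
  refine hind.comp (ψ := fun p : (ℕ → ℝ) × (ℝ × ℝ) =>
    (p.2.1 * Real.exp (ser a p.1), p.2.2 * Real.exp (ser b p.1))) measurable_id ?_
  have ha : Measurable fun p : (ℕ → ℝ) × (ℝ × ℝ) => ser a p.1 :=
    (measurable_ser a).comp measurable_fst
  have hb : Measurable fun p : (ℕ → ℝ) × (ℝ × ℝ) => ser b p.1 :=
    (measurable_ser b).comp measurable_fst
  fun_prop

lemma ser_mask (c : ℕ → ℝ) (S : Finset ℕ) (x : ℕ → ℝ) :
    ser c (fun k => if k ∈ S then 0 else x k) = ser (fun k => if k ∈ S then 0 else c k) x := by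
  unfold ser
  refine tsum_congr fun k => ?_
  by_cases hk : k ∈ S <;> simp [hk]

lemma summable_mask {c : ℕ → ℝ} (hc : Summable c) (hc0 : ∀ k, 0 ≤ c k) (S : Finset ℕ) :
    Summable fun k => if k ∈ S then 0 else c k :=
  hc.of_nonneg_of_le (fun k => by split_ifs <;> simp [hc0]) fun k => by split_ifs <;> simp [hc0]

/-- The integrand is `V₁^p V₂^q` times the exponential of a linear process independent of `V`, with
coefficients `p a_k + q b_k` off `S`. These are at most `θ < 1`, the range in which Gamma-type
innovations have exponential moments. Strict dual feasibility enters here. -/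
lemma integrable_restPair [IsProbabilityMeasure P] (hM : IsLinearModel P τ a b ξ V) (S : Finset ℕ) {p q θ : ℝ}
    (hp : 0 < p) (hq : 0 < q) (hθ0 : 0 < θ) (hθ1 : θ < 1)
    (hpq : ∀ k, k ∉ S → p * a k + q * b k ≤ θ)
    (hV : Integrable (fun ω => (V ω).1 ^ p * (V ω).2 ^ q) P) :
    Integrable (fun ω => (restPair a b ξ V S ω).1 ^ p * (restPair a b ξ V S ω).2 ^ q) P := by
  have := hM.isProbabilityMeasure
  obtain ⟨K, β, hK, htail⟩ := hM.tail
  set c : ℕ → ℝ := fun k => if k ∈ S then 0 else p * a k + q * b k with hc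
  have hab0 : ∀ k, 0 ≤ p * a k + q * b k := fun k =>
    add_nonneg (mul_nonneg hp.le (hM.a_nonneg k)) (mul_nonneg hq.le (hM.b_nonneg k))
  have hcs : Summable c :=
    summable_mask ((hM.a_summable.mul_left p).add (hM.b_summable.mul_left q)) hab0 S
  have hint := integrable_exp_ser hcs (fun k => by simp only [hc]; split_ifs <;> simp [hab0])
    hθ0 (fun k => by
      simp only [hc]; split_ifs with h
      · exact hθ0.le
      · exact hpq k h)
    hM.measurable_ξ hM.law hM.indep_ξ hM.integrable_id (htail.integrable_exp hK hθ1 hθ0.le)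
  have hind : IndepFun (fun ω => (V ω).1 ^ p * (V ω).2 ^ q)
      (fun ω => Real.exp (ser c fun k => ξ k ω)) P :=
    (hM.indep.symm).comp (φ := fun v : ℝ × ℝ => v.1 ^ p * v.2 ^ q)
      (ψ := fun x => Real.exp (ser c x)) (by fun_prop)
      (Real.measurable_exp.comp (measurable_ser c))
  refine (hind.integrable_mul hV hint).congr ?_
  filter_upwards [ae_summable_mul (summable_mask hM.a_summable hM.a_nonneg S)
    (fun k => by split_ifs <;> simp [hM.a_nonneg]) hM.measurable_ξ hM.law hM.integrable_id,
    ae_summable_mul (summable_mask hM.b_summable hM.b_nonneg S)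
    (fun k => by split_ifs <;> simp [hM.b_nonneg]) hM.measurable_ξ hM.law hM.integrable_id]
    with ω h1 h2
  obtain ⟨hv1, hv2⟩ := hM.V_nonneg ω
  simp only [Pi.mul_apply, restPair, ser_mask]
  rw [Real.mul_rpow hv1 (Real.exp_pos _).le, Real.mul_rpow hv2 (Real.exp_pos _).le,
    ← Real.exp_mul, ← Real.exp_mul]
  have : ser c (fun k => ξ k ω) = ser (fun k => if k ∈ S then 0 else a k) (fun k => ξ k ω) * p +
      ser (fun k => if k ∈ S then 0 else b k) (fun k => ξ k ω) * q := by
    unfold ser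
    rw [← tsum_mul_right, ← tsum_mul_right, ← (h1.mul_right p).tsum_add (h2.mul_right q)]
    refine tsum_congr fun k => ?_
    simp only [hc]
    split_ifs <;> ring
  rw [this, Real.exp_add]
  ring

lemma exp_ser_eq (hM : IsLinearModel P τ a b ξ V) (S : Finset ℕ) :
    ∀ᵐ ω ∂P, (V ω).1 * Real.exp (ser a fun k => ξ k ω) =
        Real.exp (∑ k ∈ S, a k * ξ k ω) * (restPair a b ξ V S ω).1 ∧
      (V ω).2 * Real.exp (ser b fun k => ξ k ω) =
        Real.exp (∑ k ∈ S, b k * ξ k ω) * (restPair a b ξ V S ω).2 := by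
  filter_upwards [ae_summable_mul hM.a_summable hM.a_nonneg hM.measurable_ξ hM.law
    hM.integrable_id, ae_summable_mul hM.b_summable hM.b_nonneg hM.measurable_ξ hM.law
    hM.integrable_id] with ω h1 h2
  have key : ∀ c : ℕ → ℝ, Summable (fun k => c k * ξ k ω) → ser c (fun k => ξ k ω) =
      ∑ k ∈ S, c k * ξ k ω + ser c fun k => if k ∈ S then 0 else ξ k ω := by
    intro c hc
    have hS : HasSum (fun k => if k ∈ S then c k * ξ k ω else 0) (∑ k ∈ S, c k * ξ k ω) := by
      have h1 : HasSum (fun k => if k ∈ S then c k * ξ k ω else 0)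
          (∑ k ∈ S, if k ∈ S then c k * ξ k ω else 0) :=
        hasSum_sum_of_ne_finset_zero fun n hn => by simp [hn]
      rwa [Finset.sum_congr rfl fun n hn => if_pos hn] at h1
    have h3 := hc.hasSum.sub hS
    have h4 : ser c (fun k => if k ∈ S then 0 else ξ k ω) =
        ser c (fun k => ξ k ω) - ∑ k ∈ S, c k * ξ k ω := by
      unfold ser
      rw [← h3.tsum_eq]
      refine tsum_congr fun k => ?_
      by_cases hk : k ∈ S <;> simp [hk]
    rw [h4]; ring
  simp only [restPair]
  rw [key a h1, key b h2, Real.exp_add, Real.exp_add]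
  constructor <;> ring

lemma integral_restPair_pos (S : Finset ℕ) (hM : IsLinearModel P τ a b ξ V) (f : ℝ × ℝ → ℝ)
    (hf : ∀ z, 0 ≤ z.1 → 0 ≤ z.2 → 0 ≤ f z) (hf' : ∀ z, 0 < z.1 → 0 < z.2 → 0 < f z)
    (hint : Integrable (fun ω => f (restPair a b ξ V S ω)) P) :
    0 < ∫ ω, f (restPair a b ξ V S ω) ∂P := by
  rw [integral_pos_iff_support_of_nonneg
    (fun ω => hf _ (hM.restPair_nonneg S ω).1 (hM.restPair_nonneg S ω).2) hint]
  refine lt_of_lt_of_le (pos_iff_ne_zero.2 hM.V_pos) (measure_mono fun ω hω => ?_)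
  exact (hf' _ (mul_pos hω.1 (Real.exp_pos _)) (mul_pos hω.2 (Real.exp_pos _))).ne'

lemma tendsto_survival_atTop {κ : ℝ} (hκ : 0 < κ) :
    Tendsto (fun x => κ * Real.log x) atTop atTop :=
  Real.tendsto_log_atTop.const_mul_atTop hκ

end IsLinearModel

/-- Converts mixed moments with exponents `p`, `q` into moments of the minimum of order `p + q`. -/
lemma min_rpow_add_le {x y p q : ℝ} (hx : 0 ≤ x) (hy : 0 ≤ y) (hp : 0 < p) (hq : 0 < q) :
    (min x y) ^ (p + q) ≤ x ^ p * y ^ q := by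
  have hm : 0 ≤ min x y := le_min hx hy
  rw [Real.rpow_add_of_nonneg hm hp.le hq.le]
  exact mul_le_mul (Real.rpow_le_rpow hm (min_le_left _ _) hp.le)
    (Real.rpow_le_rpow hm (min_le_right _ _) hq.le) (Real.rpow_nonneg hm _)
    (Real.rpow_nonneg hx _)

namespace IsLinearModel

variable {Ω : Type*} [MeasurableSpace Ω] {P : Measure Ω}
  {τ : Measure ℝ} {a b : ℕ → ℝ} {ξ : ℕ → Ω → ℝ} {V : Ω → ℝ × ℝ}

lemma integrable_minPow (hM : IsLinearModel P τ a b ξ V) (S : Finset ℕ) {p q s t : ℝ}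
    (hp : 0 < p) (hq : 0 < q) (hs : 0 < s) (ht : 0 < t)
    (hint : Integrable
      (fun ω => (restPair a b ξ V S ω).1 ^ p * (restPair a b ξ V S ω).2 ^ q) P) :
    Integrable (minPow (fun ω => (restPair a b ξ V S ω).1) (fun ω => (restPair a b ξ V S ω).2)
      (p + q) s t) P := by
  have hm := hM.measurable_restPair S
  refine (hint.const_mul (s⁻¹ ^ p * t⁻¹ ^ q)).mono' ?_ (ae_of_all _ fun ω => ?_)
  · have : Measurable (minPow (fun ω => (restPair a b ξ V S ω).1)
        (fun ω => (restPair a b ξ V S ω).2) (p + q) s t) :=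
      ((hm.fst.const_mul _).min (hm.snd.const_mul _)).pow_const _
    exact this.aestronglyMeasurable
  · obtain ⟨h1, h2⟩ := hM.restPair_nonneg S ω
    have hs' : 0 < s⁻¹ := inv_pos.2 hs
    have ht' : 0 < t⁻¹ := inv_pos.2 ht
    have h1' := mul_nonneg hs'.le h1
    have h2' := mul_nonneg ht'.le h2
    rw [minPow, Real.norm_of_nonneg (Real.rpow_nonneg (le_min h1' h2') _)]
    refine (min_rpow_add_le h1' h2' hp hq).trans_eq ?_
    rw [Real.mul_rpow hs'.le h1, Real.mul_rpow ht'.le h2]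
    ring

/-! ### One dominating innovation -/

/-- The joint tail when a single innovation dominates. -/
theorem tendsto_of_single [IsProbabilityMeasure P] (hM : IsLinearModel P τ a b ξ V) {i : ℕ} {κ p q : ℝ}
    (hab : a i = b i) (hb : 0 < b i) (hκ : b i * κ = 1) (hp : 0 < p) (hq : 0 < q)
    (hpq : p + q = κ) (hlt : ∀ k, k ≠ i → p * a k + q * b k < 1)
    (hV : ∃ r, p + q < r ∧ ∀ p' q', 0 < p' → 0 < q' → p' ≤ r → q' ≤ r →
      Integrable (fun ω => (V ω).1 ^ p' * (V ω).2 ^ q') P)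
    {Y Y' : Ω → ℝ} (hY : ∀ᵐ ω ∂P, Y ω = (V ω).1 * Real.exp (ser a fun k => ξ k ω))
    (hY' : ∀ᵐ ω ∂P, Y' ω = (V ω).2 * Real.exp (ser b fun k => ξ k ω))
    {s t : ℝ} (hs : 0 < s) (ht : 0 < t) :
    Integrable (minPow (fun ω => (restPair a b ξ V {i} ω).1)
      (fun ω => (restPair a b ξ V {i} ω).2) κ s t) P ∧
    Tendsto (fun x : ℝ => P.real {ω | s * x < Y ω ∧ t * x < Y' ω} /
        τ.real (Set.Ioi (κ * Real.log x))) atTop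
      (𝓝 (∫ ω, minPow (fun ω => (restPair a b ξ V {i} ω).1)
        (fun ω => (restPair a b ξ V {i} ω).2) κ s t ω ∂P)) := by
  have := hM.isProbabilityMeasure
  obtain ⟨K, β, hK, htail⟩ := hM.tail
  have hκ0 : 0 < κ := by rw [← hpq]; positivity
  obtain ⟨δ₀, θ, hδ₀, hθ0, hθ1, hmargin⟩ := exists_uniform_margin hM.a_nonneg hM.b_nonneg
    hM.a_le_one hM.b_le_one hM.a_summable.tendsto_atTop_zero hM.b_summable.tendsto_atTop_zero {i}
    hp hq (fun k hk => hlt k (by simpa using hk))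
  obtain ⟨r, hr, hVr⟩ := hV
  set W := restPair a b ξ V {i} with hW
  have hIntpq : ∀ p' q', |p' - p| ≤ δ₀ → |q' - q| ≤ δ₀ → p' ≤ r → q' ≤ r →
      0 < p' ∧ 0 < q' ∧ Integrable (fun ω => (W ω).1 ^ p' * (W ω).2 ^ q') P := by
    intro p' q' h1 h2 h3 h4
    obtain ⟨e1, e2, e3⟩ := hmargin p' q' h1 h2
    exact ⟨e1, e2, hM.integrable_restPair {i} e1 e2 hθ0 hθ1 e3 (hVr p' q' e1 e2 h3 h4)⟩
  -- An exponent `κ (1 + e)` splits as `p (1 + e) + q (1 + e)`; for small `e` both parts stay within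
  -- the dual margin `δ₀` and below the moment bound `r`.
  have hscale : ∃ δ, 0 < δ ∧ ∀ e : ℝ, |e| ≤ δ → |p * (1 + e) - p| ≤ δ₀ ∧ |q * (1 + e) - q| ≤ δ₀ ∧
      p * (1 + e) ≤ r ∧ q * (1 + e) ≤ r := by
    refine ⟨min (δ₀ / κ) ((r - κ) / κ), lt_min (by positivity) (div_pos (by linarith) hκ0), ?_⟩
    intro e he
    have h1 : |e| * κ ≤ δ₀ := (le_div_iff₀ hκ0).1 (he.trans (min_le_left _ _))
    have h2 : |e| * κ ≤ r - κ := (le_div_iff₀ hκ0).1 (he.trans (min_le_right _ _))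
    have h3 := le_abs_self e
    have h4 := abs_nonneg e
    have h5 : p ≤ κ := by linarith
    have h6 : q ≤ κ := by linarith
    refine ⟨?_, ?_, by nlinarith, by nlinarith⟩
    · rw [show p * (1 + e) - p = p * e by ring, abs_mul, abs_of_pos hp]; nlinarith
    · rw [show q * (1 + e) - q = q * e by ring, abs_mul, abs_of_pos hq]; nlinarith
  obtain ⟨δ, hδ, hδs⟩ := hscale
  have hIntM : ∀ e : ℝ, |e| ≤ δ → Integrable (minPow (fun ω => (W ω).1) (fun ω => (W ω).2)
      (κ * (1 + e)) s t) P := by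
    intro e he
    obtain ⟨h1, h2, h3, h4⟩ := hδs e he
    obtain ⟨e1, e2, e3⟩ := hIntpq _ _ h1 h2 h3 h4
    rw [← hpq, add_mul]
    exact hM.integrable_minPow {i} e1 e2 hs ht e3
  refine ⟨by simpa using hIntM 0 (by simpa using hδ.le), ?_⟩
  obtain ⟨C, z₀, hC, hpot⟩ := htail.potter hK hδ
  have hWm : Measurable W := hM.measurable_restPair {i}
  have hind : IndepFun (ξ i) W P := by
    have hev : Measurable fun x : ℕ → ℝ => x i := measurable_pi_apply i
    have := (hM.indepFun_restPair {i}).comp hev measurable_id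
    simpa [Function.comp_def] using this
  set E : ℝ → Set (ℝ × (ℝ × ℝ)) := fun x =>
    {z | s * x < Real.exp (b i * z.1) * z.2.1 ∧ t * x < Real.exp (b i * z.1) * z.2.2} with hE
  have hEm : ∀ x, MeasurableSet (E x) := by
    intro x
    have h1 : MeasurableSet {z : ℝ × (ℝ × ℝ) | s * x < Real.exp (b i * z.1) * z.2.1} :=
      measurableSet_lt (by fun_prop) (by fun_prop)
    have h2 : MeasurableSet {z : ℝ × (ℝ × ℝ) | t * x < Real.exp (b i * z.1) * z.2.2} :=
      measurableSet_lt (by fun_prop) (by fun_prop)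
    exact h1.inter h2
  have hset : ∀ x, P.real {ω | s * x < Y ω ∧ t * x < Y' ω} = P.real {ω | (ξ i ω, W ω) ∈ E x} := by
    intro x
    refine measureReal_congr ?_
    filter_upwards [hY, hY', hM.exp_ser_eq {i}] with ω h1 h2 h3
    rw [Finset.sum_singleton, Finset.sum_singleton, hab] at h3
    refine propext ?_
    show (s * x < Y ω ∧ t * x < Y' ω) ↔ _
    rw [h1, h2, h3.1, h3.2]
    rfl
  set m : ℝ × ℝ → ℝ := fun w => min (s⁻¹ * w.1) (t⁻¹ * w.2) with hm
  -- As `a i = b i`, both inequalities contain the same factor `exp(b i * u)` and merge into one for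
  -- the minimum `m`. Taking logarithms and multiplying by `κ = 1 / b i` leaves a tail shifted by
  -- `-κ log m`.
  have hslice : ∀ x, 0 < x → ∀ ω, (P.map (ξ i)).real {u | (u, W ω) ∈ E x} =
      if 0 < m (W ω) then τ.real (Set.Ioi (κ * Real.log x + -(κ * Real.log (m (W ω))))) else 0 := by
    intro x hx ω
    rw [hM.law i]
    have hiff : ∀ u, (u, W ω) ∈ E x ↔ x < Real.exp (b i * u) * m (W ω) := by
      intro u
      simp only [hE, hm, Set.mem_ofPred_eq]
      rw [mul_min_of_nonneg _ _ (Real.exp_pos _).le, lt_min_iff]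
      rw [show Real.exp (b i * u) * (s⁻¹ * (W ω).1) = (Real.exp (b i * u) * (W ω).1) / s by
        rw [div_eq_inv_mul]; ring, show Real.exp (b i * u) * (t⁻¹ * (W ω).2) =
        (Real.exp (b i * u) * (W ω).2) / t by rw [div_eq_inv_mul]; ring, lt_div_iff₀ hs,
        lt_div_iff₀ ht, mul_comm s, mul_comm t]
    split_ifs with h0
    · congr 1
      ext u
      rw [Set.mem_ofPred_eq, hiff, Set.mem_Ioi, ← Real.log_lt_log_iff hx (by positivity),
        Real.log_mul (Real.exp_pos _).ne' h0.ne', Real.log_exp]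
      constructor
      · intro h
        have := mul_lt_mul_of_pos_left h hκ0
        linear_combination this + (u : ℝ) * hκ
      · intro h
        have := mul_lt_mul_of_pos_left h hb
        linear_combination this + (Real.log x - Real.log (m (W ω))) * (-hκ)
    · have : {u | (u, W ω) ∈ E x} = ∅ := by
        refine Set.eq_empty_of_forall_notMem fun u hu => ?_
        have h1 := (hiff u).1 hu
        have h2 := mul_nonpos_of_nonneg_of_nonpos (Real.exp_pos (b i * u)).le (not_lt.1 h0)
        linarith
      rw [this, measureReal_empty]
  have hm0 : ∀ ω, 0 ≤ m (W ω) := fun ω =>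
    le_min (mul_nonneg (inv_nonneg.2 hs.le) (hM.restPair_nonneg {i} ω).1)
      (mul_nonneg (inv_nonneg.2 ht.le) (hM.restPair_nonneg {i} ω).2)
  simp_rw [hset]
  -- The Potter bound at the shift `-κ log m` is `C m^(κ(1+δ))` or `C m^(κ(1-δ))`, according to the
  -- sign of `log m`; the sum dominates both.
  refine tendsto_real_div_of_indepFun (hM.measurable_ξ i) hWm hind E hEm _
    (fun w => C * (m w ^ (κ * (1 + δ)) + m w ^ (κ * (1 + -δ)))) (fun w => m w ^ κ) ?_ ?_ ?_
  · exact ((hIntM δ (abs_of_pos hδ).le).add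
      (hIntM (-δ) (by rw [abs_neg, abs_of_pos hδ]))).const_mul C
  · filter_upwards [eventually_gt_atTop 0,
      (tendsto_survival_atTop hκ0).eventually_ge_atTop z₀] with x hx hxz ω
    obtain ⟨hF, hpotx⟩ := hpot _ hxz
    rw [hslice x hx]
    split_ifs with h0
    · rw [abs_of_nonneg (by positivity), div_le_iff₀ hF]
      refine (hpotx _).trans ?_
      rw [mul_right_comm]
      refine mul_le_mul_of_nonneg_right (mul_le_mul_of_nonneg_left ?_ hC.le) hF.le
      rw [Real.rpow_def_of_pos h0, Real.rpow_def_of_pos h0, neg_neg, abs_neg]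
      rcases le_total 0 (κ * Real.log (m (W ω))) with h | h
      · rw [abs_of_nonneg h, show κ * Real.log (m (W ω)) + δ * (κ * Real.log (m (W ω))) =
          Real.log (m (W ω)) * (κ * (1 + δ)) by ring]
        linarith [Real.exp_pos (Real.log (m (W ω)) * (κ * (1 + -δ)))]
      · rw [abs_of_nonpos h, show κ * Real.log (m (W ω)) + δ * -(κ * Real.log (m (W ω))) =
          Real.log (m (W ω)) * (κ * (1 + -δ)) by ring]
        linarith [Real.exp_pos (Real.log (m (W ω)) * (κ * (1 + δ)))]
    · have := hm0 ω
      rw [zero_div, abs_zero]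
      positivity
  · intro ω
    by_cases h0 : 0 < m (W ω)
    · have h1 := (htail.tendsto_ratio hK (-(κ * Real.log (m (W ω))))).comp
        (tendsto_survival_atTop hκ0)
      rw [neg_neg, mul_comm κ, ← Real.rpow_def_of_pos h0] at h1
      refine h1.congr' ?_
      filter_upwards [eventually_gt_atTop 0] with x hx
      rw [hslice x hx, if_pos h0, mul_comm (Real.log (m (W ω)))]
      rfl
    · have h1 : m (W ω) = 0 := le_antisymm (not_lt.1 h0) (hm0 ω)
      rw [h1, Real.zero_rpow hκ0.ne']
      refine tendsto_const_nhds.congr' ?_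
      filter_upwards [eventually_gt_atTop 0] with x hx
      rw [hslice x hx, if_neg h0, zero_div]

end IsLinearModel

/-! ### Two centred innovations and their exponential limit -/

/-- The measure with density `exp(-u)` on the real line. -/
noncomputable def expMeasure : Measure ℝ := volume.withDensity fun u => ENNReal.ofReal (Real.exp (-u))

instance : SFinite expMeasure := by unfold expMeasure; infer_instance

instance : NullSingletonClass expMeasure :=
  ⟨fun _ => withDensity_absolutelyContinuous _ _ (measure_singleton _)⟩

lemma expMeasure_Ioi (s : ℝ) : expMeasure (Set.Ioi s) = ENNReal.ofReal (Real.exp (-s)) := by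
  rw [expMeasure, withDensity_apply _ measurableSet_Ioi, ← integral_exp_neg_Ioi,
    ofReal_integral_eq_lintegral_ofReal (integrableOn_exp_neg_Ioi s)
      (ae_of_all _ fun u => (Real.exp_pos _).le)]

lemma map_add_expMeasure (p : ℝ) :
    expMeasure.map (fun u => u + p) = ENNReal.ofReal (Real.exp p) • expMeasure := by
  have hd : Measurable fun u : ℝ => ENNReal.ofReal (Real.exp (-u)) := by fun_prop
  ext B hB
  rw [Measure.map_apply (by fun_prop) hB, Measure.smul_apply, smul_eq_mul, expMeasure,
    withDensity_apply _ ((measurable_add_const p) hB), withDensity_apply _ hB,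
    ← lintegral_indicator ((measurable_add_const p) hB), ← lintegral_indicator hB,
    ← lintegral_const_mul _ (hd.indicator hB),
    ← lintegral_add_right_eq_self (μ := volume) (fun u => ENNReal.ofReal (Real.exp p) *
      B.indicator (fun u => ENNReal.ofReal (Real.exp (-u))) u) p]
  refine lintegral_congr fun u => ?_
  by_cases hu : u + p ∈ B
  · rw [Set.indicator_of_mem (by exact hu), Set.indicator_of_mem hu,
      ← ENNReal.ofReal_mul (Real.exp_pos _).le, ← Real.exp_add]
    congr 2; ring
  · rw [Set.indicator_of_notMem (by exact hu), Set.indicator_of_notMem hu, mul_zero]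

/-- For `b ≠ 0` every vertical section is a single point; for `b = 0` all sections but one are
empty. This makes boundaries of wedges null. -/
lemma expMeasure_prod_line {a b : ℝ} (c : ℝ) (hab : a ≠ 0 ∨ b ≠ 0) :
    (expMeasure.prod expMeasure) {z : ℝ × ℝ | c = a * z.1 + b * z.2} = 0 := by
  rw [Measure.measure_prod_null (measurableSet_eq_fun (by fun_prop) (by fun_prop))]
  by_cases hb : b = 0
  · have ha : a ≠ 0 := hab.resolve_right (not_not.2 hb)
    filter_upwards [compl_mem_ae_iff.2 (measure_singleton (μ := expMeasure) (c / a))] with u hu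
    have : Prod.mk u ⁻¹' {z : ℝ × ℝ | c = a * z.1 + b * z.2} = ∅ := by
      refine Set.eq_empty_of_forall_notMem fun v hv => hu ?_
      have hv : c = a * u + b * v := hv
      rw [hb, zero_mul, add_zero] at hv
      rw [Set.mem_singleton_iff, hv]
      field_simp
    rw [this, measure_empty]; rfl
  · refine ae_of_all _ fun u => ?_
    have : Prod.mk u ⁻¹' {z : ℝ × ℝ | c = a * z.1 + b * z.2} ⊆ {(c - a * u) / b} := by
      intro v hv
      have hv : c = a * u + b * v := hv
      rw [Set.mem_singleton_iff, hv]
      field_simp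
      ring
    exact measure_mono_null this (measure_singleton _)

lemma frontier_halfPlane_subset (a b c : ℝ) :
    frontier {z : ℝ × ℝ | c < a * z.1 + b * z.2} ⊆ {z : ℝ × ℝ | c = a * z.1 + b * z.2} :=
  frontier_lt_subset_eq continuous_const (by fun_prop)

/-- The intersection of two half planes. -/
def wedge (a a' b b' r r' : ℝ) : Set (ℝ × ℝ) :=
  {z | -r < a * z.1 + a' * z.2} ∩ {z | -r' < b * z.1 + b' * z.2}

lemma measurableSet_wedge (a a' b b' r r' : ℝ) : MeasurableSet (wedge a a' b b' r r') :=
  (measurableSet_lt (by fun_prop) (by fun_prop)).inter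
    (measurableSet_lt (by fun_prop) (by fun_prop))

lemma frontier_wedge {a a' b b' : ℝ} (ha : a ≠ 0 ∨ a' ≠ 0) (hb : b ≠ 0 ∨ b' ≠ 0) (r r' : ℝ) :
    (expMeasure.prod expMeasure) (frontier (wedge a a' b b' r r')) = 0 := by
  refine measure_mono_null ((frontier_inter_subset _ _).trans
    (Set.union_subset_union Set.inter_subset_left Set.inter_subset_right)) ?_
  exact measure_union_null (measure_mono_null (frontier_halfPlane_subset _ _ _)
    (expMeasure_prod_line _ ha)) (measure_mono_null (frontier_halfPlane_subset _ _ _)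
    (expMeasure_prod_line _ hb))

lemma quadrant_eq_wedge (k : ℝ) : Set.Ioi (-k) ×ˢ Set.Ioi (-k) = wedge 1 0 0 1 k k := by
  ext z; simp [wedge]

lemma expMeasure_prod_quadrant (s t : ℝ) :
    (expMeasure.prod expMeasure) (Set.Ioi s ×ˢ Set.Ioi t) = ENNReal.ofReal (Real.exp (-s - t)) := by
  rw [Measure.prod_prod, expMeasure_Ioi, expMeasure_Ioi, ← ENNReal.ofReal_mul (Real.exp_pos _).le,
    ← Real.exp_add]
  rfl

/-- The joint law of two independent innovations, centred at `κ₁ z` and `κ₂ z`. -/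
noncomputable def shiftLaw (τ : Measure ℝ) (κ₁ κ₂ z : ℝ) : Measure (ℝ × ℝ) :=
  (τ.map fun y => y - κ₁ * z).prod (τ.map fun y => y - κ₂ * z)

section

variable {τ : Measure ℝ} [IsProbabilityMeasure τ] {K β κ₁ κ₂ : ℝ}

instance (κ z : ℝ) : IsProbabilityMeasure (τ.map fun y => y - κ * z) :=
  Measure.isProbabilityMeasure_map (by fun_prop)

instance (z : ℝ) : IsProbabilityMeasure (shiftLaw τ κ₁ κ₂ z) := by
  unfold shiftLaw; infer_instance

/-- Markov's inequality with a product weight, whose factors have expectations of the order of the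
tails by `HasGammaTail.lintegral_exp_le`. The constant `C₁` depends neither on `Q` nor on `C`, which
is what domination requires. -/
lemma shiftLaw_bound (hτ : HasGammaTail τ K β) (hK : 0 < K) (h₁ : 0 < κ₁) (h₂ : 0 < κ₂) {δ : ℝ}
    (hδ : 0 < δ) (hδ1 : δ ≤ 1) :
    ∃ C₁ : ℝ, 0 < C₁ ∧ ∀ᶠ z in atTop,
      0 < τ.real (Set.Ioi (κ₁ * z)) * τ.real (Set.Ioi (κ₂ * z)) ∧
      ∀ (C : ℝ) (Q : Set (ℝ × ℝ)), 0 ≤ C → MeasurableSet Q →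
        (∀ w ∈ Q, 1 ≤ C * (Real.exp (w.1 - δ * |w.1|) * Real.exp (w.2 - δ * |w.2|))) →
        (shiftLaw τ κ₁ κ₂ z).real Q / (τ.real (Set.Ioi (κ₁ * z)) * τ.real (Set.Ioi (κ₂ * z))) ≤
          C₁ * C := by
  obtain ⟨C₀, z₀, hC₀, h⟩ := hτ.lintegral_exp_le hK hδ hδ1
  obtain ⟨_, z₁, -, hF⟩ := hτ.potter hK hδ
  have ht₁ : Tendsto (fun z : ℝ => κ₁ * z) atTop atTop := tendsto_id.const_mul_atTop h₁
  have ht₂ : Tendsto (fun z : ℝ => κ₂ * z) atTop atTop := tendsto_id.const_mul_atTop h₂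
  refine ⟨C₀ * C₀, by positivity, ?_⟩
  filter_upwards [ht₁.eventually_ge_atTop z₀, ht₁.eventually_ge_atTop z₁,
    ht₂.eventually_ge_atTop z₀, ht₂.eventually_ge_atTop z₁] with z e1 e2 e3 e4
  have hF₁ := (hF _ e2).1
  have hF₂ := (hF _ e4).1
  refine ⟨by positivity, fun C Q hC hQ hle => ?_⟩
  rw [div_le_iff₀ (by positivity)]
  have hφ : Measurable fun u : ℝ => ENNReal.ofReal (Real.exp (u - δ * |u|)) := by fun_prop
  have hmain : shiftLaw τ κ₁ κ₂ z Q ≤ ENNReal.ofReal (C₀ * C₀ * C *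
      (τ.real (Set.Ioi (κ₁ * z)) * τ.real (Set.Ioi (κ₂ * z)))) := by
    calc shiftLaw τ κ₁ κ₂ z Q = ∫⁻ w, Q.indicator 1 w ∂(shiftLaw τ κ₁ κ₂ z) :=
          (lintegral_indicator_one hQ).symm
      _ ≤ ∫⁻ w, ENNReal.ofReal C * (ENNReal.ofReal (Real.exp (w.1 - δ * |w.1|)) *
            ENNReal.ofReal (Real.exp (w.2 - δ * |w.2|))) ∂(shiftLaw τ κ₁ κ₂ z) := by
          refine lintegral_mono fun w => ?_
          by_cases hw : w ∈ Q
          · rw [Set.indicator_of_mem hw, Pi.one_apply, ← ENNReal.ofReal_mul (Real.exp_pos _).le,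
              ← ENNReal.ofReal_mul hC, ← ENNReal.ofReal_one]
            exact ENNReal.ofReal_le_ofReal (hle w hw)
          · rw [Set.indicator_of_notMem hw]; exact zero_le
      _ = ENNReal.ofReal C * ((∫⁻ y, ENNReal.ofReal (Real.exp (y - κ₁ * z - δ * |y - κ₁ * z|)) ∂τ) *
            ∫⁻ y, ENNReal.ofReal (Real.exp (y - κ₂ * z - δ * |y - κ₂ * z|)) ∂τ) := by
          rw [lintegral_const_mul _ (by fun_prop), shiftLaw,
            lintegral_prod_mul hφ.aemeasurable hφ.aemeasurable,
            lintegral_map hφ (by fun_prop), lintegral_map hφ (by fun_prop)]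
      _ ≤ ENNReal.ofReal C * (ENNReal.ofReal (C₀ * τ.real (Set.Ioi (κ₁ * z))) *
            ENNReal.ofReal (C₀ * τ.real (Set.Ioi (κ₂ * z)))) := by
          gcongr
          · exact h _ e1
          · exact h _ e3
      _ = _ := by
          rw [← ENNReal.ofReal_mul (by positivity), ← ENNReal.ofReal_mul hC]
          congr 1; ring
  exact ENNReal.toReal_le_of_le_ofReal (by positivity) hmain

lemma shiftLaw_quadrant (z s t : ℝ) :
    (shiftLaw τ κ₁ κ₂ z).real (Set.Ioi s ×ˢ Set.Ioi t) =
      τ.real (Set.Ioi (κ₁ * z + s)) * τ.real (Set.Ioi (κ₂ * z + t)) := by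
  have key : ∀ κ s : ℝ, (τ.map fun y => y - κ * z) (Set.Ioi s) = τ (Set.Ioi (κ * z + s)) := by
    intro κ s
    rw [Measure.map_apply (by fun_prop) measurableSet_Ioi]
    congr 1
    ext y
    simp only [Set.mem_preimage, Set.mem_Ioi]
    constructor <;> intro h <;> linarith
  rw [Measure.real, shiftLaw, Measure.prod_prod, key, key, ENNReal.toReal_mul]
  rfl

/-- The rescaled joint law of two innovations converges on sets that are controlled by an
exponential weight. -/
theorem tendsto_shiftLaw (hτ : HasGammaTail τ K β) (hK : 0 < K) (h₁ : 0 < κ₁) (h₂ : 0 < κ₂)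
    {δ : ℝ} (hδ : 0 < δ) (hδ1 : δ ≤ 1) {C : ℝ} (hC : 0 ≤ C) {Q : Set (ℝ × ℝ)}
    (hQ : MeasurableSet Q) (hfr : (expMeasure.prod expMeasure) (frontier Q) = 0)
    (hle : ∀ w ∈ Q, 1 ≤ C * (Real.exp (w.1 - δ * |w.1|) * Real.exp (w.2 - δ * |w.2|))) :
    (expMeasure.prod expMeasure) Q ≠ ⊤ ∧
    Tendsto (fun z => (shiftLaw τ κ₁ κ₂ z).real Q /
        (τ.real (Set.Ioi (κ₁ * z)) * τ.real (Set.Ioi (κ₂ * z)))) atTop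
      (𝓝 ((expMeasure.prod expMeasure).real Q)) := by
  set m := expMeasure.prod expMeasure with hm
  set N : ℝ → ℝ := fun z => τ.real (Set.Ioi (κ₁ * z)) * τ.real (Set.Ioi (κ₂ * z)) with hN
  have ht₁ : Tendsto (fun z : ℝ => κ₁ * z) atTop atTop := tendsto_id.const_mul_atTop h₁
  have ht₂ : Tendsto (fun z : ℝ => κ₂ * z) atTop atTop := tendsto_id.const_mul_atTop h₂
  -- Quadrant convergence handles `Q ∩ R n`; the part of `Q` outside `R n` is negligible uniformly
  -- in large `z`.
  let R : ℕ → Set (ℝ × ℝ) := fun n => Set.Ioi (-(n : ℝ)) ×ˢ Set.Ioi (-(n : ℝ))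
  have hRm : ∀ n, MeasurableSet (R n) := fun n => measurableSet_Ioi.prod measurableSet_Ioi
  have hlim : ∀ n, Tendsto (fun z => (shiftLaw τ κ₁ κ₂ z).real (Q ∩ R n) / N z) atTop
      (𝓝 (m.real (Q ∩ R n))) := by
    intro n
    refine tendsto_real_of_tendsto_quadrant (fun z => shiftLaw τ κ₁ κ₂ z) N m (-n) ?_ ?_
      Set.inter_subset_right ?_
    · rw [hm, expMeasure_prod_quadrant]; exact ENNReal.ofReal_ne_top
    · intro s t _ _
      have := ((hτ.tendsto_ratio hK s).comp ht₁).mul ((hτ.tendsto_ratio hK t).comp ht₂)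
      rw [← Real.exp_add] at this
      rw [Measure.real, hm, expMeasure_prod_quadrant, ENNReal.toReal_ofReal (Real.exp_pos _).le]
      refine this.congr fun z => ?_
      rw [shiftLaw_quadrant, hN]
      simp only [Function.comp]
      rw [div_mul_div_comm]
    · refine measure_mono_null ((frontier_inter_subset _ _).trans
        (Set.union_subset_union Set.inter_subset_left Set.inter_subset_right)) ?_
      refine measure_union_null hfr ?_
      simp only [R]
      rw [quadrant_eq_wedge]
      exact frontier_wedge (Or.inl one_ne_zero) (Or.inr one_ne_zero) _ _
  -- Half of `δ` is kept for the weight; the other half yields the decay `exp(-δ n / 2)` once a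
  -- coordinate is at most `-n`.
  obtain ⟨C₁, hC₁, hb⟩ := shiftLaw_bound hτ hK h₁ h₂ (half_pos hδ) (by linarith)
  have hweight : ∀ u : ℝ, Real.exp (u - δ * |u|) ≤ Real.exp (u - δ / 2 * |u|) := fun u =>
    Real.exp_le_exp.2 (by nlinarith [abs_nonneg u])
  have hweight' : ∀ (n : ℕ) (u : ℝ), u ≤ -n →
      Real.exp (u - δ * |u|) ≤ Real.exp (-(δ / 2 * n)) * Real.exp (u - δ / 2 * |u|) := by
    intro n u hu
    rw [← Real.exp_add]
    refine Real.exp_le_exp.2 ?_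
    have : (n : ℝ) ≤ |u| := by linarith [neg_le_abs u]
    nlinarith
  have hbound : ∀ n, ∀ᶠ z in atTop, (shiftLaw τ κ₁ κ₂ z).real (Q \ R n) / N z ≤
      C₁ * (C * Real.exp (-(δ / 2 * n))) := by
    intro n
    filter_upwards [hb] with z hz
    refine hz.2 _ _ (by positivity) (hQ.diff (hRm n)) fun w hw => (hle w hw.1).trans ?_
    rw [mul_assoc]
    refine mul_le_mul_of_nonneg_left ?_ hC
    have hw2 : w.1 ≤ -n ∨ w.2 ≤ -n := by
      by_contra! h
      exact hw.2 h
    rcases hw2 with h | h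
    · calc _ ≤ Real.exp (-(δ / 2 * n)) * Real.exp (w.1 - δ / 2 * |w.1|) *
            Real.exp (w.2 - δ / 2 * |w.2|) :=
          mul_le_mul (hweight' n _ h) (hweight _) (Real.exp_pos _).le (by positivity)
        _ = _ := by ring
    · calc _ ≤ Real.exp (w.1 - δ / 2 * |w.1|) * (Real.exp (-(δ / 2 * n)) *
            Real.exp (w.2 - δ / 2 * |w.2|)) :=
          mul_le_mul (hweight _) (hweight' n _ h) (Real.exp_pos _).le (by positivity)
        _ = _ := by ring
  have hmfin : ∀ n, m (Q ∩ R n) ≠ ⊤ := fun n => ne_top_of_le_ne_top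
    (by rw [hm, expMeasure_prod_quadrant]; exact ENNReal.ofReal_ne_top)
    (measure_mono (Set.inter_subset_right (s := Q) (t := R n)))
  have hmle : ∀ n, m (Q ∩ R n) ≤ ENNReal.ofReal (C₁ * C) := by
    intro n
    rw [← ofReal_measureReal (hmfin n)]
    refine ENNReal.ofReal_le_ofReal (le_of_tendsto (hlim n) ?_)
    filter_upwards [hb] with z hz
    refine hz.2 C _ hC (hQ.inter (hRm n)) fun w hw => (hle w hw.1).trans ?_
    refine mul_le_mul_of_nonneg_left ?_ hC
    exact mul_le_mul (hweight _) (hweight _) (Real.exp_pos _).le (Real.exp_pos _).le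
  have hmono : Monotone fun n => Q ∩ R n := fun n k hnk => by
    have : -(k : ℝ) ≤ -(n : ℝ) := neg_le_neg (by exact_mod_cast hnk)
    exact Set.inter_subset_inter_right _
      (Set.prod_mono (Set.Ioi_subset_Ioi this) (Set.Ioi_subset_Ioi this))
  have hU : ⋃ n, Q ∩ R n = Q := by
    rw [← Set.inter_iUnion, Set.inter_eq_left]
    intro w _
    obtain ⟨n, hn⟩ := exists_nat_gt (max (-w.1) (-w.2))
    rw [max_lt_iff] at hn
    exact Set.mem_iUnion.2 ⟨n, show -(n : ℝ) < w.1 by linarith [hn.1],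
      show -(n : ℝ) < w.2 by linarith [hn.2]⟩
  have hfin : m Q ≠ ⊤ := by
    rw [← hU, hmono.measure_iUnion]
    exact ne_top_of_le_ne_top ENNReal.ofReal_ne_top (iSup_le hmle)
  refine ⟨hfin, ?_⟩
  have hmlim : Tendsto (fun n => m.real (Q ∩ R n)) atTop (𝓝 (m.real Q)) := by
    have := tendsto_measure_iUnion_atTop (μ := m) hmono
    rw [hU] at this
    exact (ENNReal.tendsto_toReal hfin).comp this
  have herr : Tendsto (fun n : ℕ => C₁ * (C * Real.exp (-(δ / 2 * n)))) atTop (𝓝 0) := by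
    have h1 : Tendsto (fun n : ℕ => δ / 2 * (n : ℝ)) atTop atTop :=
      tendsto_natCast_atTop_atTop.const_mul_atTop (half_pos hδ)
    have := ((Real.tendsto_exp_neg_atTop_nhds_zero.comp h1).const_mul C).const_mul C₁
    simpa using this
  rw [Metric.tendsto_nhds]
  intro ε hε
  obtain ⟨n, hn1, hn2⟩ := (((Metric.tendsto_nhds.1 hmlim) (ε / 3) (by positivity)).and
    (herr.eventually_lt_const (show 0 < ε / 3 by positivity))).exists
  filter_upwards [(Metric.tendsto_nhds.1 (hlim n)) (ε / 3) (by positivity), hbound n, hb]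
    with z hz1 hz2 hz3
  have hsplit : (shiftLaw τ κ₁ κ₂ z).real Q / N z = (shiftLaw τ κ₁ κ₂ z).real (Q ∩ R n) / N z +
      (shiftLaw τ κ₁ κ₂ z).real (Q \ R n) / N z := by
    rw [← add_div, measureReal_inter_add_sdiff (hRm n)]
  have hpos : 0 ≤ (shiftLaw τ κ₁ κ₂ z).real (Q \ R n) / N z :=
    div_nonneg measureReal_nonneg hz3.1.le
  rw [Real.dist_eq, abs_lt] at hn1 hz1 ⊢
  rw [hsplit]
  constructor <;> linarith [hn1.1, hn1.2, hz1.1, hz1.2]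

end

/-! ### Wedges and two dominating innovations -/

/-- The scaling of the limit measure of a wedge. -/
lemma expMeasure_wedge {a a' b b' D : ℝ} (hD : D = b' * a - b * a') (hD0 : D ≠ 0) (r r' : ℝ) :
    (expMeasure.prod expMeasure).real (wedge a a' b b' r r') =
      Real.exp ((b' - b) / D * r + (a - a') / D * r') *
        (expMeasure.prod expMeasure).real (wedge a a' b b' 0 0) := by
  -- The translation by `(p, q)` that carries the wedge with offsets `r`, `r'` to the one with apex
  -- at the origin. It multiplies the measure by `exp(p + q)`, and `p + q` is the dual solution
  -- paired with `(r, r')`.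
  set p := (b' * r - a' * r') / D with hp
  set q := (a * r' - b * r) / D with hq
  have h1 : a * p + a' * q = r := by rw [hp, hq]; field_simp; rw [hD]; ring
  have h2 : b * p + b' * q = r' := by rw [hp, hq]; field_simp; rw [hD]; ring
  have hmap : (expMeasure.prod expMeasure).map (Prod.map (fun u => u + p) (fun u => u + q)) =
      ENNReal.ofReal (Real.exp (p + q)) • expMeasure.prod expMeasure := by
    rw [← Measure.map_prod_map _ _ (by fun_prop) (by fun_prop), map_add_expMeasure,
      map_add_expMeasure, Measure.prod_smul_left, Measure.prod_smul_right, smul_smul,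
      ← ENNReal.ofReal_mul (Real.exp_pos _).le, ← Real.exp_add]
  have hpre : Prod.map (fun u => u + p) (fun u => u + q) ⁻¹' wedge a a' b b' 0 0 =
      wedge a a' b b' r r' := by
    ext z
    simp only [wedge, Set.mem_preimage, Set.mem_inter_iff, Set.mem_ofPred_eq, Prod.map_fst,
      Prod.map_snd, neg_zero]
    refine and_congr ?_ ?_ <;> constructor <;> intro h <;> nlinarith
  have hE : (b' - b) / D * r + (a - a') / D * r' = p + q := by rw [hp, hq]; field_simp; ring
  rw [hE, ← hpre, ← map_measureReal_apply (by fun_prop) (measurableSet_wedge _ _ _ _ _ _), hmap,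
    measureReal_ennreal_smul_apply, ENNReal.toReal_ofReal (Real.exp_pos _).le]

lemma expMeasure_wedge_ne_zero {a a' b b' : ℝ} (ha0 : 0 ≤ a) (ha0' : 0 ≤ a') (hb0 : 0 ≤ b)
    (hb0' : 0 ≤ b') (ha : a ≠ 0 ∨ a' ≠ 0) (hb : b ≠ 0 ∨ b' ≠ 0) :
    (expMeasure.prod expMeasure) (wedge a a' b b' 0 0) ≠ 0 := by
  have hpos : ∀ {x x' u v : ℝ}, 0 ≤ x → 0 ≤ x' → (x ≠ 0 ∨ x' ≠ 0) → 0 < u → 0 < v →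
      -0 < x * u + x' * v := by
    intro x x' u v hx hx' h hu hv
    rw [neg_zero]
    rcases h with h | h
    · have := mul_pos (lt_of_le_of_ne hx (Ne.symm h)) hu
      have := mul_nonneg hx' hv.le
      linarith
    · have := mul_pos (lt_of_le_of_ne hx' (Ne.symm h)) hv
      have := mul_nonneg hx hu.le
      linarith
  have hsub : Set.Ioi (0 : ℝ) ×ˢ Set.Ioi (0 : ℝ) ⊆ wedge a a' b b' 0 0 := fun z hz =>
    ⟨hpos ha0 ha0' ha hz.1 hz.2, hpos hb0 hb0' hb hz.1 hz.2⟩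
  intro h
  have := measure_mono_null hsub h
  rw [expMeasure_prod_quadrant] at this
  simp at this

/-- The sign pattern used for perturbing exponents. -/
def signed (δ : ℝ) (e : Bool) : ℝ := if e then δ else -δ

lemma abs_signed {δ : ℝ} (hδ : 0 < δ) (e : Bool) : |signed δ e| = δ := by
  cases e <;> simp [signed, abs_of_pos hδ]

/-- Linearises `u - δ|u|` by a choice of sign, so that linear programming duality applies to the
weight as well. -/
lemma exists_signed_mul (δ u : ℝ) : ∃ e : Bool, (1 + signed δ e) * u = u - δ * |u| := by
  rcases le_total 0 u with h | h
  · exact ⟨false, by simp only [signed, Bool.false_eq_true, if_false, abs_of_nonneg h]; ring⟩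
  · exact ⟨true, by simp only [signed, if_true, abs_of_nonpos h]; ring⟩

/-- The perturbed first exponent. -/
noncomputable def expo₁ (b b' D δ : ℝ) (e : Bool × Bool) : ℝ :=
  ((1 + signed δ e.1) * b' - (1 + signed δ e.2) * b) / D

/-- The perturbed second exponent. -/
noncomputable def expo₂ (a a' D δ : ℝ) (e : Bool × Bool) : ℝ :=
  ((1 + signed δ e.2) * a - (1 + signed δ e.1) * a') / D

/-- Serves for both perturbed exponents: they tend to the dual solution as `δ → 0`. -/
lemma abs_signed_comb_le {x y D δ : ℝ} (hx : 0 ≤ x) (hx1 : x ≤ 1) (hy : 0 ≤ y) (hy1 : y ≤ 1)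
    (hδ : 0 < δ) (e e' : Bool) :
    |((1 + signed δ e) * x - (1 + signed δ e') * y) / D - (x - y) / D| ≤ 2 * δ / |D| := by
  rw [← sub_div, abs_div]
  refine div_le_div_of_nonneg_right ?_ (abs_nonneg D)
  rw [show (1 + signed δ e) * x - (1 + signed δ e') * y - (x - y) =
    signed δ e * x - signed δ e' * y by ring]
  refine (abs_sub _ _).trans ?_
  rw [abs_mul, abs_mul, abs_signed hδ, abs_signed hδ, abs_of_nonneg hx, abs_of_nonneg hy]
  nlinarith

/-- The indicator of a wedge is bounded by an exponential weight. -/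
lemma one_le_of_mem_wedge {a a' b b' D δ r r' : ℝ} (hD : D = b' * a - b * a') (hD0 : D ≠ 0)
    (hpos : ∀ e, 0 < expo₁ b b' D δ e ∧ 0 < expo₂ a a' D δ e) {w : ℝ × ℝ}
    (hw : w ∈ wedge a a' b b' r r') :
    1 ≤ (∑ e : Bool × Bool, Real.exp (expo₁ b b' D δ e * r + expo₂ a a' D δ e * r')) *
      (Real.exp (w.1 - δ * |w.1|) * Real.exp (w.2 - δ * |w.2|)) := by
  obtain ⟨e₁, he₁⟩ := exists_signed_mul δ w.1
  obtain ⟨e₂, he₂⟩ := exists_signed_mul δ w.2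
  obtain ⟨hp, hq⟩ := hpos (e₁, e₂)
  set p := expo₁ b b' D δ (e₁, e₂) with hpdef
  set q := expo₂ a a' D δ (e₁, e₂) with hqdef
  -- The perturbed exponents solve the dual equations with right-hand sides `1 ± δ`. The positive
  -- combination of the two inequalities defining the wedge is therefore the exponent of the weight
  -- plus a constant.
  have h1 : p * a + q * b = 1 + signed δ e₁ := by
    rw [hpdef, hqdef, expo₁, expo₂]; field_simp; rw [hD]; ring
  have h2 : p * a' + q * b' = 1 + signed δ e₂ := by
    rw [hpdef, hqdef, expo₁, expo₂]; field_simp; rw [hD]; ring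
  have hw1 : 0 < a * w.1 + a' * w.2 + r := by have : -r < a * w.1 + a' * w.2 := hw.1; linarith
  have hw2 : 0 < b * w.1 + b' * w.2 + r' := by have : -r' < b * w.1 + b' * w.2 := hw.2; linarith
  calc (1 : ℝ) ≤ Real.exp (p * (a * w.1 + a' * w.2 + r) + q * (b * w.1 + b' * w.2 + r')) :=
        Real.one_le_exp (by positivity)
    _ = Real.exp (p * r + q * r') * (Real.exp (w.1 - δ * |w.1|) * Real.exp (w.2 - δ * |w.2|)) := by
        rw [← Real.exp_add, ← Real.exp_add, ← he₁, ← he₂, ← h1, ← h2]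
        congr 1; ring
    _ ≤ _ := by
        refine mul_le_mul_of_nonneg_right ?_ (by positivity)
        exact Finset.single_le_sum
          (f := fun e => Real.exp (expo₁ b b' D δ e * r + expo₂ a a' D δ e * r'))
          (fun e _ => (Real.exp_pos _).le) (Finset.mem_univ (e₁, e₂))

namespace IsLinearModel

variable {Ω : Type*} [MeasurableSpace Ω] {P : Measure Ω} [IsProbabilityMeasure P]
  {τ : Measure ℝ} {a b : ℕ → ℝ} {ξ : ℕ → Ω → ℝ} {V : Ω → ℝ × ℝ}

/-- The joint tail when two innovations dominate. -/
theorem tendsto_of_two (hM : IsLinearModel P τ a b ξ V) {i j : ℕ} (hij : i ≠ j)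
    {κ₁ κ₂ D : ℝ} (hκ₁ : 0 < κ₁) (hκ₂ : 0 < κ₂) (hD : D = b j * a i - b i * a j) (hD0 : D ≠ 0)
    (hp : 0 < (b j - b i) / D) (hq : 0 < (a i - a j) / D)
    (hlt : ∀ k, k ≠ i → k ≠ j → (b j - b i) / D * a k + (a i - a j) / D * b k < 1)
    (hA : a i * κ₁ + a j * κ₂ = 1) (hB : b i * κ₁ + b j * κ₂ = 1)
    (hV : ∃ r, (b j - b i) / D + (a i - a j) / D < r ∧ ∀ p' q', 0 < p' → 0 < q' → p' ≤ r →
      q' ≤ r → Integrable (fun ω => (V ω).1 ^ p' * (V ω).2 ^ q') P)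
    {Y Y' : Ω → ℝ} (hY : ∀ᵐ ω ∂P, Y ω = (V ω).1 * Real.exp (ser a fun k => ξ k ω))
    (hY' : ∀ᵐ ω ∂P, Y' ω = (V ω).2 * Real.exp (ser b fun k => ξ k ω)) :
    ∃ c : ℝ, 0 < c ∧ ∀ s t : ℝ, 0 < s → 0 < t →
      Tendsto (fun x : ℝ => P.real {ω | s * x < Y ω ∧ t * x < Y' ω} /
        (τ.real (Set.Ioi (κ₁ * Real.log x)) * τ.real (Set.Ioi (κ₂ * Real.log x)))) atTop
      (𝓝 (c * (s ^ (-((b j - b i) / D)) * t ^ (-((a i - a j) / D))))) := by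
  have := hM.isProbabilityMeasure
  obtain ⟨K, β, hK, htail⟩ := hM.tail
  obtain ⟨δ₀, θ, hδ₀, hθ0, hθ1, hmargin⟩ := exists_uniform_margin hM.a_nonneg hM.b_nonneg
    hM.a_le_one hM.b_le_one hM.a_summable.tendsto_atTop_zero hM.b_summable.tendsto_atTop_zero
    {i, j} hp hq (fun k hk => by
      simp only [Finset.mem_insert, Finset.mem_singleton, not_or] at hk
      exact hlt k hk.1 hk.2)
  obtain ⟨r, hr, hVr⟩ := hV
  set p := (b j - b i) / D with hpdef
  set q := (a i - a j) / D with hqdef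
  set W := restPair a b ξ V {i, j} with hW
  have hDpos : 0 < |D| := abs_pos.2 hD0
  -- Chosen so that all four perturbed exponent pairs stay within the dual margin and below the
  -- moment bound `r`.
  obtain ⟨δ, hδ, hδ1, hδ2⟩ : ∃ δ : ℝ, 0 < δ ∧ δ ≤ 1 ∧ 2 * δ / |D| ≤ min δ₀ (min (r - p) (r - q)) := by
    have hmin : 0 < min δ₀ (min (r - p) (r - q)) :=
      lt_min hδ₀ (lt_min (by linarith) (by linarith))
    refine ⟨min 1 (|D| / 2 * min δ₀ (min (r - p) (r - q))), lt_min one_pos (by positivity),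
      min_le_left _ _, ?_⟩
    rw [div_le_iff₀ hDpos]
    linarith [min_le_right 1 (|D| / 2 * min δ₀ (min (r - p) (r - q)))]
  have hexpo : ∀ e, |expo₁ (b i) (b j) D δ e - p| ≤ δ₀ ∧ |expo₂ (a i) (a j) D δ e - q| ≤ δ₀ ∧
      expo₁ (b i) (b j) D δ e ≤ r ∧ expo₂ (a i) (a j) D δ e ≤ r := by
    intro e
    have h1 := (abs_signed_comb_le (D := D) (hM.b_nonneg j) (hM.b_le_one j) (hM.b_nonneg i)
      (hM.b_le_one i) hδ e.1 e.2).trans hδ2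
    have h2 := (abs_signed_comb_le (D := D) (hM.a_nonneg i) (hM.a_le_one i) (hM.a_nonneg j)
      (hM.a_le_one j) hδ e.2 e.1).trans hδ2
    have h3 := (le_abs_self _).trans (h1.trans ((min_le_right _ _).trans (min_le_left _ _)))
    have h4 := (le_abs_self _).trans (h2.trans ((min_le_right _ _).trans (min_le_right _ _)))
    refine ⟨h1.trans (min_le_left _ _), h2.trans (min_le_left _ _), ?_, ?_⟩
    · rw [expo₁]; linarith
    · rw [expo₂]; linarith
  have hint : ∀ p' q', |p' - p| ≤ δ₀ → |q' - q| ≤ δ₀ → p' ≤ r → q' ≤ r →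
      Integrable (fun ω => (W ω).1 ^ p' * (W ω).2 ^ q') P := by
    intro p' q' h1 h2 h3 h4
    obtain ⟨e1, e2, e3⟩ := hmargin p' q' h1 h2
    exact hM.integrable_restPair {i, j} e1 e2 hθ0 hθ1 e3 (hVr p' q' e1 e2 h3 h4)
  have hpos : ∀ e, 0 < expo₁ (b i) (b j) D δ e ∧ 0 < expo₂ (a i) (a j) D δ e := fun e =>
    ⟨(hmargin _ _ (hexpo e).1 (hexpo e).2.1).1, (hmargin _ _ (hexpo e).1 (hexpo e).2.1).2.1⟩
  have hWm : Measurable W := hM.measurable_restPair {i, j}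
  have hWnn : ∀ ω, 0 ≤ (W ω).1 ∧ 0 ≤ (W ω).2 := hM.restPair_nonneg {i, j}
  set U : Ω → ℝ × ℝ := fun ω => (ξ i ω, ξ j ω) with hU
  have hUm : Measurable U := (hM.measurable_ξ i).prodMk (hM.measurable_ξ j)
  have hind : IndepFun U W P := by
    have hev : Measurable fun x : ℕ → ℝ => (x i, x j) :=
      (measurable_pi_apply i).prodMk (measurable_pi_apply j)
    have := (hM.indepFun_restPair {i, j}).comp hev measurable_id
    simpa [Function.comp_def] using this
  have hlawU : P.map U = τ.prod τ := by
    have := (indepFun_iff_map_prod_eq_prod_map_map (hM.measurable_ξ i).aemeasurable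
      (hM.measurable_ξ j).aemeasurable).1 (hM.indep_ξ.indepFun hij)
    rw [hM.law, hM.law] at this
    exact this
  have hlaw : ∀ z, (τ.prod τ).map (Prod.map (fun y => y - κ₁ * z) (fun y => y - κ₂ * z)) =
      shiftLaw τ κ₁ κ₂ z := fun z => by
    rw [shiftLaw, Measure.map_prod_map _ _ (by fun_prop) (by fun_prop)]
  have ha : a i ≠ 0 ∨ a j ≠ 0 := by
    by_contra! h
    rw [h.1, h.2] at hD
    exact hD0 (by rw [hD]; ring)
  have hb : b i ≠ 0 ∨ b j ≠ 0 := by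
    by_contra! h
    rw [h.1, h.2] at hD
    exact hD0 (by rw [hD]; ring)
  set c₀ := (expMeasure.prod expMeasure).real (wedge (a i) (a j) (b i) (b j) 0 0) with hc₀
  have hwedge := fun R R' => tendsto_shiftLaw (κ₁ := κ₁) (κ₂ := κ₂) htail hK hκ₁ hκ₂ hδ hδ1
    (Finset.sum_nonneg fun e _ => (Real.exp_pos _).le)
    (measurableSet_wedge (a i) (a j) (b i) (b j) R R') (frontier_wedge ha hb R R')
    (fun w hw => one_le_of_mem_wedge hD hD0 hpos hw)
  have hc₀pos : 0 < c₀ := ENNReal.toReal_pos (expMeasure_wedge_ne_zero (hM.a_nonneg i)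
    (hM.a_nonneg j) (hM.b_nonneg i) (hM.b_nonneg j) ha hb) (hwedge 0 0).1
  obtain ⟨C₁, hC₁, hbd⟩ := shiftLaw_bound htail hK hκ₁ hκ₂ hδ hδ1
  have hint0 := hint p q (by simpa using hδ₀.le) (by simpa using hδ₀.le) (by linarith) (by linarith)
  have hmean : 0 < ∫ ω, (W ω).1 ^ p * (W ω).2 ^ q ∂P :=
    hM.integral_restPair_pos {i, j} (fun w => w.1 ^ p * w.2 ^ q)
      (fun w h1 h2 => mul_nonneg (Real.rpow_nonneg h1 _) (Real.rpow_nonneg h2 _))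
      (fun w h1 h2 => mul_pos (Real.rpow_pos_of_pos h1 _) (Real.rpow_pos_of_pos h2 _)) hint0
  -- The constant is the limit mass of the wedge with apex at the origin times the mixed moment of
  -- `W` at the dual exponents.
  refine ⟨c₀ * ∫ ω, (W ω).1 ^ p * (W ω).2 ^ q ∂P, mul_pos hc₀pos hmean, fun s t hs ht => ?_⟩
  set E : ℝ → Set ((ℝ × ℝ) × (ℝ × ℝ)) := fun x =>
    {z | s * x < Real.exp (a i * z.1.1 + a j * z.1.2) * z.2.1 ∧
      t * x < Real.exp (b i * z.1.1 + b j * z.1.2) * z.2.2} with hE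
  have hEm : ∀ x, MeasurableSet (E x) := by
    intro x
    have h1 : MeasurableSet {z : (ℝ × ℝ) × (ℝ × ℝ) |
        s * x < Real.exp (a i * z.1.1 + a j * z.1.2) * z.2.1} :=
      measurableSet_lt (by fun_prop) (by fun_prop)
    have h2 : MeasurableSet {z : (ℝ × ℝ) × (ℝ × ℝ) |
        t * x < Real.exp (b i * z.1.1 + b j * z.1.2) * z.2.2} :=
      measurableSet_lt (by fun_prop) (by fun_prop)
    exact h1.inter h2
  have hset : ∀ x, P.real {ω | s * x < Y ω ∧ t * x < Y' ω} = P.real {ω | (U ω, W ω) ∈ E x} := by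
    intro x
    refine measureReal_congr ?_
    filter_upwards [hY, hY', hM.exp_ser_eq {i, j}] with ω h1 h2 h3
    rw [Finset.sum_pair hij, Finset.sum_pair hij] at h3
    refine propext ?_
    show (s * x < Y ω ∧ t * x < Y' ω) ↔ _
    rw [h1, h2, h3.1, h3.2]
    rfl
  have hslice0 : ∀ x, 0 < x → ∀ ω, ¬ (0 < (W ω).1 ∧ 0 < (W ω).2) →
      (P.map U).real {u | (u, W ω) ∈ E x} = 0 := by
    intro x hx ω h
    have : {u | (u, W ω) ∈ E x} = ∅ := by
      refine Set.eq_empty_of_forall_notMem fun u hu => h ⟨?_, ?_⟩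
      · exact pos_of_mul_pos_right ((mul_pos hs hx).trans hu.1) (Real.exp_pos _).le
      · exact pos_of_mul_pos_right ((mul_pos ht hx).trans hu.2) (Real.exp_pos _).le
    rw [this, measureReal_empty]
  have hslice : ∀ x, 0 < x → ∀ ω, 0 < (W ω).1 → 0 < (W ω).2 →
      (P.map U).real {u | (u, W ω) ∈ E x} = (shiftLaw τ κ₁ κ₂ (Real.log x)).real
        (wedge (a i) (a j) (b i) (b j) (Real.log ((W ω).1 / s)) (Real.log ((W ω).2 / t))) := by
    intro x hx ω h1 h2
    rw [hlawU, ← hlaw, map_measureReal_apply (by fun_prop) (measurableSet_wedge _ _ _ _ _ _)]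
    congr 1
    -- The tight constraint `c κ₁ + c' κ₂ = 1` is what makes the centring absorb the threshold `log
    -- x` exactly.
    have key : ∀ {s w y y₁ y₂ c c' : ℝ}, 0 < s → 0 < w → c * κ₁ + c' * κ₂ = 1 →
        (s * x < Real.exp (c * y₁ + c' * y₂) * w ↔
          -Real.log (w / s) < c * (y₁ - κ₁ * Real.log x) + c' * (y₂ - κ₂ * Real.log x)) := by
      intro s w y y₁ y₂ c c' hs hw hcc
      rw [← Real.log_lt_log_iff (by positivity) (by positivity), Real.log_mul hs.ne' hx.ne',
        Real.log_mul (Real.exp_pos _).ne' hw.ne', Real.log_exp, Real.log_div hw.ne' hs.ne']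
      have : c * (y₁ - κ₁ * Real.log x) + c' * (y₂ - κ₂ * Real.log x) =
          c * y₁ + c' * y₂ - Real.log x := by linear_combination -Real.log x * hcc
      rw [this]
      constructor <;> intro h <;> linarith
    ext u
    simp only [hE, wedge, Set.mem_preimage, Set.mem_inter_iff, Set.mem_ofPred_eq, Prod.map_fst,
      Prod.map_snd]
    exact and_congr (key (y := 0) hs h1 hA) (key (y := 0) ht h2 hB)
  have hrpow : ∀ {s w e : ℝ}, 0 < s → 0 < w → Real.exp (e * Real.log (w / s)) = (w / s) ^ e := by
    intro s w e hs hw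
    rw [Real.rpow_def_of_pos (div_pos hw hs), mul_comm]
  have hresult : ∫ ω, c₀ * (((W ω).1 / s) ^ p * ((W ω).2 / t) ^ q) ∂P =
      c₀ * (∫ ω, (W ω).1 ^ p * (W ω).2 ^ q ∂P) * (s ^ (-p) * t ^ (-q)) := by
    rw [← integral_const_mul, ← integral_mul_const]
    refine integral_congr_ae (ae_of_all _ fun ω => ?_)
    simp only
    rw [Real.div_rpow (hWnn ω).1 hs.le, Real.div_rpow (hWnn ω).2 ht.le, Real.rpow_neg hs.le,
      Real.rpow_neg ht.le]
    field_simp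
  simp_rw [hset]
  rw [← hresult]
  -- The bound sums over the four sign patterns, since the signs of the two centred innovations vary
  -- over the wedge.
  refine tendsto_real_div_of_indepFun hUm hWm hind E hEm _
    (fun w => C₁ * ∑ e : Bool × Bool, (w.1 / s) ^ expo₁ (b i) (b j) D δ e *
      (w.2 / t) ^ expo₂ (a i) (a j) D δ e)
    (fun w => c₀ * ((w.1 / s) ^ p * (w.2 / t) ^ q)) ?_ ?_ ?_
  · refine (integrable_finsetSum _ fun e _ => ?_).const_mul C₁
    have h := (hint _ _ (hexpo e).1 (hexpo e).2.1 (hexpo e).2.2.1 (hexpo e).2.2.2).const_mul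
      ((s ^ expo₁ (b i) (b j) D δ e)⁻¹ * (t ^ expo₂ (a i) (a j) D δ e)⁻¹)
    refine h.congr (ae_of_all _ fun ω => ?_)
    simp only
    rw [Real.div_rpow (hWnn ω).1 hs.le, Real.div_rpow (hWnn ω).2 ht.le]
    field_simp
  · filter_upwards [eventually_gt_atTop 0, Real.tendsto_log_atTop.eventually hbd] with x hx hz ω
    by_cases h : 0 < (W ω).1 ∧ 0 < (W ω).2
    · rw [hslice x hx ω h.1 h.2, abs_of_nonneg (div_nonneg measureReal_nonneg hz.1.le)]
      refine (hz.2 _ _ (Finset.sum_nonneg fun e _ => (Real.exp_pos _).le)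
        (measurableSet_wedge _ _ _ _ _ _)
        (fun w hw => one_le_of_mem_wedge hD hD0 hpos hw)).trans_eq ?_
      congr 1
      refine Finset.sum_congr rfl fun e _ => ?_
      rw [Real.exp_add, hrpow hs h.1, hrpow ht h.2]
    · rw [hslice0 x hx ω h, zero_div, abs_zero]
      refine mul_nonneg hC₁.le (Finset.sum_nonneg fun e _ => ?_)
      exact mul_nonneg (Real.rpow_nonneg (div_nonneg (hWnn ω).1 hs.le) _)
        (Real.rpow_nonneg (div_nonneg (hWnn ω).2 ht.le) _)
  · intro ω
    by_cases h : 0 < (W ω).1 ∧ 0 < (W ω).2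
    · have h1 := ((hwedge (Real.log ((W ω).1 / s)) (Real.log ((W ω).2 / t))).2).comp
        Real.tendsto_log_atTop
      rw [expMeasure_wedge hD hD0, ← hc₀, ← hpdef, ← hqdef, Real.exp_add, hrpow hs h.1,
        hrpow ht h.2, mul_comm _ c₀] at h1
      refine h1.congr' ?_
      filter_upwards [eventually_gt_atTop 0] with x hx
      rw [hslice x hx ω h.1 h.2]
      rfl
    · have h0 : c₀ * (((W ω).1 / s) ^ p * ((W ω).2 / t) ^ q) = 0 := by
        rcases not_and_or.1 h with h' | h'
        · rw [le_antisymm (not_lt.1 h') (hWnn ω).1, zero_div, Real.zero_rpow hp.ne']; ring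
        · rw [le_antisymm (not_lt.1 h') (hWnn ω).2, zero_div, Real.zero_rpow hq.ne']; ring
      rw [h0]
      refine tendsto_const_nhds.congr' ?_
      filter_upwards [eventually_gt_atTop 0] with x hx
      rw [hslice0 x hx ω h, zero_div]

end IsLinearModel

/-! ### Limit measures and regular variation of the linear model -/

/-- The measure on `(0,∞)` that gives mass `s^(-p)` to `(s,∞)`. -/
noncomputable def powMeasure (p : ℝ) : Measure ℝ := expMeasure.map fun u => Real.exp (u / p)

instance (p : ℝ) : SFinite (powMeasure p) := by unfold powMeasure; infer_instance

lemma powMeasure_Ioi {p s : ℝ} (hp : 0 < p) (hs : 0 < s) :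
    powMeasure p (Set.Ioi s) = ENNReal.ofReal (s ^ (-p)) := by
  rw [powMeasure, Measure.map_apply (by fun_prop) measurableSet_Ioi]
  have : (fun u : ℝ => Real.exp (u / p)) ⁻¹' Set.Ioi s = Set.Ioi (p * Real.log s) := by
    ext u
    rw [Set.mem_preimage, Set.mem_Ioi, Set.mem_Ioi, ← Real.log_lt_iff_lt_exp hs, lt_div_iff₀ hp,
      mul_comm]
  rw [this, expMeasure_Ioi, Real.rpow_def_of_pos hs]
  congr 2
  ring

lemma measurableSet_cone : MeasurableSet cone := measurableSet_Ioi.prod measurableSet_Ioi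

lemma prod_Ioi_subset_cone {s t : ℝ} (hs : 0 < s) (ht : 0 < t) :
    Set.Ioi s ×ˢ Set.Ioi t ⊆ cone :=
  Set.prod_mono (Set.Ioi_subset_Ioi hs.le) (Set.Ioi_subset_Ioi ht.le)

lemma restrict_cone_quadrant (m : Measure (ℝ × ℝ)) {s t : ℝ} (hs : 0 < s) (ht : 0 < t) :
    m.restrict cone (Set.Ioi s ×ˢ Set.Ioi t) = m (Set.Ioi s ×ˢ Set.Ioi t) := by
  rw [Measure.restrict_apply' measurableSet_cone, Set.inter_eq_left.2 (prod_Ioi_subset_cone hs ht)]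

lemma restrict_cone_compl (m : Measure (ℝ × ℝ)) : m.restrict cone coneᶜ = 0 := by
  rw [Measure.restrict_apply' measurableSet_cone, Set.compl_inter_self, measure_empty]

/-- The scale mixture of the pairs `(A, B)` along the measure with tail `r^(-κ)`. -/
noncomputable def mixMeasure {Ω : Type*} [MeasurableSpace Ω] (P : Measure Ω) (A B : Ω → ℝ)
    (κ : ℝ) : Measure (ℝ × ℝ) :=
  (P.prod expMeasure).map fun z => (Real.exp (z.2 / κ) * A z.1, Real.exp (z.2 / κ) * B z.1)

/-- For fixed `ω` the condition on `u` is `u > -κ log min(A/s, B/t)`, a half-line of mass `min(A/s,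
B/t)^κ`. -/
lemma mixMeasure_quadrant {Ω : Type*} [MeasurableSpace Ω] (P : Measure Ω) [IsProbabilityMeasure P]
    {A B : Ω → ℝ} {κ s t : ℝ} (hA : Measurable A) (hB : Measurable B) (hA0 : ∀ ω, 0 ≤ A ω)
    (hB0 : ∀ ω, 0 ≤ B ω) (hκ : 0 < κ) (hs : 0 < s) (ht : 0 < t)
    (hint : Integrable (minPow A B κ s t) P) :
    mixMeasure P A B κ (Set.Ioi s ×ˢ Set.Ioi t) =
      ENNReal.ofReal (∫ ω, minPow A B κ s t ω ∂P) := by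
  have hm : Measurable fun z : Ω × ℝ =>
      (Real.exp (z.2 / κ) * A z.1, Real.exp (z.2 / κ) * B z.1) := by fun_prop
  have hM0 : ∀ ω, 0 ≤ min (s⁻¹ * A ω) (t⁻¹ * B ω) := fun ω =>
    le_min (mul_nonneg (inv_nonneg.2 hs.le) (hA0 ω)) (mul_nonneg (inv_nonneg.2 ht.le) (hB0 ω))
  rw [mixMeasure, Measure.map_apply hm (measurableSet_Ioi.prod measurableSet_Ioi),
    Measure.prod_apply (hm (measurableSet_Ioi.prod measurableSet_Ioi)),
    ofReal_integral_eq_lintegral_ofReal hint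
      (ae_of_all _ fun ω => Real.rpow_nonneg (hM0 ω) _)]
  refine lintegral_congr fun ω => ?_
  have hset : Prod.mk ω ⁻¹' ((fun z : Ω × ℝ =>
      (Real.exp (z.2 / κ) * A z.1, Real.exp (z.2 / κ) * B z.1)) ⁻¹' Set.Ioi s ×ˢ Set.Ioi t) =
      {u | 1 < Real.exp (u / κ) * min (s⁻¹ * A ω) (t⁻¹ * B ω)} := by
    ext u
    simp only [Set.mem_preimage, Set.mem_prod, Set.mem_Ioi, Set.mem_ofPred_eq]
    rw [mul_min_of_nonneg _ _ (Real.exp_pos _).le, lt_min_iff, mul_left_comm, mul_left_comm _ t⁻¹,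
      inv_mul_eq_div, inv_mul_eq_div, one_lt_div hs, one_lt_div ht]
  rw [hset, minPow]
  rcases (hM0 ω).eq_or_lt with h0 | h0
  · rw [← h0, Real.zero_rpow hκ.ne']
    simp [not_lt_of_ge (zero_le_one (α := ℝ))]
  · have : {u | 1 < Real.exp (u / κ) * min (s⁻¹ * A ω) (t⁻¹ * B ω)} =
        Set.Ioi (-(κ * Real.log (min (s⁻¹ * A ω) (t⁻¹ * B ω)))) := by
      ext u
      rw [Set.mem_ofPred_eq, Set.mem_Ioi, ← Real.log_pos_iff (by positivity),
        Real.log_mul (Real.exp_pos _).ne' h0.ne', Real.log_exp]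
      constructor
      · intro h
        have := mul_lt_mul_of_pos_left h hκ
        rw [mul_add, mul_zero, mul_div_cancel₀ _ hκ.ne'] at this
        linarith
      · intro h
        refine (mul_pos_iff_of_pos_left hκ).1 ?_
        rw [mul_add, mul_div_cancel₀ _ hκ.ne']
        linarith
    rw [this, expMeasure_Ioi, neg_neg, mul_comm, ← Real.rpow_def_of_pos h0]

lemma integral_minPow_smul {Ω : Type*} [MeasurableSpace Ω] (P : Measure Ω)
    {A B : Ω → ℝ} {κ r s t : ℝ} (hA0 : ∀ ω, 0 ≤ A ω) (hB0 : ∀ ω, 0 ≤ B ω) (hr : 0 < r)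
    (hs : 0 < s) (ht : 0 < t) :
    ∫ ω, minPow A B κ (r * s) (r * t) ω ∂P = r ^ (-κ) * ∫ ω, minPow A B κ s t ω ∂P := by
  rw [← integral_const_mul]
  refine integral_congr_ae (ae_of_all _ fun ω => ?_)
  have h0 : 0 ≤ min (s⁻¹ * A ω) (t⁻¹ * B ω) :=
    le_min (mul_nonneg (inv_nonneg.2 hs.le) (hA0 ω)) (mul_nonneg (inv_nonneg.2 ht.le) (hB0 ω))
  simp only [minPow]
  rw [mul_inv, mul_inv, mul_assoc, mul_assoc, ← mul_min_of_nonneg _ _ (inv_nonneg.2 hr.le),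
    Real.mul_rpow (inv_nonneg.2 hr.le) h0, Real.inv_rpow hr.le, Real.rpow_neg hr.le]

/-- Positive thresholds see only positive parts, so returns of either sign fit a model with `V ≥ 0`.
-/
lemma tendsto_real_congr_of_max {Ω : Type*} [MeasurableSpace Ω] {P : Measure Ω}
    {Y Y' : Ω → ℝ} {s t l : ℝ} {N : ℝ → ℝ} (hs : 0 < s) (ht : 0 < t)
    (h : Tendsto (fun x : ℝ => P.real {ω | s * x < max (Y ω) 0 ∧ t * x < max (Y' ω) 0} / N x)
      atTop (𝓝 l)) :
    Tendsto (fun x : ℝ => P.real {ω | s * x < Y ω ∧ t * x < Y' ω} / N x) atTop (𝓝 l) := by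
  refine h.congr' ?_
  filter_upwards [eventually_gt_atTop 0] with x hx
  have h1 : ¬ s * x < 0 := (mul_pos hs hx).not_gt
  have h2 : ¬ t * x < 0 := (mul_pos ht hx).not_gt
  simp only [lt_max_iff, h1, h2, or_false]

namespace IsLinearModel

variable {Ω : Type*} [MeasurableSpace Ω] {P : Measure Ω} [IsProbabilityMeasure P]
  {τ : Measure ℝ} {a b : ℕ → ℝ} {ξ : ℕ → Ω → ℝ} {V : Ω → ℝ × ℝ}

/-- Regular variation on the cone when two innovations dominate. -/
theorem regVar_of_two (hM : IsLinearModel P τ a b ξ V) {κ : ℕ → ℝ} (hr : IsRigid a b κ) {i j : ℕ}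
    (hij : i ≠ j) (hi : 0 < κ i) (hj : 0 < κ j)
    (hV : ∃ r, ∑' n, κ n < r ∧ ∀ p' q', 0 < p' → 0 < q' → p' ≤ r → q' ≤ r →
      Integrable (fun ω => (V ω).1 ^ p' * (V ω).2 ^ q') P)
    {Y Y' : Ω → ℝ} (hYm : Measurable Y) (hYm' : Measurable Y')
    (hY : ∀ᵐ ω ∂P, max (Y ω) 0 = (V ω).1 * Real.exp (ser a fun k => ξ k ω))
    (hY' : ∀ᵐ ω ∂P, max (Y' ω) 0 = (V ω).2 * Real.exp (ser b fun k => ξ k ω)) :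
    (∀ s t : ℝ, 0 < s → 0 < t → Tendsto (tailRatio P Y Y' s t) atTop
      (𝓝 (s ^ ((b i - b j) / (b j * a i - b i * a j)) *
        t ^ ((a j - a i) / (b j * a i - b i * a j))))) ∧
    ∃ ν : Measure (ℝ × ℝ), IsRegVarOnCone P (fun ω => (Y ω, Y' ω)) (-∑' n, κ n) ν ∧
      ∀ s t : ℝ, 0 < s → 0 < t →
        Tendsto (tailRatio P Y Y' s t) atTop (𝓝 (ν.real (Set.Ioi s ×ˢ Set.Ioi t))) := by
  obtain ⟨D, hD⟩ : ∃ D, D = b j * a i - b i * a j := ⟨_, rfl⟩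
  obtain ⟨hD0, hp, hq, hlt, -, hA, hB, hsum⟩ := hr.dual_two hij hi hj D hD
  rw [hsum] at hV
  obtain ⟨c, hc, hlim⟩ := hM.tendsto_of_two hij hi hj hD hD0 hp hq hlt hA hB hV hY hY'
  rw [← hD, hsum, ← neg_sub (b j) (b i), ← neg_sub (a i) (a j), neg_div, neg_div]
  set p := (b j - b i) / D
  set q := (a i - a j) / D
  -- The limit `c s^(-p) t^(-q)` factorises, so the limit measure is a multiple of a product of two
  -- power measures.
  have key := isRegVarOnCone_of_tendsto P hYm hYm'
    (fun x => τ.real (Set.Ioi (κ i * Real.log x)) * τ.real (Set.Ioi (κ j * Real.log x)))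
    (fun s t => c * (s ^ (-p) * t ^ (-q)))
    ((ENNReal.ofReal c • (powMeasure p).prod (powMeasure q)).restrict cone)
    (ρ := -(p + q)) (by linarith) (restrict_cone_compl _) ?_ ?_ ?_ ?_ ?_
  · refine ⟨fun s t hs ht => ?_, key.2⟩
    have := key.1 s t hs ht
    simpa [hc.ne'] using this
  · intro s t hs ht
    rw [restrict_cone_quadrant _ hs ht, Measure.smul_apply, Measure.prod_prod,
      powMeasure_Ioi hp hs, powMeasure_Ioi hq ht, smul_eq_mul, ENNReal.ofReal_mul hc.le,
      ENNReal.ofReal_mul (by positivity)]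
  · intro s t hs ht
    positivity
  · simpa using hc
  · intro r s t hr hs ht
    rw [Real.mul_rpow hr.le hs.le, Real.mul_rpow hr.le ht.le, neg_add, Real.rpow_add hr]
    ring
  · exact fun s t hs ht => tendsto_real_congr_of_max hs ht (hlim s t hs ht)

/-- Regular variation on the cone when a single innovation dominates. -/
theorem regVar_of_single (hM : IsLinearModel P τ a b ξ V) {κ : ℕ → ℝ} (hr : IsRigid a b κ)
    (hma : ∃ m, a m = 1) (hmb : ∃ m, b m = 1) {i : ℕ} (hi : 0 < κ i) (hz : ∀ j, j ≠ i → κ j = 0)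
    (hV : ∃ r, ∑' n, κ n < r ∧ ∀ p' q', 0 < p' → 0 < q' → p' ≤ r → q' ≤ r →
      Integrable (fun ω => (V ω).1 ^ p' * (V ω).2 ^ q') P)
    {Y Y' : Ω → ℝ} (hYm : Measurable Y) (hYm' : Measurable Y')
    (hY : ∀ᵐ ω ∂P, max (Y ω) 0 = (V ω).1 * Real.exp (ser a fun k => ξ k ω))
    (hY' : ∀ᵐ ω ∂P, max (Y' ω) 0 = (V ω).2 * Real.exp (ser b fun k => ξ k ω))
    {A B : Ω → ℝ} (hAB : ∀ᵐ ω ∂P, restPair a b ξ V {i} ω = (A ω, B ω)) :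
    0 < ∫ ω, minPow A B (1 / b i) 1 1 ω ∂P ∧
    (∀ s t : ℝ, 0 < s → 0 < t → Integrable (minPow A B (1 / b i) s t) P ∧
      Tendsto (tailRatio P Y Y' s t) atTop
        (𝓝 ((∫ ω, minPow A B (1 / b i) s t ω ∂P) / ∫ ω, minPow A B (1 / b i) 1 1 ω ∂P))) ∧
    ∃ ν : Measure (ℝ × ℝ), IsRegVarOnCone P (fun ω => (Y ω, Y' ω)) (-∑' n, κ n) ν ∧
      ∀ s t : ℝ, 0 < s → 0 < t →
        Tendsto (tailRatio P Y Y' s t) atTop (𝓝 (ν.real (Set.Ioi s ×ˢ Set.Ioi t))) := by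
  obtain ⟨hab, hb, hbκ, hsum, p, q, hp, hq, hpq, hlt⟩ := hr.dual_one hM.a_nonneg hM.b_nonneg
    hM.a_le_one hM.b_le_one hma hmb hM.a_summable.tendsto_atTop_zero
    hM.b_summable.tendsto_atTop_zero hi hz
  have hinv : 1 / b i = κ i := by rw [div_eq_iff hb.ne', mul_comm]; exact hbκ.symm
  rw [hsum] at hV ⊢
  rw [hinv]
  rw [← hpq] at hV
  set A₀ : Ω → ℝ := fun ω => (restPair a b ξ V {i} ω).1 with hA₀
  set B₀ : Ω → ℝ := fun ω => (restPair a b ξ V {i} ω).2 with hB₀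
  -- `A` and `B` are given only up to null sets, so the argument runs with the everywhere
  -- nonnegative `A₀`, `B₀`.
  have hae : ∀ s t : ℝ, minPow A₀ B₀ (κ i) s t =ᵐ[P] minPow A B (κ i) s t := by
    intro s t
    filter_upwards [hAB] with ω hω
    simp only [minPow, hA₀, hB₀, hω]
  have hcore := fun (s t : ℝ) (hs : 0 < s) (ht : 0 < t) =>
    hM.tendsto_of_single hab hb hbκ hp hq hpq hlt hV hY hY' hs ht
  have hA0 : ∀ ω, 0 ≤ A₀ ω := fun ω => (hM.restPair_nonneg {i} ω).1
  have hB0 : ∀ ω, 0 ≤ B₀ ω := fun ω => (hM.restPair_nonneg {i} ω).2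
  have hpos : 0 < ∫ ω, minPow A₀ B₀ (κ i) 1 1 ω ∂P := by
    refine hM.integral_restPair_pos {i}
      (fun z => (min ((1 : ℝ)⁻¹ * z.1) ((1 : ℝ)⁻¹ * z.2)) ^ κ i) ?_ ?_
      (hcore 1 1 one_pos one_pos).1
    · intro z h1 h2
      exact Real.rpow_nonneg (le_min (by simpa using h1) (by simpa using h2)) _
    · intro z h1 h2
      exact Real.rpow_pos_of_pos (lt_min (by simpa using h1) (by simpa using h2)) _
  have hmeas := hM.measurable_restPair {i}
  have key := isRegVarOnCone_of_tendsto P hYm hYm'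
    (fun x => τ.real (Set.Ioi (κ i * Real.log x)))
    (fun s t => ∫ ω, minPow A₀ B₀ (κ i) s t ω ∂P)
    ((mixMeasure P A₀ B₀ (κ i)).restrict cone) (ρ := -κ i) (by linarith) (restrict_cone_compl _)
    (fun s t hs ht => by
      rw [restrict_cone_quadrant _ hs ht]
      exact mixMeasure_quadrant P hmeas.fst hmeas.snd hA0 hB0 hi hs ht (hcore s t hs ht).1)
    (fun s t hs ht => integral_nonneg fun ω => Real.rpow_nonneg
      (le_min (mul_nonneg (inv_nonneg.2 hs.le) (hA0 ω))
        (mul_nonneg (inv_nonneg.2 ht.le) (hB0 ω))) _)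
    hpos (fun r s t hr hs ht => integral_minPow_smul P hA0 hB0 hr hs ht)
    (fun s t hs ht => tendsto_real_congr_of_max hs ht (hcore s t hs ht).2)
  refine ⟨by rwa [← integral_congr_ae (hae 1 1)], fun s t hs ht =>
    ⟨(hcore s t hs ht).1.congr (hae s t), ?_⟩, key.2⟩
  rw [← integral_congr_ae (hae 1 1), ← integral_congr_ae (hae s t)]
  exact key.1 s t hs ht

end IsLinearModel

/-! ### Reduction of the stochastic volatility model to the linear model -/

lemma lag_add (α : ℕ → ℝ) (h n : ℕ) : lag α h (n + h) = α n := by simp [lag]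

lemma summable_lag {α : ℕ → ℝ} (hα : Summable α) (h : ℕ) : Summable (lag α h) :=
  (summable_nat_add_iff h).1 (by simpa only [lag_add] using hα)

lemma ser_lag {α x : ℕ → ℝ} {h : ℕ} (hs : Summable fun k => lag α h k * x k) :
    ser (lag α h) x = ser α fun n => x (n + h) := by
  have h0 : ∑ k ∈ Finset.range h, lag α h k * x k = 0 :=
    Finset.sum_eq_zero fun k hk => by
      rw [lag, if_neg (not_le.2 (Finset.mem_range.1 hk)), zero_mul]
  rw [ser, ← hs.sum_add_tsum_nat_add h, h0, zero_add]
  simp only [lag_add, ser]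

lemma rpow_le_one_add_rpow {x p r : ℝ} (hx : 0 ≤ x) (hp : 0 < p) (hpr : p ≤ r) :
    x ^ p ≤ 1 + x ^ r := by
  rcases le_total x 1 with h | h
  · exact (Real.rpow_le_one hx h hp.le).trans (le_add_of_nonneg_right (Real.rpow_nonneg hx _))
  · exact (Real.rpow_le_rpow_of_exponent_le h hpr).trans (le_add_of_nonneg_left zero_le_one)

namespace IsGammaSVModel

variable {Ω : Type*} [MeasurableSpace Ω] {P : Measure Ω}
  {α : ℕ → ℝ} {ε η σ X : ℤ → Ω → ℝ}

lemma summable_α (hm : IsGammaSVModel P α ε η σ X) : Summable α := by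
  obtain ⟨θ, hθ, hO⟩ := hm.α_decay
  exact summable_of_isBigO_nat (Real.summable_nat_rpow.2 (by linarith)) hO

/-- The choice `φ = 1` describes the volatilities and `φ(x) = max x 0` the returns. Counting
innovations backwards from time `h` lets both dates share one sequence. -/
lemma isLinearModel [IsProbabilityMeasure P] (hm : IsGammaSVModel P α ε η σ X) {h : ℕ}
    (hh : 1 ≤ h) {φ : ℝ → ℝ}
    (hφ : Measurable φ) (hφ0 : ∀ x, 0 ≤ φ x) (hφpos : ∀ x, 0 < x → 0 < φ x) :
    IsLinearModel P (P.map (η 0)) (lag α h) α (fun k => η ((h : ℤ) - (k : ℕ)))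
      (fun ω => (φ (ε 0 ω), φ (ε h ω))) := by
  have hle : ∀ i, α i ≤ 1 := fun i => hm.α_max.2 ⟨i, rfl⟩
  refine
    { measurable_ξ := fun k => hm.measurable_η _
      measurable_V := (hφ.comp (hm.measurable_ε 0)).prodMk (hφ.comp (hm.measurable_ε h))
      indep_ξ := hm.indep_η.precomp (g := fun k : ℕ => (h : ℤ) - k) fun k l hkl => by
        have : (h : ℤ) - k = h - l := hkl
        omega
      indep := ?_
      law := fun k => (hm.ident_η _).map_eq
      integrable_id := ?_
      a_nonneg := lag_nonneg hm.α_nonneg h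
      b_nonneg := hm.α_nonneg
      a_le_one := lag_le_one hle h
      b_le_one := hle
      a_summable := summable_lag hm.summable_α h
      b_summable := hm.summable_α
      V_nonneg := fun ω => ⟨hφ0 _, hφ0 _⟩
      V_pos := ?_
      tail := ?_ }
  · refine hm.indep_η_ε.comp (φ := fun (x : ℤ → ℝ) (k : ℕ) => x ((h : ℤ) - (k : ℕ)))
      (ψ := fun x : ℤ → ℝ => (φ (x 0), φ (x h))) ?_ ?_
    · exact measurable_pi_lambda _ fun k => measurable_pi_apply _
    · exact (hφ.comp (measurable_pi_apply _)).prodMk (hφ.comp (measurable_pi_apply _))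
  · rw [integrable_map_measure measurable_id.aestronglyMeasurable (hm.measurable_η 0).aemeasurable]
    exact ((memLp_two_iff_integrable_sq (hm.measurable_η 0).aestronglyMeasurable).2
      hm.moment_η).integrable one_le_two
  · have hind : IndepFun (ε 0) (ε h) P := hm.indep_ε.indepFun (by omega)
    have hpos : P {ω | 0 < ε 0 ω} * P {ω | 0 < ε h ω} ≠ 0 := by
      have := (hm.ident_ε h).measure_mem_eq (measurableSet_Ioi (a := (0 : ℝ)))
      have h2 : P {ω | 0 < ε h ω} = P {ω | 0 < ε 0 ω} := this
      rw [h2]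
      exact mul_ne_zero hm.pos_ε.ne' hm.pos_ε.ne'
    have hmul := hind.measure_inter_preimage_eq_mul _ _ (measurableSet_Ioi (a := (0 : ℝ)))
      (measurableSet_Ioi (a := (0 : ℝ)))
    refine fun h0 => hpos (Eq.trans hmul.symm (measure_mono_null ?_ h0))
    exact fun ω hω => ⟨hφpos _ hω.1, hφpos _ hω.2⟩
  · obtain ⟨K, β, hK, -, htail⟩ := hm.tail_η
    refine ⟨K, β, hK, ?_⟩
    have : (fun z : ℝ => (P.map (η 0)).real (Set.Ioi z)) = fun z => P.real {ω | z < η 0 ω} := by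
      funext z
      rw [map_measureReal_apply (hm.measurable_η 0) measurableSet_Ioi]
      rfl
    rw [HasGammaTail, this]
    exact htail

/-- `ε 0` and `ε h` are independent because `h ≥ 1`, so each needs only its own moment of order at
most `r`. -/
lemma integrable_rpow_mul [IsProbabilityMeasure P] (hm : IsGammaSVModel P α ε η σ X) {h : ℕ}
    (hh : 1 ≤ h) {φ : ℝ → ℝ}
    (hφ : Measurable φ) (hφ0 : ∀ x, 0 ≤ φ x) {r p q : ℝ} (hp : 0 < p) (hq : 0 < q) (hpr : p ≤ r)
    (hqr : q ≤ r) (hint : Integrable (fun ω => φ (ε 0 ω) ^ r) P) :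
    Integrable (fun ω => φ (ε 0 ω) ^ p * φ (ε h ω) ^ q) P := by
  have hle : ∀ p, 0 < p → p ≤ r → Integrable (fun ω => φ (ε 0 ω) ^ p) P := by
    intro p hp hpr
    refine ((integrable_const (1 : ℝ)).add hint).mono'
      ((hφ.comp (hm.measurable_ε 0)).pow_const p).aestronglyMeasurable (ae_of_all _ fun ω => ?_)
    rw [Real.norm_of_nonneg (Real.rpow_nonneg (hφ0 _) _)]
    exact rpow_le_one_add_rpow (hφ0 _) hp hpr
  have hind : IndepFun (fun ω => φ (ε 0 ω) ^ p) (fun ω => φ (ε h ω) ^ q) P :=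
    (hm.indep_ε.indepFun (show (0 : ℤ) ≠ h by omega)).comp (hφ.pow_const p) (hφ.pow_const q)
  exact hind.integrable_mul (hle p hp hpr)
    (((hm.ident_ε h).comp (hφ.pow_const q)).integrable_iff.2 (hle q hq hqr))

/-- The series converge absolutely almost surely, so the limit of partial sums agrees with the
unordered sum, and time 0 is reindexed by `η_{-n} = η_{h-(n+h)}`. -/
lemma log_volatility_eq [IsProbabilityMeasure P] (hm : IsGammaSVModel P α ε η σ X) {h : ℕ} (hh : 1 ≤ h) :
    ∀ᵐ ω ∂P, 0 < σ 0 ω ∧ 0 < σ h ω ∧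
      σ 0 ω = Real.exp (ser (lag α h) fun k => η ((h : ℤ) - (k : ℕ)) ω) ∧
      σ h ω = Real.exp (ser α fun k => η ((h : ℤ) - (k : ℕ)) ω) := by
  have hM := hm.isLinearModel hh (φ := fun _ => 1) measurable_const (fun _ => zero_le_one)
    fun _ _ => one_pos
  filter_upwards [ae_summable_mul hM.a_summable hM.a_nonneg hM.measurable_ξ hM.law
    hM.integrable_id, ae_summable_mul hM.b_summable hM.b_nonneg hM.measurable_ξ hM.law
    hM.integrable_id, hm.pos_σ 0, hm.pos_σ h, hm.log_σ 0, hm.log_σ h] with ω h1 h2 h3 h4 h5 h6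
  refine ⟨h3, h4, ?_, ?_⟩
  · have hs : Summable fun n : ℕ => α n * η (0 - (n : ℕ)) ω := by
      have := (summable_nat_add_iff h).2 h1
      simp only [lag_add] at this
      refine this.congr fun n => ?_
      congr 2
      push_cast
      ring_nf
    have : ser (lag α h) (fun k => η ((h : ℤ) - (k : ℕ)) ω) = Real.log (σ 0 ω) := by
      rw [ser_lag h1, ← tendsto_nhds_unique hs.hasSum.tendsto_sum_nat h5]
      refine tsum_congr fun n => ?_
      congr 2
      push_cast
      ring_nf
    rw [this, Real.exp_log h3]
  · have : ser α (fun k => η ((h : ℤ) - (k : ℕ)) ω) = Real.log (σ h ω) :=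
      tendsto_nhds_unique h2.hasSum.tendsto_sum_nat h6
    rw [this, Real.exp_log h4]

/-- Almost sure absolute convergence of the exponents permits passing from the infinite product to
the exponential of a series; elsewhere both sides are default values. -/
lemma restProd_eq [IsProbabilityMeasure P] (hm : IsGammaSVModel P α ε η σ X) {c : ℕ → ℝ} (hc : Summable c)
    (hc0 : ∀ k, 0 ≤ c k) (h i : ℕ) : ∀ᵐ ω ∂P, restProd η c h i ω =
      Real.exp (ser c fun k => if k ∈ ({i} : Finset ℕ) then 0 else η ((h : ℤ) - (k : ℕ)) ω) := by
  have hint : Integrable id (P.map (η 0)) := by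
    rw [integrable_map_measure measurable_id.aestronglyMeasurable (hm.measurable_η 0).aemeasurable]
    exact ((memLp_two_iff_integrable_sq (hm.measurable_η 0).aestronglyMeasurable).2
      hm.moment_η).integrable one_le_two
  filter_upwards [ae_summable_mul hc hc0 (ξ := fun k => η ((h : ℤ) - (k : ℕ)))
    (fun k => hm.measurable_η _) (fun k => (hm.ident_η _).map_eq) hint] with ω hω
  have hs : Summable fun k : {k : ℕ // k ≠ i} => η ((h : ℤ) - (k : ℕ)) ω * c k := by
    refine (hω.subtype {k | k ≠ i}).congr fun k => ?_
    exact mul_comm _ _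
  rw [restProd, ← Real.rexp_tsum_eq_tprod (fun _ => Real.exp_pos _) (by simpa using hs)]
  congr 1
  simp only [Real.log_exp]
  refine (tsum_subtype {k | k ≠ i} fun k => η ((h : ℤ) - (k : ℕ)) ω * c k).trans
    (tsum_congr fun k => ?_)
  by_cases hk : k = i
  · simp [hk]
  · rw [Set.indicator_of_mem hk, mul_comm]
    simp [hk]

end IsGammaSVModel

end GammaSV

/-! ### Assembly for volatilities and returns -/

theorem mainTheorem2 {Ω : Type*} [MeasurableSpace Ω] (P : Measure Ω) [IsProbabilityMeasure P]
    (α : ℕ → ℝ) (ε η σ X : ℤ → Ω → ℝ) (hmodel : GammaSV.IsGammaSVModel P α ε η σ X)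
    (h : ℕ) (hh : 1 ≤ h) (κ : ℕ → ℝ)
    (hopt : GammaSV.IsOptimal α h κ)
    (hunique : ∀ κ' : ℕ → ℝ, GammaSV.IsOptimal α h κ' → κ' = κ)
    (hmoment : ∃ δ : ℝ, 0 < δ ∧
      Integrable (fun ω => (max (ε 0 ω) 0) ^ ((∑' i, κ i) + δ)) P) :
    -- two positive components of the solution
    (∀ i j : ℕ, i ≠ j → 0 < κ i → 0 < κ j → ∀ s₀ s₁ : ℝ, 0 < s₀ → 0 < s₁ →
      let D : ℝ := α j * GammaSV.lag α h i - α i * GammaSV.lag α h j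
      let G : ℝ := s₀ ^ ((α i - α j) / D) *
        s₁ ^ ((GammaSV.lag α h j - GammaSV.lag α h i) / D)
      Tendsto (GammaSV.tailRatio P (σ 0) (σ h) s₀ s₁) atTop (𝓝 G) ∧
      Tendsto (GammaSV.tailRatio P (X 0) (X h) s₀ s₁) atTop (𝓝 G)) ∧
    -- exactly one positive component of the solution
    (∀ i : ℕ, 0 < κ i → (∀ j, j ≠ i → κ j = 0) →
      h ≤ i ∧ α i = α (i - h) ∧
      let A : Ω → ℝ := GammaSV.restProd η (GammaSV.lag α h) h i
      let B : Ω → ℝ := GammaSV.restProd η α h i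
      let A' : Ω → ℝ := fun ω => max (ε 0 ω) 0 * A ω
      let B' : Ω → ℝ := fun ω => max (ε h ω) 0 * B ω
      0 < ∫ ω, GammaSV.minPow A B (1 / α i) 1 1 ω ∂P ∧
      0 < ∫ ω, GammaSV.minPow A' B' (1 / α i) 1 1 ω ∂P ∧
      ∀ s₀ s₁ : ℝ, 0 < s₀ → 0 < s₁ →
        Integrable (GammaSV.minPow A B (1 / α i) s₀ s₁) P ∧
        Integrable (GammaSV.minPow A' B' (1 / α i) s₀ s₁) P ∧
        Tendsto (GammaSV.tailRatio P (σ 0) (σ h) s₀ s₁) atTop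
          (𝓝 ((∫ ω, GammaSV.minPow A B (1 / α i) s₀ s₁ ω ∂P) /
            ∫ ω, GammaSV.minPow A B (1 / α i) 1 1 ω ∂P)) ∧
        Tendsto (GammaSV.tailRatio P (X 0) (X h) s₀ s₁) atTop
          (𝓝 ((∫ ω, GammaSV.minPow A' B' (1 / α i) s₀ s₁ ω ∂P) /
            ∫ ω, GammaSV.minPow A' B' (1 / α i) 1 1 ω ∂P))) ∧
    -- regular variation on the cone, with limit measures determined by the limits above
    (∃ ν : Measure (ℝ × ℝ),
      GammaSV.IsRegVarOnCone P (fun ω => (σ 0 ω, σ h ω)) (-∑' i, κ i) ν ∧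
      ∀ s₀ s₁ : ℝ, 0 < s₀ → 0 < s₁ → Tendsto (GammaSV.tailRatio P (σ 0) (σ h) s₀ s₁) atTop
        (𝓝 (ν.real (Set.Ioi s₀ ×ˢ Set.Ioi s₁)))) ∧
    (∃ ν : Measure (ℝ × ℝ),
      GammaSV.IsRegVarOnCone P (fun ω => (X 0 ω, X h ω)) (-∑' i, κ i) ν ∧
      ∀ s₀ s₁ : ℝ, 0 < s₀ → 0 < s₁ → Tendsto (GammaSV.tailRatio P (X 0) (X h) s₀ s₁) atTop
        (𝓝 (ν.real (Set.Ioi s₀ ×ˢ Set.Ioi s₁)))) := by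
  have hα1 : ∀ i, α i ≤ 1 := fun i => hmodel.α_max.2 ⟨i, rfl⟩
  have hr := hopt.isRigid hmodel.α_nonneg hmodel.α_max hunique
  obtain ⟨m, hmα⟩ := hmodel.α_max.1
  have hma : ∃ m, GammaSV.lag α h m = 1 := ⟨m + h, by rw [GammaSV.lag_add, hmα]⟩
  have hmb : ∃ m, α m = 1 := ⟨m, hmα⟩
  have hMσ := hmodel.isLinearModel hh (φ := fun _ => 1) measurable_const (fun _ => zero_le_one)
    fun _ _ => one_pos
  have hφ : Measurable fun x : ℝ => max x 0 := by fun_prop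
  have hφ0 : ∀ x : ℝ, 0 ≤ max x 0 := fun x => le_max_right _ _
  have hMX := hmodel.isLinearModel hh hφ hφ0 fun x hx => lt_max_of_lt_left hx
  obtain ⟨δ, hδ, hmom⟩ := hmoment
  -- For the volatilities `V = (1, 1)` has all moments; for the returns the extra `δ` in the moment
  -- assumption supplies `r`.
  have hVσ : ∃ r, ∑' n, κ n < r ∧ ∀ p' q' : ℝ, 0 < p' → 0 < q' → p' ≤ r → q' ≤ r →
      Integrable (fun _ : Ω => (1 : ℝ) ^ p' * (1 : ℝ) ^ q') P :=
    ⟨_, lt_add_one _, fun _ _ _ _ _ _ => integrable_const _⟩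
  have hVX : ∃ r, ∑' n, κ n < r ∧ ∀ p' q' : ℝ, 0 < p' → 0 < q' → p' ≤ r → q' ≤ r →
      Integrable (fun ω => (max (ε 0 ω) 0) ^ p' * (max (ε h ω) 0) ^ q') P :=
    ⟨_, lt_add_of_pos_right _ hδ, fun _ _ hp hq hpr hqr =>
      hmodel.integrable_rpow_mul hh hφ hφ0 hp hq hpr hqr hmom⟩
  have hlog := hmodel.log_volatility_eq hh
  have hσ0 : ∀ᵐ ω ∂P, max (σ 0 ω) 0 =
      1 * Real.exp (GammaSV.ser (GammaSV.lag α h) fun k => η ((h : ℤ) - (k : ℕ)) ω) := by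
    filter_upwards [hlog] with ω hω
    rw [max_eq_left hω.1.le, one_mul, hω.2.2.1]
  have hσh : ∀ᵐ ω ∂P, max (σ h ω) 0 =
      1 * Real.exp (GammaSV.ser α fun k => η ((h : ℤ) - (k : ℕ)) ω) := by
    filter_upwards [hlog] with ω hω
    rw [max_eq_left hω.2.1.le, one_mul, hω.2.2.2]
  have hX0 : ∀ᵐ ω ∂P, max (X 0 ω) 0 = max (ε 0 ω) 0 *
      Real.exp (GammaSV.ser (GammaSV.lag α h) fun k => η ((h : ℤ) - (k : ℕ)) ω) := by
    filter_upwards [hlog, hmodel.X_eq 0] with ω hω hX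
    rw [← hω.2.2.1, hX, max_mul_of_nonneg _ _ hω.1.le, zero_mul, mul_comm]
  have hXh : ∀ᵐ ω ∂P, max (X h ω) 0 = max (ε h ω) 0 *
      Real.exp (GammaSV.ser α fun k => η ((h : ℤ) - (k : ℕ)) ω) := by
    filter_upwards [hlog, hmodel.X_eq h] with ω hω hX
    rw [← hω.2.2.2, hX, max_mul_of_nonneg _ _ hω.2.1.le, zero_mul, mul_comm]
  have htwoσ := fun (i j : ℕ) (hij : i ≠ j) (hi : 0 < κ i) (hj : 0 < κ j) =>
    hMσ.regVar_of_two hr hij hi hj hVσ (hmodel.measurable_σ 0) (hmodel.measurable_σ h) hσ0 hσh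
  have htwoX := fun (i j : ℕ) (hij : i ≠ j) (hi : 0 < κ i) (hj : 0 < κ j) =>
    hMX.regVar_of_two hr hij hi hj hVX (hmodel.measurable_X 0) (hmodel.measurable_X h) hX0 hXh
  have hrest : ∀ i, ∀ᵐ ω ∂P, GammaSV.restProd η (GammaSV.lag α h) h i ω = _ ∧
      GammaSV.restProd η α h i ω = _ := fun i =>
    (hmodel.restProd_eq hMσ.a_summable hMσ.a_nonneg h i).and
      (hmodel.restProd_eq hMσ.b_summable hMσ.b_nonneg h i)
  have honeσ := fun (i : ℕ) (hi : 0 < κ i) (hz : ∀ j, j ≠ i → κ j = 0) =>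
    hMσ.regVar_of_single hr hma hmb hi hz hVσ (hmodel.measurable_σ 0) (hmodel.measurable_σ h)
      hσ0 hσh (A := GammaSV.restProd η (GammaSV.lag α h) h i) (B := GammaSV.restProd η α h i)
      (by
        filter_upwards [hrest i] with ω hω
        rw [hω.1, hω.2, GammaSV.restPair, one_mul, one_mul])
  have honeX := fun (i : ℕ) (hi : 0 < κ i) (hz : ∀ j, j ≠ i → κ j = 0) =>
    hMX.regVar_of_single hr hma hmb hi hz hVX (hmodel.measurable_X 0) (hmodel.measurable_X h)
      hX0 hXh (A := fun ω => max (ε 0 ω) 0 * GammaSV.restProd η (GammaSV.lag α h) h i ω)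
      (B := fun ω => max (ε h ω) 0 * GammaSV.restProd η α h i ω)
      (by
        filter_upwards [hrest i] with ω hω
        rw [hω.1, hω.2, GammaSV.restPair])
  obtain ⟨i₀, hi₀⟩ : ∃ i, 0 < κ i := by
    by_contra! hcon
    have h0 : ∀ n, α n * κ n = 0 := fun n => by rw [le_antisymm (hcon n) (hr.nonneg n), mul_zero]
    have := hr.le_b
    simp only [h0, tsum_zero] at this
    linarith
  refine ⟨?_, ?_, ?_, ?_⟩
  · exact fun i j hij hi hj s t hs ht =>
      ⟨(htwoσ i j hij hi hj).1 s t hs ht, (htwoX i j hij hi hj).1 s t hs ht⟩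
  · intro i hi hz
    obtain ⟨hab, hb, -⟩ := hr.dual_one hMσ.a_nonneg hMσ.b_nonneg hMσ.a_le_one hMσ.b_le_one
      hma hmb hMσ.a_summable.tendsto_atTop_zero hMσ.b_summable.tendsto_atTop_zero hi hz
    -- For `i < h` the shifted coefficient would be zero, although it equals `α i > 0`.
    have hhi : h ≤ i := by
      by_contra hcon
      rw [GammaSV.lag, if_neg hcon] at hab
      exact hb.ne hab
    rw [GammaSV.lag, if_pos hhi] at hab
    refine ⟨hhi, hab.symm, (honeσ i hi hz).1, (honeX i hi hz).1, fun s t hs ht => ?_⟩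
    exact ⟨((honeσ i hi hz).2.1 s t hs ht).1, ((honeX i hi hz).2.1 s t hs ht).1,
      ((honeσ i hi hz).2.1 s t hs ht).2, ((honeX i hi hz).2.1 s t hs ht).2⟩
  · by_cases hz : ∀ j, j ≠ i₀ → κ j = 0
    · exact (honeσ i₀ hi₀ hz).2.2
    · push Not at hz
      obtain ⟨j, hj, hκj⟩ := hz
      exact (htwoσ i₀ j hj.symm hi₀ ((hr.nonneg j).lt_of_ne' hκj)).2
  · by_cases hz : ∀ j, j ≠ i₀ → κ j = 0
    · exact (honeX i₀ hi₀ hz).2.2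
    · push Not at hz
      obtain ⟨j, hj, hκj⟩ := hz
      exact (htwoX i₀ j hj.symm hi₀ ((hr.nonneg j).lt_of_ne' hκj)).2
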